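/- **Setting.** Let $\Omega\subset\mathbb R^3$ be a bounded domain with Lipschitz boundary $\Gamma$ and outer unit normal $n$, and let $\varepsilon,\mu>0$ be constants. Let $\nu_E,\nu_H\in C^2([0,\infty))$ be real-valued kernels with $\lim_{t\to\infty}\nu_E'(t)=\lim_{t\to\infty}\nu_H'(t)=0$, and let $C,\delta>0$ be such that $|\nu_E''(t)|\le w(t)$ and $|\nu_H''(t)|\le w(t)$ for all $t\ge 0$, where $w(t)=Ce^{-\delta t}$. Put $$J(\Omega)=\{\chi\in L^2(\Omega)^3:\ \operatorname{div}\chi=0\},\qquad \hat J(\Omega)=\{\chi\in J(\Omega):\ \chi\cdot n=0\text{ on }\Gamma\}$$ (complex-valued fields, with $\operatorname{div}$, $\operatorname{curl}$ and the traces understood in the weak sense). For a Hilbert space $X$ let $L^2_w((0,\infty);X)$ be the space of $\eta:(0,\infty)\to X$ with $\int_0^\infty\|\eta(s)\|_X^2\,w(s)\,ds<\infty$. Let $$\mathcal H=J(\Omega)\times\hat J(\Omega)\times L^2_w((0,\infty);J(\Omega))\times L^2_w((0,\infty);\hat J(\Omega))$$ with the inner product $$\big((E,H,\eta_E,\eta_H),(E',H',\eta_E',\eta_H')\big)_{\mathcal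 H}=\int_\Omega(\varepsilon E\cdot\bar E'+\mu H\cdot\bar H')\,dx+\int_0^\infty\!\!\int_\Omega(\eta_E\cdot\bar\eta_E'+\eta_H\cdot\bar\eta_H')\,dx\,w(s)\,ds .$$ Let $\mathcal A$ be the operator in $\mathcal H$ whose domain $D(\mathcal A)$ consists of all $(E,H,\eta_E,\eta_H)\in\mathcal H$ such that $\operatorname{curl}E,\operatorname{curl}H\in L^2(\Omega)^3$, $E\times n=0$ on $\Gamma$, $\partial_s\eta_E\in L^2_w((0,\infty);J(\Omega))$, $\partial_s\eta_H\in L^2_w((0,\infty);\hat J(\Omega))$ and $\eta_E(0)=\eta_H(0)=0$, and which is given by $$\mathcal A\begin{pmatrix}E\\H\\\eta_E\\\eta_H\end{pmatrix}=\begin{pmatrix}\varepsilon^{-1}\big(-\nu_E(0)E+\int_0^\infty\nu_E''(s)\eta_E(\cdot,s)\,ds+\operatorname{curl}H\big)\\ \mu^{-1}\big(-\nu_H(0)H+\int_0^\infty\nu_H''(s)\eta_H(\cdot,s)\,ds-\operatorname{curl}E\big)\\ -\partial_s\eta_E+E\\ -\partial_s\eta_H+H\end{pmatrix}.$$ **Theorem.**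 The operator $\mathcal A$ generates a $C_0$-semigroup $(T(t))_{t\ge0}$ on $\mathcal H$. For every $U_0\in\mathcal H$ the function $U(t)=T(t)U_0$, $t\ge0$, belongs to $C([0,\infty),\mathcal H)$ and is a weak solution of the Cauchy problem $U_t=\mathcal AU$, $U(0)=U_0$; that is, $U(0)=U_0$ and, for every $V\in D(\mathcal A^*)$, the function $t\mapsto(U(t),V)_{\mathcal H}$ is differentiable on $[0,\infty)$ with derivative $(U(t),\mathcal A^*V)_{\mathcal H}$. If moreover $U_0\in D(\mathcal A^k)$ for an integer $k\ge1$, then $U$ is a strong solution of this problem: $U\in C([0,\infty),D(\mathcal A^k))\cap C^1([0,\infty),D(\mathcal A^{k-1}))$ (graph norms, $\mathcal A^0=I$), and $U_t(t)=\mathcal AU(t)$ for all $t\ge0$. -/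

import Mathlib

open MeasureTheory Set Filter Topology
open scoped ContDiff

noncomputable section

namespace DispersiveMaxwell

/-! ### Vector calculus in three space dimensions -/

/-- The physical space. -/
abbrev R3 := EuclideanSpace ℝ (Fin 3)

/-- The values of the (complex) fields. -/
abbrev C3 := EuclideanSpace ℂ (Fin 3)

/-- `φ` is smooth with compact support contained in `S`. -/
structure IsTest {V F : Type*} [NormedAddCommGroup V] [NormedSpace ℝ V]
    [NormedAddCommGroup F] [NormedSpace ℝ F] (φ : V → F) (S : Set V) : Prop where
  smooth : ContDiff ℝ ∞ φ
  compact : HasCompactSupport φ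
  support : tsupport φ ⊆ S

/-- The classical partial derivative `∂ᵢ f`. -/
def pd (i : Fin 3) (f : R3 → ℂ) (x : R3) : ℂ := fderiv ℝ f x (EuclideanSpace.single i 1)

/-- The classical gradient. -/
def grad (φ : R3 → ℂ) (x : R3) : C3 := !₂[pd 0 φ x, pd 1 φ x, pd 2 φ x]

/-- The classical curl. -/
def classicalCurl (ψ : R3 → C3) (x : R3) : C3 :=
  !₂[pd 1 (fun y => ψ y 2) x - pd 2 (fun y => ψ y 1) x,
     pd 2 (fun y => ψ y 0) x - pd 0 (fun y => ψ y 2) x,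
     pd 0 (fun y => ψ y 1) x - pd 1 (fun y => ψ y 0) x]

theorem pd_smooth {f : R3 → ℂ} (hf : ContDiff ℝ ∞ f) (i : Fin 3) : ContDiff ℝ ∞ (pd i f) := by
  unfold pd
  exact (hf.fderiv_right (m := ∞) (by simp)).clm_apply contDiff_const

theorem pd_support {f : R3 → ℂ} (i : Fin 3) : Function.support (pd i f) ⊆ tsupport f := by
  intro x hx
  by_contra h
  apply hx
  have : fderiv ℝ f x = 0 := by
    by_contra h'
    exact h (support_fderiv_subset ℝ h')
  simp [pd, this]

theorem pd_comm {f : R3 → ℂ} (hf : ContDiff ℝ ∞ f) (i j : Fin 3) (x : R3) :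
    pd i (pd j f) x = pd j (pd i f) x := by
  have key : ∀ k l : Fin 3, pd k (pd l f) x =
      fderiv ℝ (fderiv ℝ f) x (EuclideanSpace.single k 1) (EuclideanSpace.single l 1) := by
    intro k l
    have hd : DifferentiableAt ℝ (fderiv ℝ f) x :=
      ((hf.fderiv_right (m := ∞) (by simp)).differentiable (by simp)) x
    unfold pd
    rw [fderiv_clm_apply hd (differentiableAt_const _)]
    simp
  rw [key, key]
  have hs : IsSymmSndFDerivAt ℝ f x :=
    (hf.contDiffAt (x := x)).isSymmSndFDerivAt (by
      simp only [minSmoothness_of_isRCLikeNormedField]; exact WithTop.coe_le_coe.2 le_top)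
  exact hs _ _

theorem grad_test {φ : R3 → ℂ} {S : Set R3} (h : IsTest φ S) : IsTest (grad φ) S := by
  have hsupp : Function.support (grad φ) ⊆ tsupport φ := by
    intro x hx
    by_contra hn
    apply hx
    have h0 : ∀ i, pd i φ x = 0 := fun i => by
      by_contra h'
      exact hn (pd_support i h')
    ext i
    fin_cases i <;> simp [grad, h0]
  have hts : tsupport (grad φ) ⊆ tsupport φ := closure_minimal hsupp (isClosed_tsupport _)
  refine ⟨?_, ?_, hts.trans h.support⟩
  · rw [contDiff_piLp 2]
    intro i
    fin_cases i <;> simpa [grad] using pd_smooth h.smooth _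
  · exact h.compact.of_isClosed_subset (isClosed_tsupport _) hts

theorem curl_grad {φ : R3 → ℂ} (h : ContDiff ℝ ∞ φ) (x : R3) : classicalCurl (grad φ) x = 0 := by
  ext i
  fin_cases i
  · simpa [classicalCurl, grad, sub_eq_zero] using pd_comm h 1 2 x
  · simpa [classicalCurl, grad, sub_eq_zero] using pd_comm h 2 0 x
  · simpa [classicalCurl, grad, sub_eq_zero] using pd_comm h 0 1 x

theorem classicalCurl_continuous_compact {ψ : R3 → C3} {S : Set R3} (h : IsTest ψ S) :
    Continuous (classicalCurl ψ) ∧ HasCompactSupport (classicalCurl ψ) := by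
  have hc : ∀ i : Fin 3, ContDiff ℝ ∞ (fun y => ψ y i) := fun i => (contDiff_piLp 2).1 h.smooth i
  have hp : ∀ i j : Fin 3, Continuous (pd i (fun y => ψ y j)) :=
    fun i j => (pd_smooth (hc j) i).continuous
  constructor
  · unfold classicalCurl
    refine (PiLp.continuous_toLp 2 _).comp ?_
    refine continuous_pi fun i => ?_
    fin_cases i
    · exact (hp 1 2).sub (hp 2 1)
    · exact (hp 2 0).sub (hp 0 2)
    · exact (hp 0 1).sub (hp 1 0)
  · refine h.compact.of_isClosed_subset (isClosed_tsupport _) ?_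
    refine closure_minimal ?_ (isClosed_tsupport _)
    intro x hx
    by_contra hn
    apply hx
    have h0 : ∀ i j : Fin 3, pd i (fun y => ψ y j) x = 0 := fun i j => by
      by_contra h'
      have hx' := pd_support i h'
      apply hn
      refine closure_mono ?_ hx'
      intro y hy hy'
      apply hy
      simp [hy']
    ext i
    fin_cases i <;> simp [classicalCurl, h0]

/-- `Ω` has a Lipschitz boundary: near each boundary point and in suitable orthonormal
coordinates, `Ω` is the set of points lying above the graph of a Lipschitz function of two
variables. -/
def HasLipschitzBoundary (Ω : Set R3) : Prop :=
  ∀ x ∈ frontier Ω, ∃ (R : R3 ≃ₗᵢ[ℝ] R3) (K : NNReal) (g : EuclideanSpace ℝ (Fin 2) → ℝ),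
    LipschitzWith K g ∧ ∀ᶠ y in 𝓝 x, (y ∈ Ω ↔ g !₂[R y 0, R y 1] < R y 2)

/-! ### The spaces `L²(Ω)³`, `J(Ω)`, `Ĵ(Ω)` and the weak curl -/

/-- `L²(Ω)³`, complex valued. -/
abbrev L2 (Ω : Set R3) := Lp C3 2 (volume.restrict Ω)

/-- Integration against a continuous compactly supported field is an inner product in `L²`. -/
theorem exists_rep (Ω : Set R3) {g : R3 → C3} (hg : Continuous g) (hc : HasCompactSupport g) :
    ∃ G : L2 Ω, ∀ u : L2 Ω, ∫ x in Ω, inner ℂ (g x) (u x) = inner ℂ G u := by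
  have hm : MemLp g 2 (volume.restrict Ω) := hg.memLp_of_hasCompactSupport hc
  refine ⟨hm.toLp g, fun u => ?_⟩
  rw [L2.inner_def]
  refine integral_congr_ae ?_
  filter_upwards [hm.coeFn_toLp] with x hx
  rw [hx]

/-- Linear space of `L²` fields that are orthogonal to a family of gradients: the fields `u` with
`∫_Ω u · ∇φ̄ = 0` for all smooth `φ` with compact support in `S`. -/
def orthGrad (Ω S : Set R3) : Submodule ℂ (L2 Ω) where
  carrier := {u | ∀ φ : R3 → ℂ, IsTest φ S → ∫ x in Ω, inner ℂ (grad φ x) (u x) = 0}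
  zero_mem' := by
    intro φ h
    obtain ⟨G, hG⟩ := exists_rep Ω (grad_test h).smooth.continuous (grad_test h).compact
    rw [hG, inner_zero_right]
  add_mem' := by
    intro u v hu hv φ h
    obtain ⟨G, hG⟩ := exists_rep Ω (grad_test h).smooth.continuous (grad_test h).compact
    have h1 := hu φ h
    have h2 := hv φ h
    rw [hG] at h1 h2 ⊢
    rw [inner_add_right, h1, h2, add_zero]
  smul_mem' := by
    intro c u hu φ h
    obtain ⟨G, hG⟩ := exists_rep Ω (grad_test h).smooth.continuous (grad_test h).compact
    have h1 := hu φ h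
    rw [hG] at h1 ⊢
    rw [inner_smul_right, h1, mul_zero]

theorem orthGrad_isClosed (Ω S : Set R3) : IsClosed (orthGrad Ω S : Set (L2 Ω)) := by
  have : (orthGrad Ω S : Set (L2 Ω)) = ⋂ (φ : R3 → ℂ) (_ : IsTest φ S),
      {u | ∫ x in Ω, inner ℂ (grad φ x) (u x) = 0} := by
    ext u
    simp [orthGrad]
  rw [this]
  refine isClosed_iInter fun φ => isClosed_iInter fun h => ?_
  obtain ⟨G, hG⟩ := exists_rep Ω (grad_test h).smooth.continuous (grad_test h).compact
  simp only [hG]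
  exact isClosed_eq (continuous_const.inner continuous_id) continuous_const

/-- `J(Ω)`: the fields `χ ∈ L²(Ω)³` with `div χ = 0` in the sense of distributions in `Ω`. -/
def J (Ω : Set R3) : Submodule ℂ (L2 Ω) := orthGrad Ω Ω

/-- `Ĵ(Ω)`: the fields `χ ∈ J(Ω)` whose normal trace `χ · n` vanishes on the boundary. The normal
trace of a divergence-free field is the functional `φ ↦ ∫_Ω χ · ∇φ`, where `φ` runs through the
functions smooth up to the boundary. -/
def Jhat (Ω : Set R3) : Submodule ℂ (L2 Ω) := J Ω ⊓ orthGrad Ω univ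

/-- `J(Ω)` as a Hilbert space with the inner product of `L²(Ω)³`. -/
def JSpace (Ω : Set R3) : Type := J Ω

/-- `Ĵ(Ω)` as a Hilbert space with the inner product of `L²(Ω)³`. -/
def JhatSpace (Ω : Set R3) : Type := Jhat Ω

instance (Ω : Set R3) : NormedAddCommGroup (JSpace Ω) :=
  inferInstanceAs (NormedAddCommGroup (J Ω))

instance (Ω : Set R3) : InnerProductSpace ℂ (JSpace Ω) :=
  inferInstanceAs (InnerProductSpace ℂ (J Ω))

instance (Ω : Set R3) : CompleteSpace (JSpace Ω) :=
  (orthGrad_isClosed Ω Ω).completeSpace_coe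

instance (Ω : Set R3) : NormedAddCommGroup (JhatSpace Ω) :=
  inferInstanceAs (NormedAddCommGroup (Jhat Ω))

instance (Ω : Set R3) : InnerProductSpace ℂ (JhatSpace Ω) :=
  inferInstanceAs (InnerProductSpace ℂ (Jhat Ω))

instance (Ω : Set R3) : CompleteSpace (JhatSpace Ω) :=
  ((orthGrad_isClosed Ω Ω).inter (orthGrad_isClosed Ω univ)).completeSpace_coe

/-- The inclusion of `J(Ω)` in `L²(Ω)³`. -/
def inclJ (Ω : Set R3) : JSpace Ω →ₗ[ℂ] L2 Ω := (J Ω).subtype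

/-- The inclusion of `Ĵ(Ω)` in `L²(Ω)³`. -/
def inclJhat (Ω : Set R3) : JhatSpace Ω →ₗ[ℂ] L2 Ω := (Jhat Ω).subtype

/-- The pairs `(u, v)` of `L²` fields satisfying `∫_Ω u · curl ψ̄ = ∫_Ω v · ψ̄` for all smooth `ψ`
with compact support in `S`. -/
def greenGraph (Ω S : Set R3) : Submodule ℂ (L2 Ω × L2 Ω) where
  carrier := {p | ∀ ψ : R3 → C3, IsTest ψ S →
    ∫ x in Ω, inner ℂ (classicalCurl ψ x) (p.1 x) = ∫ x in Ω, inner ℂ (ψ x) (p.2 x)}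
  zero_mem' := by
    intro ψ h
    obtain ⟨G, hG⟩ := exists_rep Ω h.smooth.continuous h.compact
    obtain ⟨K, hK⟩ := exists_rep Ω (classicalCurl_continuous_compact h).1
      (classicalCurl_continuous_compact h).2
    simp only [hG, hK, Prod.fst_zero, Prod.snd_zero, inner_zero_right]
  add_mem' := by
    intro p q hp hq ψ h
    obtain ⟨G, hG⟩ := exists_rep Ω h.smooth.continuous h.compact
    obtain ⟨K, hK⟩ := exists_rep Ω (classicalCurl_continuous_compact h).1
      (classicalCurl_continuous_compact h).2
    have h1 := hp ψ h
    have h2 := hq ψ h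
    simp only [hG, hK] at h1 h2 ⊢
    rw [Prod.fst_add, Prod.snd_add, inner_add_right, inner_add_right, h1, h2]
  smul_mem' := by
    intro c p hp ψ h
    obtain ⟨G, hG⟩ := exists_rep Ω h.smooth.continuous h.compact
    obtain ⟨K, hK⟩ := exists_rep Ω (classicalCurl_continuous_compact h).1
      (classicalCurl_continuous_compact h).2
    have h1 := hp ψ h
    simp only [hG, hK] at h1 ⊢
    rw [Prod.smul_fst, Prod.smul_snd, inner_smul_right, inner_smul_right, h1]

/-- The weak (distributional) curl as an unbounded operator in `L²(Ω)³`, with its maximal domain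
`{u ∈ L²(Ω)³ | curl u ∈ L²(Ω)³}`. -/
def curl (Ω : Set R3) : L2 Ω →ₗ.[ℂ] L2 Ω := (greenGraph Ω Ω).toLinearPMap

/-- The weak curl restricted to the fields `u` with `u × n = 0` on the boundary, i.e. whose
tangential trace `ψ ↦ ∫_Ω (u · curl ψ̄ - curl u · ψ̄)` vanishes, where `ψ` runs through the fields
smooth up to the boundary. -/
def curlZeroTrace (Ω : Set R3) : L2 Ω →ₗ.[ℂ] L2 Ω :=
  (greenGraph Ω Ω ⊓ greenGraph Ω univ).toLinearPMap

theorem greenGraph_functional {Ω : Set R3} (hΩ : IsOpen Ω) :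
    ∀ p ∈ greenGraph Ω Ω, p.1 = 0 → p.2 = 0 := by
  rintro ⟨u, v⟩ hp hu
  simp only at hu ⊢
  subst hu
  have hz : ∀ ψ : R3 → C3, IsTest ψ Ω → ∫ x in Ω, inner ℂ (ψ x) (v x) = 0 := by
    intro ψ h
    rw [← hp ψ h]
    obtain ⟨K, hK⟩ := exists_rep Ω (classicalCurl_continuous_compact h).1
      (classicalCurl_continuous_compact h).2
    rw [hK, inner_zero_right]
  have hvi : LocallyIntegrable (v : R3 → C3) (volume.restrict Ω) :=
    (Lp.memLp v).locallyIntegrable (by norm_num)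
  have key : ∀ i : Fin 3, ∀ᵐ x ∂(volume.restrict Ω), x ∈ Ω → v x i = 0 := by
    intro i
    have hli : LocallyIntegrable (fun x => v x i) (volume.restrict Ω) := by
      have hmem : MemLp (fun x => v x i) 2 (volume.restrict Ω) :=
        (EuclideanSpace.proj (𝕜 := ℂ) i).comp_memLp' (Lp.memLp v)
      exact hmem.locallyIntegrable (by norm_num)
    refine hΩ.ae_eq_zero_of_integral_contDiff_smul_eq_zero (hli.locallyIntegrableOn _) ?_
    intro g hg hgc hgs
    have ht : IsTest (fun x => EuclideanSpace.single i ((g x : ℂ))) Ω := by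
      have hsub : tsupport (fun x => (EuclideanSpace.single i ((g x : ℂ)) : C3)) ⊆ tsupport g := by
        refine closure_mono ?_
        intro x hx hx'
        apply hx
        simp [hx']
      refine ⟨?_, hgc.of_isClosed_subset (isClosed_tsupport _) hsub, hsub.trans hgs⟩
      rw [contDiff_piLp 2]
      intro j
      by_cases hij : j = i
      · subst hij
        simpa [Function.comp_def] using Complex.ofRealCLM.contDiff.comp hg
      · simpa [hij] using contDiff_const
    have := hz _ ht
    rw [← this]
    refine integral_congr_ae (Eventually.of_forall fun x => ?_)
    simp [EuclideanSpace.inner_single_left]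
  rw [Lp.eq_zero_iff_ae_eq_zero]
  filter_upwards [key 0, key 1, key 2, self_mem_ae_restrict hΩ.measurableSet]
    with x h0 h1 h2 hx
  ext i
  fin_cases i
  · exact h0 hx
  · exact h1 hx
  · exact h2 hx

theorem mem_greenGraph_curl {Ω : Set R3} (hΩ : IsOpen Ω) (u : (curl Ω).domain) :
    ((u : L2 Ω), curl Ω u) ∈ greenGraph Ω Ω :=
  Submodule.mem_graph_toLinearPMap
    (fun p hp h => greenGraph_functional hΩ p hp h) u

theorem mem_greenGraph_curlZeroTrace {Ω : Set R3} (hΩ : IsOpen Ω) (u : (curlZeroTrace Ω).domain) :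
    ((u : L2 Ω), curlZeroTrace Ω u) ∈ greenGraph Ω Ω ⊓ greenGraph Ω univ :=
  Submodule.mem_graph_toLinearPMap
    (fun p hp h => greenGraph_functional hΩ p (Submodule.mem_inf.1 hp).1 h) u

theorem snd_mem_orthGrad {Ω S : Set R3} {u v : L2 Ω} (h : (u, v) ∈ greenGraph Ω S) :
    v ∈ orthGrad Ω S := by
  intro φ hφ
  have h1 := h (grad φ) (grad_test hφ)
  rw [← h1]
  simp [curl_grad hφ.smooth]

theorem curl_mem_J {Ω : Set R3} (hΩ : IsOpen Ω) (u : (curl Ω).domain) : curl Ω u ∈ J Ω :=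
  snd_mem_orthGrad (mem_greenGraph_curl hΩ u)

theorem curlZeroTrace_mem_Jhat {Ω : Set R3} (hΩ : IsOpen Ω) (u : (curlZeroTrace Ω).domain) :
    curlZeroTrace Ω u ∈ Jhat Ω :=
  ⟨snd_mem_orthGrad (mem_greenGraph_curlZeroTrace hΩ u).1,
    snd_mem_orthGrad (mem_greenGraph_curlZeroTrace hΩ u).2⟩

/-! ### The weighted history spaces and the derivative `∂ₛ` -/

/-- The weight `w(s) = C e^{-δ s}`. -/
def weight (C δ s : ℝ) : ℝ := C * Real.exp (-δ * s)

/-- The measure `w(s) ds` on `(0, ∞)`. -/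
def histMeasure (C δ : ℝ) : Measure ℝ :=
  (volume.restrict (Ioi 0)).withDensity fun s => ENNReal.ofReal (weight C δ s)

/-- The space `L²_w((0, ∞); X)`. -/
abbrev L2w (C δ : ℝ) (X : Type) [NormedAddCommGroup X] := Lp X 2 (histMeasure C δ)

theorem weight_continuous (C δ : ℝ) : Continuous (weight C δ) := by
  unfold weight; fun_prop

theorem weight_pos {C : ℝ} (δ : ℝ) (hC : 0 < C) (s : ℝ) : 0 < weight C δ s :=
  mul_pos hC (Real.exp_pos _)

theorem histMeasure_finite {C δ : ℝ} (hδ : 0 < δ) : IsFiniteMeasure (histMeasure C δ) := by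
  unfold histMeasure
  refine isFiniteMeasure_withDensity_ofReal ?_
  have : IntegrableOn (fun s => C * Real.exp (-δ * s)) (Ioi 0) :=
    (exp_neg_integrableOn_Ioi 0 hδ).const_mul C
  exact this.hasFiniteIntegral

section History

variable {C δ : ℝ} {X : Type} [NormedAddCommGroup X] [InnerProductSpace ℂ X]

/-- Elements of `L²_w` are integrable against every function dominated by the weight. -/
theorem integrable_smul_of_le_weight (hC : 0 < C) (hδ : 0 < δ) {g : ℝ → ℝ} {M : ℝ}
    (hg : ContinuousOn g (Ioi 0)) (hb : ∀ s ∈ Ioi (0 : ℝ), |g s| ≤ M * weight C δ s)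
    (η : L2w C δ X) : IntegrableOn (fun s => g s • η s) (Ioi 0) := by
  have := histMeasure_finite (C := C) hδ
  have h1 : Integrable η (histMeasure C δ) := (Lp.memLp η).integrable (by norm_num)
  have hm : Measurable fun s => ENNReal.ofReal (weight C δ s) :=
    (weight_continuous C δ).measurable.ennreal_ofReal
  have h2 : IntegrableOn (fun s => weight C δ s • η s) (Ioi 0) := by
    unfold histMeasure at h1
    rw [integrable_withDensity_iff_integrable_smul' hm (by simp)] at h1
    refine h1.congr (Eventually.of_forall fun s => ?_)
    simp only [ENNReal.toReal_ofReal (weight_pos δ hC s).le]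
    rfl
  have hr : ContinuousOn (fun s => g s / weight C δ s) (Ioi 0) :=
    hg.div (weight_continuous C δ).continuousOn fun s _ => (weight_pos δ hC s).ne'
  have h3 : Integrable ((fun s => g s / weight C δ s) • (fun s => weight C δ s • η s))
      (volume.restrict (Ioi 0)) := by
    refine Integrable.bdd_smul h2 M (hr.aestronglyMeasurable measurableSet_Ioi) ?_
    filter_upwards [self_mem_ae_restrict measurableSet_Ioi] with s hs
    rw [Real.norm_eq_abs, abs_div, abs_of_pos (weight_pos δ hC s),
      div_le_iff₀ (weight_pos δ hC s)]
    exact hb s hs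
  refine h3.congr (Eventually.of_forall fun s => ?_)
  simp only [Pi.smul_apply', smul_smul]
  rw [div_mul_cancel₀ _ (weight_pos δ hC s).ne']

theorem exists_bound_of_compact (hC : 0 < C) {g : ℝ → ℝ} (hg : Continuous g)
    (hc : HasCompactSupport g) :
    ∃ M, ∀ s ∈ Ioi (0 : ℝ), |g s| ≤ M * weight C δ s := by
  have hr : Continuous (fun s => g s / weight C δ s) :=
    hg.div (weight_continuous C δ) fun s => (weight_pos δ hC s).ne'
  have hcr : HasCompactSupport (fun s => g s / weight C δ s) := by
    refine hc.of_isClosed_subset (isClosed_tsupport _) (closure_mono ?_)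
    intro s hs hs'
    apply hs
    simp [hs']
  obtain ⟨M, hM⟩ := hcr.exists_bound_of_continuous hr
  refine ⟨M, fun s _ => ?_⟩
  have := hM s
  rwa [Real.norm_eq_abs, abs_div, abs_of_pos (weight_pos δ hC s),
    div_le_iff₀ (weight_pos δ hC s)] at this

theorem ae_history_iff (hC : 0 < C) {p : ℝ → Prop} :
    (∀ᵐ s ∂histMeasure C δ, p s) ↔ ∀ᵐ s ∂volume.restrict (Ioi 0), p s := by
  unfold histMeasure
  rw [ae_withDensity_iff (weight_continuous C δ).measurable.ennreal_ofReal]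
  refine eventually_congr (Eventually.of_forall fun s => ?_)
  simp [weight_pos δ hC s]

/-- `ζ` is the weak derivative of `η` on `(0, ∞)`. -/
def HasWeakDeriv (η ζ : L2w C δ X) : Prop :=
  ∀ φ : ℝ → ℝ, IsTest φ (Ioi 0) →
    ∫ s in Ioi 0, deriv φ s • η s = -∫ s in Ioi 0, φ s • ζ s

/-- `η(0) = 0`: `η` has a representative that is continuous on `[0, ∞)` and vanishes at `0`. -/
def VanishesAtZero (η : L2w C δ X) : Prop :=
  ∃ f : ℝ → X, ContinuousOn f (Ici 0) ∧ f 0 = 0 ∧ ∀ᵐ s ∂volume.restrict (Ioi 0), η s = f s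

theorem integral_add_smul (hC : 0 < C) (hδ : 0 < δ) {g : ℝ → ℝ} {M : ℝ}
    (hg : ContinuousOn g (Ioi 0)) (hb : ∀ s ∈ Ioi (0 : ℝ), |g s| ≤ M * weight C δ s)
    (η ζ : L2w C δ X) :
    ∫ s in Ioi 0, g s • (η + ζ) s = (∫ s in Ioi 0, g s • η s) + ∫ s in Ioi 0, g s • ζ s := by
  rw [← integral_add (integrable_smul_of_le_weight hC hδ hg hb η)
    (integrable_smul_of_le_weight hC hδ hg hb ζ)]
  refine integral_congr_ae ?_
  filter_upwards [(ae_history_iff hC).1 (Lp.coeFn_add η ζ)] with s hs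
  rw [hs, Pi.add_apply, smul_add]

theorem integral_const_smul (hC : 0 < C) (g : ℝ → ℝ) (c : ℂ) (η : L2w C δ X) :
    ∫ s in Ioi 0, g s • (c • η) s = c • ∫ s in Ioi 0, g s • η s := by
  rw [← integral_smul]
  refine integral_congr_ae ?_
  filter_upwards [(ae_history_iff hC).1 (Lp.coeFn_smul c η)] with s hs
  rw [hs, Pi.smul_apply, smul_comm]

/-- The graph of `∂ₛ` with the condition `η(0) = 0`. -/
def derivGraph (hC : 0 < C) (hδ : 0 < δ) (X : Type) [NormedAddCommGroup X]
    [InnerProductSpace ℂ X] : Submodule ℂ (L2w C δ X × L2w C δ X) where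
  carrier := {p | HasWeakDeriv p.1 p.2 ∧ VanishesAtZero p.1}
  zero_mem' := by
    have h0 : ∀ᵐ s ∂volume.restrict (Ioi 0), (0 : L2w C δ X) s = 0 :=
      (ae_history_iff hC).1 (Lp.coeFn_zero X 2 (histMeasure C δ))
    have h1 : ∀ g : ℝ → ℝ, ∫ s in Ioi 0, g s • (0 : L2w C δ X) s = 0 := by
      intro g
      rw [← integral_zero ℝ X]
      refine integral_congr_ae ?_
      filter_upwards [h0] with s hs
      rw [hs, smul_zero]
    refine ⟨fun φ _ => ?_, 0, continuousOn_const, rfl, h0⟩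
    simp only [Prod.fst_zero, Prod.snd_zero]
    rw [h1, h1, neg_zero]
  add_mem' := by
    rintro ⟨η, ζ⟩ ⟨η', ζ'⟩ ⟨h, f, hf, hf0, hfe⟩ ⟨h', f', hf', hf0', hfe'⟩
    refine ⟨fun φ hφ => ?_, f + f', hf.add hf', by simp [hf0, hf0'], ?_⟩
    · have hd : Continuous (deriv φ) := hφ.smooth.continuous_deriv (by simp)
      obtain ⟨M, hM⟩ := exists_bound_of_compact (δ := δ) hC hd hφ.compact.deriv
      obtain ⟨N, hN⟩ := exists_bound_of_compact (δ := δ) hC hφ.smooth.continuous hφ.compact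
      simp only [Prod.mk_add_mk]
      rw [integral_add_smul hC hδ hd.continuousOn hM,
        integral_add_smul hC hδ hφ.smooth.continuous.continuousOn hN, neg_add]
      exact congrArg₂ (· + ·) (h φ hφ) (h' φ hφ)
    · filter_upwards [(ae_history_iff hC).1 (Lp.coeFn_add η η'), hfe, hfe'] with s h1 h2 h3
      simp only [Prod.mk_add_mk, Pi.add_apply] at h1 h2 h3 ⊢
      rw [h1, h2, h3]
  smul_mem' := by
    rintro c ⟨η, ζ⟩ ⟨h, f, hf, hf0, hfe⟩
    refine ⟨fun φ hφ => ?_, c • f, hf.const_smul c, by simp [hf0], ?_⟩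
    · simp only [Prod.smul_mk]
      rw [integral_const_smul hC, integral_const_smul hC, ← smul_neg]
      exact congrArg (c • ·) (h φ hφ)
    · filter_upwards [(ae_history_iff hC).1 (Lp.coeFn_smul c η), hfe] with s h1 h2
      simp only [Prod.smul_mk, Pi.smul_apply] at h1 h2 ⊢
      rw [h1, h2]

/-- The operator `∂ₛ` in `L²_w((0, ∞); X)` with the domain of all `η` such that
`∂ₛ η ∈ L²_w((0, ∞); X)` and `η(0) = 0`. -/
def ds (hC : 0 < C) (hδ : 0 < δ) (X : Type) [NormedAddCommGroup X] [InnerProductSpace ℂ X] :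
    L2w C δ X →ₗ.[ℂ] L2w C δ X := (derivGraph hC hδ X).toLinearPMap

theorem derivGraph_functional (hC : 0 < C) (hδ : 0 < δ) (X : Type) [NormedAddCommGroup X]
    [InnerProductSpace ℂ X] [CompleteSpace X] :
    ∀ p ∈ derivGraph hC hδ X, p.1 = 0 → p.2 = 0 := by
  rintro ⟨η, ζ⟩ ⟨h, -⟩ hη
  simp only at h hη ⊢
  subst hη
  have hint : LocallyIntegrableOn (fun s => weight C δ s • ζ s) (Ioi 0) volume := by
    refine (IntegrableOn.locallyIntegrableOn ?_)
    exact integrable_smul_of_le_weight (M := 1) hC hδ (weight_continuous C δ).continuousOn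
      (fun s _ => by rw [one_mul, abs_of_pos (weight_pos δ hC s)]) ζ
  have hz := isOpen_Ioi.ae_eq_zero_of_integral_contDiff_smul_eq_zero hint (by
    intro g hg hgc hgs
    have hw : ContDiff ℝ ∞ (weight C δ) := by unfold weight; fun_prop
    have hsub : tsupport (fun s => g s * weight C δ s) ⊆ tsupport g := by
      refine closure_mono ?_
      intro x hx hx'
      apply hx
      simp [hx']
    have ht : IsTest (fun s => g s * weight C δ s) (Ioi 0) :=
      ⟨hg.mul hw, hgc.of_isClosed_subset (isClosed_tsupport _) hsub, hsub.trans hgs⟩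
    have h1 := h _ ht
    have h2 : ∫ s in Ioi 0, deriv (fun s => g s * weight C δ s) s • (0 : L2w C δ X) s = 0 := by
      rw [← integral_zero ℝ X]
      refine integral_congr_ae ?_
      filter_upwards [(ae_history_iff hC).1 (Lp.coeFn_zero X 2 (histMeasure C δ))] with s hs
      rw [hs, Pi.zero_apply, smul_zero]
    rw [h2, zero_eq_neg] at h1
    rw [← h1, ← setIntegral_eq_integral_of_forall_compl_eq_zero (s := Ioi 0)]
    · simp only [smul_smul]
    · intro s hs
      have : g s = 0 := by
        by_contra hne
        exact hs (hgs (subset_tsupport _ hne))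
      simp [this])
  rw [Lp.eq_zero_iff_ae_eq_zero]
  refine (ae_history_iff hC).2 ?_
  rw [ae_restrict_iff' measurableSet_Ioi]
  filter_upwards [hz] with s hs hs0
  simpa [(weight_pos δ hC s).ne'] using hs hs0

theorem mem_derivGraph_ds (hC : 0 < C) (hδ : 0 < δ) (X : Type) [NormedAddCommGroup X]
    [InnerProductSpace ℂ X] [CompleteSpace X] (η : (ds hC hδ X).domain) :
    ((η : L2w C δ X), ds hC hδ X η) ∈ derivGraph hC hδ X :=
  Submodule.mem_graph_toLinearPMap
    (fun p hp h => derivGraph_functional hC hδ X p hp h) η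

end History

/-! ### The medium -/

/-- The second derivative of a kernel on `[0, ∞)` (one-sided at `0`). -/
def second (ν : ℝ → ℝ) (s : ℝ) : ℝ := iteratedDerivWithin 2 ν (Ici 0) s

/-- The real kernel `ν` is of class `C²` on `[0, ∞)`, `ν'(t) → 0` as `t → ∞`, and
`|ν''(t)| ≤ C e^{-δ t}` for all `t ≥ 0`. -/
structure IsKernel (C δ : ℝ) (ν : ℝ → ℝ) : Prop where
  contDiff : ContDiffOn ℝ 2 ν (Ici 0)
  tendsto : Tendsto (derivWithin ν (Ici 0)) atTop (𝓝 0)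
  bound : ∀ t, 0 ≤ t → |second ν t| ≤ C * Real.exp (-δ * t)

/-- The data of the problem: a bounded domain `Ω ⊆ ℝ³` with a Lipschitz boundary, a constant
permittivity `ε > 0` and permeability `μ > 0`, two susceptibility kernels, and constants
`C, δ > 0` for which both kernels satisfy the exponential bound. -/
structure Medium where
  Ω : Set R3
  isOpen : IsOpen Ω
  isConnected : IsConnected Ω
  isBounded : Bornology.IsBounded Ω
  lipschitz : HasLipschitzBoundary Ω
  ε : ℝ
  ε_pos : 0 < ε
  μ : ℝ
  μ_pos : 0 < μ
  C : ℝ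
  C_pos : 0 < C
  δ : ℝ
  δ_pos : 0 < δ
  νE : ℝ → ℝ
  νE_kernel : IsKernel C δ νE
  νH : ℝ → ℝ
  νH_kernel : IsKernel C δ νH

/-- The memory operator `η ↦ ∫₀^∞ ν''(s) η(s) ds` from `L²_w((0, ∞); X)` to `X`. -/
def memory {C δ : ℝ} (hC : 0 < C) (hδ : 0 < δ) {ν : ℝ → ℝ} (hν : IsKernel C δ ν)
    (X : Type) [NormedAddCommGroup X] [InnerProductSpace ℂ X] [CompleteSpace X] :
    L2w C δ X →ₗ[ℂ] X where
  toFun η := ∫ s in Ioi 0, second ν s • η s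
  map_add' η ζ := by
    refine integral_add_smul (M := 1) hC hδ ?_ ?_ η ζ
    · exact (hν.contDiff.continuousOn_iteratedDerivWithin le_rfl
        (uniqueDiffOn_Ici 0)).mono Ioi_subset_Ici_self
    · intro s hs
      rw [one_mul]
      exact hν.bound s (le_of_lt hs)
  map_smul' c η := integral_const_smul hC _ c η

/-- The inner product `ε (x₁, y₁) + μ (x₂, y₂) + (x₃, y₃) + (x₄, y₄)` on a product of four inner
product spaces. -/
@[reducible]
def weightedCore {ε μ : ℝ} (hε : 0 < ε) (hμ : 0 < μ) (X₁ X₂ X₃ X₄ : Type)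
    [NormedAddCommGroup X₁] [InnerProductSpace ℂ X₁] [NormedAddCommGroup X₂]
    [InnerProductSpace ℂ X₂] [NormedAddCommGroup X₃] [InnerProductSpace ℂ X₃]
    [NormedAddCommGroup X₄] [InnerProductSpace ℂ X₄] :
    InnerProductSpace.Core ℂ (X₁ × X₂ × X₃ × X₄) where
  inner x y := (ε : ℂ) * inner ℂ x.1 y.1 + (μ : ℂ) * inner ℂ x.2.1 y.2.1
    + inner ℂ x.2.2.1 y.2.2.1 + inner ℂ x.2.2.2 y.2.2.2
  conj_inner_symm x y := by
    simp only [map_add, map_mul, inner_conj_symm, Complex.conj_ofReal]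
  re_inner_nonneg x := by
    simp only [map_add, RCLike.re_to_complex, Complex.re_ofReal_mul]
    have h1 := mul_nonneg hε.le (inner_self_nonneg (𝕜 := ℂ) (x := x.1))
    have h2 := mul_nonneg hμ.le (inner_self_nonneg (𝕜 := ℂ) (x := x.2.1))
    have h3 := inner_self_nonneg (𝕜 := ℂ) (x := x.2.2.1)
    have h4 := inner_self_nonneg (𝕜 := ℂ) (x := x.2.2.2)
    exact add_nonneg (add_nonneg (add_nonneg h1 h2) h3) h4
  add_left x y z := by
    simp only [Prod.fst_add, Prod.snd_add, inner_add_left]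
    ring
  smul_left x y c := by
    simp only [Prod.smul_fst, Prod.smul_snd, inner_smul_left]
    ring
  definite x h := by
    have h0 := congrArg Complex.re h
    simp only [Complex.add_re, Complex.re_ofReal_mul, Complex.zero_re] at h0
    have h1 := mul_nonneg hε.le (inner_self_nonneg (𝕜 := ℂ) (x := x.1))
    have h2 := mul_nonneg hμ.le (inner_self_nonneg (𝕜 := ℂ) (x := x.2.1))
    have h3 := inner_self_nonneg (𝕜 := ℂ) (x := x.2.2.1)
    have h4 := inner_self_nonneg (𝕜 := ℂ) (x := x.2.2.2)
    simp only [RCLike.re_to_complex] at h1 h2 h3 h4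
    have e1 : ε * (inner ℂ x.1 x.1).re = 0 := by linarith
    have e2 : μ * (inner ℂ x.2.1 x.2.1).re = 0 := by linarith
    have e3 : (inner ℂ x.2.2.1 x.2.2.1).re = 0 := by linarith
    have e4 : (inner ℂ x.2.2.2 x.2.2.2).re = 0 := by linarith
    have e1' := (mul_eq_zero.1 e1).resolve_left hε.ne'
    have e2' := (mul_eq_zero.1 e2).resolve_left hμ.ne'
    exact Prod.ext ((re_inner_self_nonpos (𝕜 := ℂ)).1 e1'.le)
      (Prod.ext ((re_inner_self_nonpos (𝕜 := ℂ)).1 e2'.le)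
        (Prod.ext ((re_inner_self_nonpos (𝕜 := ℂ)).1 e3.le)
          ((re_inner_self_nonpos (𝕜 := ℂ)).1 e4.le)))

namespace Medium

variable (d : Medium)

/-- The set of quadruples `(E, H, η_E, η_H)` underlying the history space. -/
abbrev Quad : Type :=
  JSpace d.Ω × JhatSpace d.Ω × L2w d.C d.δ (JSpace d.Ω) × L2w d.C d.δ (JhatSpace d.Ω)

/-- The history space `ℋ = J(Ω) × Ĵ(Ω) × L²_w((0, ∞); J(Ω)) × L²_w((0, ∞); Ĵ(Ω))`, with the inner
product `∫_Ω (ε E · E' + μ H · H') dx + ∫₀^∞ ∫_Ω (η_E · η_E' + η_H · η_H') dx w(s) ds` (complex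
conjugation on one factor of each product). -/
def Hist : Type := d.Quad

instance : AddCommGroup d.Hist := inferInstanceAs (AddCommGroup d.Quad)

instance : Module ℂ d.Hist := inferInstanceAs (Module ℂ d.Quad)

/-- The inner product of `ℋ`. -/
@[reducible]
def histCore : InnerProductSpace.Core ℂ d.Hist :=
  weightedCore d.ε_pos d.μ_pos (JSpace d.Ω) (JhatSpace d.Ω) (L2w d.C d.δ (JSpace d.Ω))
    (L2w d.C d.δ (JhatSpace d.Ω))

instance : NormedAddCommGroup d.Hist :=
  InnerProductSpace.Core.toNormedAddCommGroup (cd := d.histCore)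

instance : InnerProductSpace ℂ d.Hist := InnerProductSpace.ofCore d.histCore.toCore

/-- The component `E`. -/
def pE : d.Hist →ₗ[ℂ] JSpace d.Ω where
  toFun U := U.1
  map_add' _ _ := rfl
  map_smul' _ _ := rfl

/-- The component `H`. -/
def pH : d.Hist →ₗ[ℂ] JhatSpace d.Ω where
  toFun U := U.2.1
  map_add' _ _ := rfl
  map_smul' _ _ := rfl

/-- The component `η_E`. -/
def pηE : d.Hist →ₗ[ℂ] L2w d.C d.δ (JSpace d.Ω) where
  toFun U := U.2.2.1
  map_add' _ _ := rfl
  map_smul' _ _ := rfl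

/-- The component `η_H`. -/
def pηH : d.Hist →ₗ[ℂ] L2w d.C d.δ (JhatSpace d.Ω) where
  toFun U := U.2.2.2
  map_add' _ _ := rfl
  map_smul' _ _ := rfl

/-- The quadruple with given components, depending linearly on a parameter. -/
def assemble {V : Type} [AddCommGroup V] [Module ℂ V] (a : V →ₗ[ℂ] JSpace d.Ω)
    (b : V →ₗ[ℂ] JhatSpace d.Ω) (p : V →ₗ[ℂ] L2w d.C d.δ (JSpace d.Ω))
    (q : V →ₗ[ℂ] L2w d.C d.δ (JhatSpace d.Ω)) : V →ₗ[ℂ] d.Hist where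
  toFun v := (a v, b v, p v, q v)
  map_add' v w := by simp only [map_add]; rfl
  map_smul' c v := by simp only [map_smul]; rfl

/-- The domain of `𝒜`: `curl E, curl H ∈ L²(Ω)³`, `E × n = 0` on the boundary,
`∂ₛ η_E ∈ L²_w((0, ∞); J(Ω))`, `∂ₛ η_H ∈ L²_w((0, ∞); Ĵ(Ω))` and `η_E(0) = η_H(0) = 0`. -/
def domA : Submodule ℂ d.Hist :=
  (curlZeroTrace d.Ω).domain.comap (inclJ d.Ω ∘ₗ d.pE) ⊓
  (curl d.Ω).domain.comap (inclJhat d.Ω ∘ₗ d.pH) ⊓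
  (ds d.C_pos d.δ_pos (JSpace d.Ω)).domain.comap d.pηE ⊓
  (ds d.C_pos d.δ_pos (JhatSpace d.Ω)).domain.comap d.pηH

/-- `curl E`, as an element of `Ĵ(Ω)`. -/
def curlE : d.domA →ₗ[ℂ] JhatSpace d.Ω :=
  LinearMap.codRestrict (Jhat d.Ω)
    ((curlZeroTrace d.Ω).toFun ∘ₗ
      ((inclJ d.Ω ∘ₗ d.pE ∘ₗ d.domA.subtype).codRestrict _ fun U => U.2.1.1.1))
    fun _ => curlZeroTrace_mem_Jhat d.isOpen _

/-- `curl H`, as an element of `J(Ω)`. -/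
def curlH : d.domA →ₗ[ℂ] JSpace d.Ω :=
  LinearMap.codRestrict (J d.Ω)
    ((curl d.Ω).toFun ∘ₗ
      ((inclJhat d.Ω ∘ₗ d.pH ∘ₗ d.domA.subtype).codRestrict _ fun U => U.2.1.1.2))
    fun _ => curl_mem_J d.isOpen _

/-- `∂ₛ η_E`. -/
def dsE : d.domA →ₗ[ℂ] L2w d.C d.δ (JSpace d.Ω) :=
  (ds d.C_pos d.δ_pos (JSpace d.Ω)).toFun ∘ₗ
    ((d.pηE ∘ₗ d.domA.subtype).codRestrict _ fun U => U.2.1.2)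

/-- `∂ₛ η_H`. -/
def dsH : d.domA →ₗ[ℂ] L2w d.C d.δ (JhatSpace d.Ω) :=
  (ds d.C_pos d.δ_pos (JhatSpace d.Ω)).toFun ∘ₗ
    ((d.pηH ∘ₗ d.domA.subtype).codRestrict _ fun U => U.2.2)

instance : IsFiniteMeasure (histMeasure d.C d.δ) := histMeasure_finite d.δ_pos

/-- A field independent of `s`, as an element of the history space. -/
def constHist (X : Type) [NormedAddCommGroup X] [InnerProductSpace ℂ X] :
    X →ₗ[ℂ] L2w d.C d.δ X := Lp.constₗ 2 (histMeasure d.C d.δ) ℂ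

/-- The operator `𝒜` of the dispersive Maxwell system in `ℋ`. The components of
`𝒜 (E, H, η_E, η_H)` are
`ε⁻¹ (-ν_E(0) E + ∫₀^∞ ν_E''(s) η_E(s) ds + curl H)`,
`μ⁻¹ (-ν_H(0) H + ∫₀^∞ ν_H''(s) η_H(s) ds - curl E)`,
`-∂ₛ η_E + E` and `-∂ₛ η_H + H`, where `E` and `H` are regarded as functions constant in `s`. -/
def opA : d.Hist →ₗ.[ℂ] d.Hist where
  domain := d.domA
  toFun := d.assemble
    ((d.ε : ℂ)⁻¹ • (-((d.νE 0 : ℂ) • (d.pE ∘ₗ d.domA.subtype))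
      + memory d.C_pos d.δ_pos d.νE_kernel (JSpace d.Ω) ∘ₗ d.pηE ∘ₗ d.domA.subtype + d.curlH))
    ((d.μ : ℂ)⁻¹ • (-((d.νH 0 : ℂ) • (d.pH ∘ₗ d.domA.subtype))
      + memory d.C_pos d.δ_pos d.νH_kernel (JhatSpace d.Ω) ∘ₗ d.pηH ∘ₗ d.domA.subtype - d.curlE))
    (-d.dsE + d.constHist (JSpace d.Ω) ∘ₗ d.pE ∘ₗ d.domA.subtype)
    (-d.dsH + d.constHist (JhatSpace d.Ω) ∘ₗ d.pH ∘ₗ d.domA.subtype)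

end Medium

/-! ### Semigroups and solutions of abstract Cauchy problems -/

section Semigroup

variable {X : Type} [NormedAddCommGroup X] [InnerProductSpace ℂ X]

/-- `(T(t))_{t ≥ 0}` is a `C₀`-semigroup of bounded operators (the values of `T` at negative
arguments are irrelevant). -/
structure IsC0Semigroup (T : ℝ → X →L[ℂ] X) : Prop where
  zero : T 0 = ContinuousLinearMap.id ℂ X
  add : ∀ s t, 0 ≤ s → 0 ≤ t → T (s + t) = T s ∘L T t
  tendsto : ∀ x, Tendsto (fun t => T t x) (𝓝[>] 0) (𝓝 x)

/-- `A` is the infinitesimal generator of `T`: the domain of `A` consists of those `x` for which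
`(T(t) x - x) / t` converges as `t → 0+`, and the limit is then `A x`. -/
def Generates (A : X →ₗ.[ℂ] X) (T : ℝ → X →L[ℂ] X) : Prop :=
  ∀ x y, (x, y) ∈ A.graph ↔
    Tendsto (fun t : ℝ => t⁻¹ • (T t x - x)) (𝓝[>] 0) (𝓝 y)

/-- The pairs `(y, A* y)` of the graph of the adjoint of `A`. -/
def InAdjointGraph (A : X →ₗ.[ℂ] X) (y z : X) : Prop :=
  ∀ x : A.domain, inner ℂ y (A x) = inner ℂ z (x : X)

/-- `U ∈ C([0, ∞), X)` is a weak solution of `U' = A U`, `U(0) = U₀`: for every `y ∈ D(A*)` the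
function `t ↦ (U(t), y)` is differentiable on `[0, ∞)` with derivative `(U(t), A* y)`. -/
structure IsWeakSolution (A : X →ₗ.[ℂ] X) (U₀ : X) (U : ℝ → X) : Prop where
  continuousOn : ContinuousOn U (Ici 0)
  initial : U 0 = U₀
  equation : ∀ y z, InAdjointGraph A y z → ∀ t, 0 ≤ t →
    HasDerivWithinAt (fun s => inner ℂ y (U s)) (inner ℂ z (U t)) (Ici 0) t

/-- The space `D(A^k)` with its graph norm, realised as the space of the tuples
`(x, A x, …, A^k x)` with the norm `max_j ‖A^j x‖`. -/
def powDomain (A : X →ₗ.[ℂ] X) (k : ℕ) : Submodule ℂ (Fin (k + 1) → X) where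
  carrier := {W | ∀ j : Fin k, (W j.castSucc, W j.succ) ∈ A.graph}
  zero_mem' _ := A.graph.zero_mem
  add_mem' h h' j := A.graph.add_mem (h j) (h' j)
  smul_mem' c _ h j := A.graph.smul_mem c (h j)

/-- `U` is a strong solution of `U' = A U`, `U(0) = U₀` with
`U ∈ C([0, ∞), D(A^k)) ∩ C¹([0, ∞), D(A^{k-1}))`. -/
structure IsStrongSolution (A : X →ₗ.[ℂ] X) (k : ℕ) (U₀ : X) (U : ℝ → X) : Prop where
  initial : U 0 = U₀
  equation : ∀ t, 0 ≤ t → ∃ V, (U t, V) ∈ A.graph ∧ HasDerivWithinAt U V (Ici 0) t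
  continuous : ∃ W : ℝ → powDomain A k, ContinuousOn W (Ici 0) ∧
    ∀ t, 0 ≤ t → (W t : Fin (k + 1) → X) 0 = U t
  differentiable : ∃ W : ℝ → powDomain A (k - 1), ContDiffOn ℝ 1 W (Ici 0) ∧
    ∀ t, 0 ≤ t → (W t : Fin (k - 1 + 1) → X) 0 = U t

end Semigroup

end DispersiveMaxwell

end

/-!
The operator `𝒜` is a bounded perturbation of a maximal dissipative operator, and the theorem is
the Lumer-Phillips theorem for it, followed by the standard regularity of semigroup orbits.

*Splitting.* The terms of `𝒜` of order zero (multiplication by the numbers `ν(0)`, the memory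
integrals, and the embedding of `E` and `H` in the history spaces as functions constant in `s`) are
bounded on `ℋ`: `Medium.lowerOrderL`. What remains is the principal part
`(E, H, η_E, η_H) ↦ (ε⁻¹ curl H, -μ⁻¹ curl E, -∂ₛ η_E, -∂ₛ η_H)`, whose graph is
`Medium.principalGraph`. By `Medium.graph_opA`, `𝒜` is the sum of the two.

*The principal part is dissipative.* The contributions of the two curls cancel by Green's formula
`⟨curl E, H⟩ = ⟨E, curl H⟩` for `E` with vanishing tangential trace
(`inner_eq_inner_of_mem_greenGraph`). This is where the Lipschitz boundary enters. The trace of `E`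
vanishes in the sense that the zero extension of `E` to the whole space has the zero extension of
`curl E` as its weak curl. After localization by a partition of unity, a piece of the extended field
can be translated along a cone into the domain and mollified there, which gives test fields in `Ω`
that approximate it; `integral_inner_eq_of_cone` passes to the limit. For the history variables,
`-∂ₛ` with zero initial value is dissipative because the weight decreases: the solution
`η(s) = ∫₀ˢ e^{-l (s - r)} a(r) dr` of `l η + ∂ₛ η = a` satisfies `l ‖η‖ ≤ ‖a‖` by Schur's test,
and it is the only one by the du Bois-Reymond lemma (`derivGraph_re_nonneg`).

*The principal part has full range.* The equation `l U - A U = Z` decouples. The history variables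
are given by the explicit solution above. The stationary Maxwell system is solved by an orthogonal
projection onto the graph of the curl with vanishing tangential trace (`exists_maxwell_solution`).

*Semigroups.* `MDissipative.exists_semigroup` is the generation theorem by Yosida approximation,
`exists_isGeneratedBy` adds the bounded perturbation, and `IsGeneratedBy.isWeakSolution` and
`IsGeneratedBy.isStrongSolution` give the solutions of the Cauchy problem.
-/

noncomputable section

namespace DispersiveMaxwell

section HilleYosida

variable {X : Type} [NormedAddCommGroup X] [InnerProductSpace ℂ X]

/-! ### Uniformly continuous contraction semigroups -/

/-- The uniformly continuous semigroup `exp (t a)`. -/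
def expSg (a : X →L[ℂ] X) (t : ℝ) : X →L[ℂ] X := NormedSpace.exp (t • a)

section Exp

theorem expSg_zero (a : X →L[ℂ] X) : expSg a 0 = ContinuousLinearMap.id ℂ X := by
  simp [expSg, NormedSpace.exp_zero]; rfl

variable [CompleteSpace X]

theorem expSg_hasDerivAt (a : X →L[ℂ] X) (x : X) (t : ℝ) :
    HasDerivAt (fun t => expSg a t x) (expSg a t (a x)) t := by
  have h := hasDerivAt_exp_smul_const (𝕂 := ℝ) a t
  have h2 := (((ContinuousLinearMap.apply ℂ X x).restrictScalars ℝ).hasFDerivAt).comp_hasDerivAt t h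
  exact h2

theorem expSg_add (a : X →L[ℂ] X) (s t : ℝ) : expSg a (s + t) = expSg a s ∘L expSg a t := by
  unfold expSg
  rw [add_smul]
  let : NormedAlgebra ℚ (X →L[ℂ] X) := NormedAlgebra.restrictScalars ℚ ℝ _
  exact NormedSpace.exp_add_of_commute (((Commute.refl a).smul_left s).smul_right t)

theorem expSg_commute {a b : X →L[ℂ] X} (h : Commute a b) (t : ℝ) (x : X) :
    expSg a t (b x) = b (expSg a t x) := by
  have : Commute (expSg a t) b := by
    unfold expSg
    exact (h.smul_left t).exp_left
  exact congrArg (fun f : X →L[ℂ] X => f x) this.eq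

/-- If `a` is dissipative, then `t ↦ ‖exp (t a) x‖²` is decreasing. -/
theorem expSg_norm_le {a : X →L[ℂ] X} (ha : ∀ x, (inner ℂ x (a x)).re ≤ 0) {t : ℝ} (ht : 0 ≤ t)
    (x : X) : ‖expSg a t x‖ ≤ ‖x‖ := by
  let : InnerProductSpace ℝ X := InnerProductSpace.complexToReal
  have hd : ∀ s : ℝ, HasDerivAt (fun s => ‖expSg a s x‖ ^ 2)
      (2 * inner ℝ (expSg a s x) (expSg a s (a x))) s := fun s => (expSg_hasDerivAt a x s).norm_sq
  have hanti : Antitone (fun s => ‖expSg a s x‖ ^ 2) := by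
    refine antitone_of_deriv_nonpos (fun s => (hd s).differentiableAt) fun s => ?_
    rw [(hd s).deriv, expSg_commute (Commute.refl a)]
    have := ha (expSg a s x)
    have h2 : inner ℝ (expSg a s x) (a (expSg a s x))
      = (inner ℂ (expSg a s x) (a (expSg a s x))).re := rfl
    rw [h2]; linarith
  have := hanti ht
  simp only [expSg_zero, ContinuousLinearMap.id_apply] at this
  exact le_of_sq_le_sq this (norm_nonneg _)

/-- Dependence of `exp (t a) x` on the generator. The bound involves only `‖a x - b x‖`, not the
operator norms, which is what makes the Yosida approximations converge. -/
theorem expSg_sub_le {a b : X →L[ℂ] X} (ha : ∀ x, (inner ℂ x (a x)).re ≤ 0)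
    (hb : ∀ x, (inner ℂ x (b x)).re ≤ 0) (hab : Commute a b) {t : ℝ} (ht : 0 ≤ t) (x : X) :
    ‖expSg a t x - expSg b t x‖ ≤ ‖a x - b x‖ * t := by
  -- differentiate `s ↦ exp (s a) exp ((t - s) b) x`
  have hd : ∀ s ∈ Icc 0 t, HasDerivWithinAt (fun s => expSg a s (expSg b (t - s) x))
      (expSg a s (expSg b (t - s) (a x - b x))) (Icc 0 t) s := by
    intro s _
    have h1 : HasDerivAt (fun s : ℝ => NormedSpace.exp (s • a)) (NormedSpace.exp (s • a) * a) s :=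
      hasDerivAt_exp_smul_const (𝕂 := ℝ) a s
    have h2 : HasDerivAt (fun s => expSg b (t - s) x) (-(expSg b (t - s) (b x))) s := by
      have := (expSg_hasDerivAt b x (t - s)).scomp s ((hasDerivAt_id s).const_sub t)
      refine (this.congr_deriv ?_)
      simp
    have h1' : HasDerivAt (fun s : ℝ => ContinuousLinearMap.restrictScalarsL ℂ X X ℝ ℝ (expSg a s))
        (ContinuousLinearMap.restrictScalarsL ℂ X X ℝ ℝ (expSg a s * a)) s :=
      (ContinuousLinearMap.restrictScalarsL ℂ X X ℝ ℝ).hasFDerivAt.comp_hasDerivAt s h1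
    have h3 := h1'.clm_apply h2
    refine (h3.congr_deriv ?_).hasDerivWithinAt
    change expSg a s (a (expSg b (t - s) x)) + expSg a s (-(expSg b (t - s) (b x))) = _
    rw [← map_add, ← expSg_commute hab.symm, ← sub_eq_add_neg, ← map_sub]
  have hbd : ∀ s ∈ Ico 0 t, ‖expSg a s (expSg b (t - s) (a x - b x))‖ ≤ ‖a x - b x‖ := by
    intro s hs
    exact (expSg_norm_le ha hs.1 _).trans (expSg_norm_le hb (by linarith [hs.2]) _)
  have := norm_image_sub_le_of_norm_deriv_le_segment' hd hbd t (right_mem_Icc.2 ht)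
  simpa [expSg_zero] using this

end Exp

/-! ### Maximal dissipative relations and their Yosida approximations -/

/-- `G` is the graph of a maximal dissipative operator `A`: `Re ⟨x, A x⟩ ≤ 0` for every `x` in the
domain, and `l - A` is onto for every `l > 0`. -/
structure MDissipative (G : Submodule ℂ (X × X)) : Prop where
  functional : ∀ p ∈ G, p.1 = 0 → p.2 = 0
  dissipative : ∀ p ∈ G, (inner ℂ p.1 p.2).re ≤ 0
  onto : ∀ l : ℝ, 0 < l → ∀ z, ∃ p ∈ G, (l : ℂ) • p.1 - p.2 = z

namespace MDissipative

variable {G : Submodule ℂ (X × X)}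

theorem norm_le (hG : MDissipative G) {p : X × X} (hp : p ∈ G) {l : ℝ} :
    l * ‖p.1‖ ≤ ‖(l : ℂ) • p.1 - p.2‖ := by
  have h := hG.dissipative p hp
  by_cases h0 : ‖p.1‖ = 0
  · rw [h0, mul_zero]; exact norm_nonneg _
  have hpos : 0 < ‖p.1‖ := lt_of_le_of_ne (norm_nonneg _) (Ne.symm h0)
  have h1 : l * ‖p.1‖ ^ 2 ≤ (inner ℂ p.1 ((l : ℂ) • p.1 - p.2)).re := by
    rw [inner_sub_right, inner_smul_right, inner_self_eq_norm_sq_to_K, Complex.sub_re]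
    have : ((l : ℂ) * ((‖p.1‖ : ℂ)) ^ 2).re = l * ‖p.1‖ ^ 2 := by
      rw [← Complex.ofReal_pow, ← Complex.ofReal_mul, Complex.ofReal_re]
    simp only [Complex.coe_algebraMap] at *
    linarith
  have h2 := (Complex.re_le_norm _).trans (norm_inner_le_norm (𝕜 := ℂ) p.1 ((l : ℂ) • p.1 - p.2))
  have h3 : ‖p.1‖ * (l * ‖p.1‖) ≤ ‖p.1‖ * ‖(l : ℂ) • p.1 - p.2‖ := by nlinarith
  exact le_of_mul_le_mul_left h3 hpos

theorem exists_resolvent (hG : MDissipative G) {l : ℝ} (hl : 0 < l) :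
    ∃ R : X →L[ℂ] X, (∀ z, (R z, (l : ℂ) • R z - z) ∈ G) ∧ (∀ z, l * ‖R z‖ ≤ ‖z‖) ∧
      ∀ p ∈ G, R ((l : ℂ) • p.1 - p.2) = p.1 := by
  choose P hP hPz using hG.onto l hl
  have huniq : ∀ p ∈ G, ∀ q ∈ G, (l : ℂ) • p.1 - p.2 = (l : ℂ) • q.1 - q.2 → p.1 = q.1 := by
    intro p hp q hq h
    have := hG.norm_le (G.sub_mem hp hq) (l := l)
    have h0 : (l : ℂ) • (p - q).1 - (p - q).2 = 0 := by
      rw [Prod.fst_sub, Prod.snd_sub, smul_sub, sub_sub_sub_comm, h, sub_self]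
    rw [h0, norm_zero] at this
    have h1 : ‖(p - q).1‖ ≤ 0 := by
      by_contra hc
      push Not at hc
      nlinarith [mul_pos hl hc]
    exact sub_eq_zero.1 (norm_le_zero_iff.1 h1)
  have hb : ∀ z, l * ‖(P z).1‖ ≤ ‖z‖ := fun z => by
    have := hG.norm_le (hP z) (l := l)
    rwa [hPz] at this
  let f : X →ₗ[ℂ] X :=
    { toFun := fun z => (P z).1
      map_add' := fun z w => by
        refine huniq _ (hP _) _ (G.add_mem (hP z) (hP w)) ?_
        rw [hPz, Prod.fst_add, Prod.snd_add, smul_add, add_sub_add_comm, hPz, hPz]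
      map_smul' := fun c z => by
        refine huniq _ (hP _) _ (G.smul_mem c (hP z)) ?_
        rw [hPz, Prod.smul_fst, Prod.smul_snd, smul_comm, ← smul_sub, hPz] }
  refine ⟨f.mkContinuous l⁻¹ fun z => ?_, fun z => ?_, fun z => hb z, fun p hp => ?_⟩
  · rw [inv_mul_eq_div, le_div_iff₀ hl, mul_comm]
    exact hb z
  · have h : (l : ℂ) • (P z).1 - z = (P z).2 := by
      nth_rewrite 2 [← hPz z]
      exact sub_sub_cancel _ _
    change ((P z).1, (l : ℂ) • (P z).1 - z) ∈ G
    rw [h]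
    exact hP z
  · exact huniq _ (hP _) _ hp (hPz _)

/-- The domain of a maximal dissipative relation is dense: a vector `y` orthogonal to it is
`x - w` with `(x, w) ∈ G`, and pairing with `x` gives `‖x‖² = Re ⟨x, w⟩ ≤ 0`. -/
theorem dense_domain [CompleteSpace X] (hG : MDissipative G) :
    Dense (G.map (LinearMap.fst ℂ X X) : Set X) := by
  rw [Submodule.dense_iff_topologicalClosure_eq_top, Submodule.topologicalClosure_eq_top_iff,
    Submodule.eq_bot_iff]
  intro y hy
  obtain ⟨p, hp, hpy⟩ := hG.onto 1 one_pos y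
  rw [Complex.ofReal_one, one_smul] at hpy
  have h0 : inner ℂ p.1 y = 0 := hy p.1 ⟨p, hp, rfl⟩
  rw [← hpy, inner_sub_right] at h0
  have h1 := congrArg Complex.re h0
  rw [Complex.sub_re, Complex.zero_re] at h1
  have h2 := hG.dissipative p hp
  have h3 : p.1 = 0 := (re_inner_self_nonpos (𝕜 := ℂ)).1 (by
    simp only [RCLike.re_to_complex]; linarith)
  rw [← hpy, h3, hG.functional p hp h3, sub_zero]

/-- The Yosida approximations `(n + 1) ((n + 1) R - 1)`, where `R` is the resolvent at `n + 1`: they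
are bounded, dissipative and commute, and converge to the operator on its domain. -/
theorem exists_yosida [CompleteSpace X] (hG : MDissipative G) :
    ∃ a : ℕ → X →L[ℂ] X, (∀ n x, (inner ℂ x (a n x)).re ≤ 0) ∧ (∀ m n, Commute (a m) (a n)) ∧
      ∀ p ∈ G, Tendsto (fun n => a n p.1) atTop (𝓝 p.2) := by
  have hpos : ∀ n : ℕ, (0 : ℝ) < n + 1 := fun n => by positivity
  choose R hRG hRb hRp using fun n : ℕ => hG.exists_resolvent (hpos n)
  -- the resolvent identity
  have hres : ∀ m n z,
      R m z - R n z = (((n : ℝ) + 1 : ℝ) - ((m : ℝ) + 1 : ℝ) : ℂ) • R n (R m z) := by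
    intro m n z
    have h := hRp n _ (hRG m z)
    simp only [map_sub, map_smul] at h
    rw [sub_smul]
    nth_rewrite 1 [← h]
    abel
  have hcomm : ∀ m n, Commute (R m) (R n) := by
    intro m n
    refine ContinuousLinearMap.ext fun z => ?_
    change R m (R n z) = R n (R m z)
    have h := hRp m (R n (R m z), (((n : ℝ) + 1 : ℝ) : ℂ) • R n (R m z) - R m z) (hRG n (R m z))
    refine Eq.trans (congrArg (R m) ?_) h
    have := hres m n z
    rw [sub_smul, sub_eq_iff_eq_add] at this
    simp only
    generalize R n (R m z) = u at this ⊢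
    rw [this]
    abel
  have hA : ∀ n : ℕ, ∀ p ∈ G, (((n : ℝ) + 1 : ℝ) : ℂ) • ((((n : ℝ) + 1 : ℝ) : ℂ) • R n p.1 - p.1) =
      (((n : ℝ) + 1 : ℝ) : ℂ) • R n p.2 := by
    intro n p hp
    have h := hRp n p hp
    rw [map_sub, map_smul, sub_eq_iff_eq_add] at h
    rw [h, add_sub_cancel_left]
  refine ⟨fun n => (((n : ℝ) + 1 : ℝ) : ℂ) • ((((n : ℝ) + 1 : ℝ) : ℂ) • R n - 1), fun n x => ?_,
    fun m n => ?_, fun p hp => ?_⟩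
  · have h1 : (inner ℂ x (R n x)).re ≤ ‖x‖ * ‖R n x‖ :=
      (Complex.re_le_norm _).trans (norm_inner_le_norm (𝕜 := ℂ) _ _)
    have h2 := hRb n x
    have h3 : (inner ℂ x x).re = ‖x‖ ^ 2 := inner_self_eq_norm_sq (𝕜 := ℂ) x
    change (inner ℂ x ((((n : ℝ) + 1 : ℝ) : ℂ) • ((((n : ℝ) + 1 : ℝ) : ℂ) • R n x - x))).re ≤ 0
    rw [inner_smul_right, inner_sub_right, inner_smul_right, Complex.re_ofReal_mul, Complex.sub_re,
      Complex.re_ofReal_mul, h3]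
    have h4 := mul_le_mul_of_nonneg_left h1 (hpos n).le
    have h5 := mul_le_mul_of_nonneg_left h2 (norm_nonneg x)
    refine mul_nonpos_of_nonneg_of_nonpos (hpos n).le ?_
    nlinarith
  · have := hcomm m n
    exact ((((this.smul_left _).smul_right _).sub_left (Commute.one_left _)).sub_right
      (Commute.one_right _)).smul_left _ |>.smul_right _
  · have h1 : ∀ (n : ℕ) (z : X), ‖(((n : ℝ) + 1 : ℝ) : ℂ) • R n z‖ ≤ ‖z‖ := by
      intro n z
      rw [norm_smul, Complex.norm_real, Real.norm_of_nonneg (hpos n).le]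
      exact hRb n z
    have h2 : ∀ q ∈ G, ∀ n : ℕ,
        ‖(((n : ℝ) + 1 : ℝ) : ℂ) • R n q.1 - q.1‖ ≤ ‖q.2‖ * (1 / ((n : ℝ) + 1)) := by
      intro q hq n
      have h := hRp n q hq
      rw [map_sub, map_smul, sub_eq_iff_eq_add] at h
      rw [h, add_sub_cancel_left, mul_one_div, le_div_iff₀ (hpos n), mul_comm]
      exact hRb n _
    have h3 : Tendsto (fun n : ℕ => (((n : ℝ) + 1 : ℝ) : ℂ) • R n p.2) atTop (𝓝 p.2) := by
      rw [Metric.tendsto_atTop]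
      intro e he
      obtain ⟨-, hqe, ⟨q, hq, rfl⟩⟩ :=
        Metric.dense_iff.1 hG.dense_domain p.2 (e / 3) (by positivity)
      rw [LinearMap.fst_apply, Metric.mem_ball, dist_eq_norm] at hqe
      have h4 : Tendsto (fun n : ℕ => ‖q.2‖ * (1 / ((n : ℝ) + 1))) atTop (𝓝 0) := by
        simpa using tendsto_one_div_add_atTop_nhds_zero_nat.const_mul ‖q.2‖
      obtain ⟨N, hN⟩ :=
        eventually_atTop.1 (h4.eventually (gt_mem_nhds (show 0 < e / 3 by positivity)))
      refine ⟨N, fun n hn => ?_⟩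
      rw [dist_eq_norm]
      have h5 := h1 n (p.2 - q.1)
      have h6 := (h2 q hq n).trans_lt (hN n hn)
      rw [norm_sub_rev p.2 q.1] at h5
      have h7 : (((n : ℝ) + 1 : ℝ) : ℂ) • R n p.2 - p.2 = (((n : ℝ) + 1 : ℝ) : ℂ) • R n (p.2 - q.1)
          + ((((n : ℝ) + 1 : ℝ) : ℂ) • R n q.1 - q.1) + (q.1 - p.2) := by
        rw [map_sub, smul_sub]; abel
      rw [h7]
      refine (norm_add₃_le).trans_lt ?_
      linarith
    refine h3.congr fun n => ?_
    exact (hA n p hp).symm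

end MDissipative

/-! ### The semigroup generated by a maximal dissipative operator -/

/-- Contractions that converge pointwise on a dense set converge pointwise to a contraction. -/
theorem exists_strong_limit [CompleteSpace X] {S : ℕ → X →L[ℂ] X} (hS : ∀ n x, ‖S n x‖ ≤ ‖x‖)
    {D : Set X} (hD : Dense D) (hc : ∀ x ∈ D, CauchySeq fun n => S n x) :
    ∃ T : X →L[ℂ] X, (∀ x, ‖T x‖ ≤ ‖x‖) ∧ ∀ x, Tendsto (fun n => S n x) atTop (𝓝 (T x)) := by
  have h : ∀ x, ∃ y, Tendsto (fun n => S n x) atTop (𝓝 y) := by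
    intro x
    refine cauchySeq_tendsto_of_complete (Metric.cauchySeq_iff.2 fun e he => ?_)
    obtain ⟨q, hqe, hq⟩ := Metric.dense_iff.1 hD x (e / 3) (by positivity)
    rw [Metric.mem_ball, dist_eq_norm] at hqe
    obtain ⟨N, hN⟩ := Metric.cauchySeq_iff.1 (hc q hq) (e / 3) (by positivity)
    refine ⟨N, fun m hm n hn => ?_⟩
    have h1 := hN m hm n hn
    have h2 := hS m (q - x)
    have h3 := hS n (q - x)
    rw [map_sub, norm_sub_rev] at h2
    rw [map_sub] at h3
    rw [dist_eq_norm] at h1 ⊢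
    have h4 : S m x - S n x = (S m x - S m q) + (S m q - S n q) + (S n q - S n x) := by abel
    rw [h4]
    refine norm_add₃_le.trans_lt ?_
    linarith
  choose f hf using h
  have hb : ∀ x, ‖f x‖ ≤ ‖x‖ := fun x =>
    le_of_tendsto (hf x).norm (Eventually.of_forall fun n => hS n x)
  let F : X →ₗ[ℂ] X :=
    { toFun := f
      map_add' := fun x y => tendsto_nhds_unique (hf (x + y))
        (((hf x).add (hf y)).congr fun n => (map_add (S n) x y).symm)
      map_smul' := fun c x => tendsto_nhds_unique (hf (c • x))
        (((hf x).const_smul c).congr fun n => (map_smul (S n) c x).symm) }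
  exact ⟨F.mkContinuous 1 fun x => by rw [one_mul]; exact hb x, hb, hf⟩

theorem expSg_sub_self_le [CompleteSpace X] {a : X →L[ℂ] X} (ha : ∀ x, (inner ℂ x (a x)).re ≤ 0)
    {t : ℝ} (ht : 0 ≤ t) (x : X) : ‖expSg a t x - x‖ ≤ t * ‖a x‖ := by
  have h := expSg_sub_le ha (b := 0) (fun x => by simp) (Commute.zero_right a) ht x
  have h0 : expSg (0 : X →L[ℂ] X) t = ContinuousLinearMap.id ℂ X := by
    rw [← expSg_zero (0 : X →L[ℂ] X)]; simp [expSg]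
  rw [h0] at h
  simpa [mul_comm] using h

/-- First order Taylor estimate for `exp (t a) x`, where `y` stands for a limit of `a x` and `z` is
an approximation of `y` at which `a` stays bounded. -/
theorem expSg_taylor_le [CompleteSpace X] {a : X →L[ℂ] X} (ha : ∀ x, (inner ℂ x (a x)).re ≤ 0)
    {t : ℝ} (ht : 0 ≤ t) (x y z : X) :
    ‖expSg a t x - x - t • y‖ ≤ (‖a x - y‖ + 2 * ‖y - z‖ + t * ‖a z‖) * t := by
  have hd : ∀ s ∈ Icc 0 t, HasDerivWithinAt (fun s => expSg a s x - s • y)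
      (expSg a s (a x) - y) (Icc 0 t) s := by
    intro s _
    have := (expSg_hasDerivAt a x s).sub ((hasDerivAt_id s).smul_const y)
    refine (this.congr_deriv ?_).hasDerivWithinAt
    simp
  have hbd : ∀ s ∈ Ico 0 t, ‖expSg a s (a x) - y‖ ≤ ‖a x - y‖ + 2 * ‖y - z‖ + t * ‖a z‖ := by
    intro s hs
    have h1 := expSg_norm_le ha hs.1 (a x - y)
    have h2 := expSg_norm_le ha hs.1 (y - z)
    have h3 := expSg_sub_self_le ha hs.1 z
    have h4 : s * ‖a z‖ ≤ t * ‖a z‖ := mul_le_mul_of_nonneg_right hs.2.le (norm_nonneg _)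
    have h5 : expSg a s (a x) - y = (expSg a s (a x - y) + expSg a s (y - z))
        + (expSg a s z - z) + (z - y) := by
      simp only [map_sub]; abel
    rw [h5]
    have h6 := norm_add_le (expSg a s (a x - y)) (expSg a s (y - z))
    have h7 := norm_sub_rev z y
    refine norm_add₃_le.trans ?_
    linarith
  have := norm_image_sub_le_of_norm_deriv_le_segment' hd hbd t (right_mem_Icc.2 ht)
  simp only [expSg_zero, ContinuousLinearMap.id_apply, zero_smul, sub_zero] at this
  rwa [sub_right_comm] at this

/-- **Lumer-Phillips theorem**: a maximal dissipative operator generates a contraction semigroup,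
the strong limit of the semigroups of its Yosida approximations. -/
theorem MDissipative.exists_semigroup [CompleteSpace X] {G : Submodule ℂ (X × X)}
    (hG : MDissipative G) :
    ∃ T : ℝ → X →L[ℂ] X, IsC0Semigroup T ∧ (∀ t, 0 ≤ t → ∀ x, ‖T t x‖ ≤ ‖x‖) ∧
      ∀ p, p ∈ G ↔ Tendsto (fun t : ℝ => t⁻¹ • (T t p.1 - p.1)) (𝓝[>] 0) (𝓝 p.2) := by
  obtain ⟨a, had, hac, hap⟩ := hG.exists_yosida
  have hlim : ∀ t : ℝ, ∃ T : X →L[ℂ] X, 0 ≤ t →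
      ((∀ x, ‖T x‖ ≤ ‖x‖) ∧ ∀ x, Tendsto (fun n => expSg (a n) t x) atTop (𝓝 (T x))) := by
    intro t
    by_cases ht : 0 ≤ t
    · obtain ⟨T, hT⟩ := exists_strong_limit (fun n x => expSg_norm_le (had n) ht x)
        hG.dense_domain (by
          rintro - ⟨p, hp, rfl⟩
          rw [LinearMap.fst_apply]
          have h1 := (hap p hp).cauchySeq
          refine Metric.cauchySeq_iff.2 fun e he => ?_
          obtain ⟨N, hN⟩ := Metric.cauchySeq_iff.1 h1 (e / (t + 1)) (by positivity)
          refine ⟨N, fun m hm n hn => ?_⟩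
          have h2 := hN m hm n hn
          rw [dist_eq_norm, lt_div_iff₀ (by positivity)] at h2
          rw [dist_eq_norm]
          refine (expSg_sub_le (had m) (had n) (hac m n) ht p.1).trans_lt (lt_of_le_of_lt ?_ h2)
          gcongr
          linarith)
      exact ⟨T, fun _ => hT⟩
    · exact ⟨0, fun h => absurd h ht⟩
  choose T hT using hlim
  have hb : ∀ t, 0 ≤ t → ∀ x, ‖T t x‖ ≤ ‖x‖ := fun t ht => (hT t ht).1
  have hl : ∀ t, 0 ≤ t → ∀ x, Tendsto (fun n => expSg (a n) t x) atTop (𝓝 (T t x)) :=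
    fun t ht => (hT t ht).2
  have hzero : T 0 = ContinuousLinearMap.id ℂ X := by
    refine ContinuousLinearMap.ext fun x => tendsto_nhds_unique (hl 0 le_rfl x) ?_
    simp only [expSg_zero]
    exact tendsto_const_nhds
  have hadd : ∀ s t, 0 ≤ s → 0 ≤ t → T (s + t) = T s ∘L T t := by
    intro s t hs ht
    refine ContinuousLinearMap.ext fun x => tendsto_nhds_unique (hl _ (add_nonneg hs ht) x) ?_
    simp only [expSg_add, ContinuousLinearMap.comp_apply]
    have h1 := hl s hs (T t x)
    have h2 : Tendsto (fun n => expSg (a n) s (expSg (a n) t x - T t x)) atTop (𝓝 0) := by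
      refine squeeze_zero_norm (fun n => expSg_norm_le (had n) hs _) ?_
      simpa using ((hl t ht x).sub_const (T t x)).norm
    simpa using h2.add h1
  have htay : ∀ p ∈ G, ∀ q ∈ G, ∀ t, 0 ≤ t →
      ‖T t p.1 - p.1 - t • p.2‖ ≤ (2 * ‖p.2 - q.1‖ + t * ‖q.2‖) * t := by
    intro p hp q hq t ht
    have h1 := (((hl t ht p.1).sub_const p.1).sub_const (t • p.2)).norm
    have h2 : Tendsto (fun n => (‖a n p.1 - p.2‖ + 2 * ‖p.2 - q.1‖ + t * ‖a n q.1‖) * t) atTop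
        (𝓝 ((‖p.2 - p.2‖ + 2 * ‖p.2 - q.1‖ + t * ‖q.2‖) * t)) :=
      (((((hap p hp).sub_const p.2).norm).add_const _).add
        ((hap q hq).norm.const_mul t)).mul_const t
    have := le_of_tendsto_of_tendsto h1 h2
      (Eventually.of_forall fun n => expSg_taylor_le (had n) ht p.1 p.2 q.1)
    simpa using this
  have hforward : ∀ p ∈ G, Tendsto (fun t : ℝ => t⁻¹ • (T t p.1 - p.1)) (𝓝[>] 0) (𝓝 p.2) := by
    intro p hp
    rw [Metric.tendsto_nhds]
    intro e he
    obtain ⟨-, hqe, ⟨q, hq, rfl⟩⟩ := Metric.dense_iff.1 hG.dense_domain p.2 (e / 4) (by positivity)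
    rw [LinearMap.fst_apply, Metric.mem_ball, dist_eq_norm, norm_sub_rev] at hqe
    have h1 : Tendsto (fun t : ℝ => t * ‖q.2‖) (𝓝[>] 0) (𝓝 0) := by
      have : Tendsto (fun t : ℝ => t * ‖q.2‖) (𝓝 0) (𝓝 (0 * ‖q.2‖)) := tendsto_id.mul_const _
      rw [zero_mul] at this
      exact this.mono_left nhdsWithin_le_nhds
    filter_upwards [self_mem_nhdsWithin, h1.eventually (gt_mem_nhds (show 0 < e / 2 by positivity))]
      with t ht ht2
    have ht0 : 0 < t := ht
    have h2 := htay p hp q hq t ht0.le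
    rw [dist_eq_norm]
    have h3 : t⁻¹ • (T t p.1 - p.1) - p.2 = t⁻¹ • (T t p.1 - p.1 - t • p.2) := by
      rw [smul_sub t⁻¹ _ (t • p.2), smul_smul, inv_mul_cancel₀ ht0.ne', one_smul]
    rw [h3, norm_smul, norm_inv, Real.norm_of_nonneg ht0.le, inv_mul_eq_div]
    rw [← div_le_iff₀ ht0] at h2
    refine h2.trans_lt ?_
    linarith
  refine ⟨T, ⟨hzero, hadd, fun x => ?_⟩, hb, fun p => ⟨hforward p, fun hp => ?_⟩⟩
  · rw [Metric.tendsto_nhds]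
    intro e he
    obtain ⟨-, hqe, ⟨q, hq, rfl⟩⟩ := Metric.dense_iff.1 hG.dense_domain x (e / 3) (by positivity)
    rw [LinearMap.fst_apply, Metric.mem_ball, dist_eq_norm] at hqe
    have h1 : Tendsto (fun t : ℝ => t * ‖q.2‖) (𝓝[>] 0) (𝓝 0) := by
      have : Tendsto (fun t : ℝ => t * ‖q.2‖) (𝓝 0) (𝓝 (0 * ‖q.2‖)) := tendsto_id.mul_const _
      rw [zero_mul] at this
      exact this.mono_left nhdsWithin_le_nhds
    filter_upwards [self_mem_nhdsWithin, h1.eventually (gt_mem_nhds (show 0 < e / 3 by positivity))]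
      with t ht ht2
    have ht0 : 0 ≤ t := le_of_lt ht
    have h2 : ‖T t q.1 - q.1‖ ≤ t * ‖q.2‖ :=
      le_of_tendsto_of_tendsto ((hl t ht0 q.1).sub_const q.1).norm ((hap q hq).norm.const_mul t)
        (Eventually.of_forall fun n => expSg_sub_self_le (had n) ht0 q.1)
    have h3 := hb t ht0 (q.1 - x)
    rw [map_sub, norm_sub_rev] at h3
    rw [dist_eq_norm]
    have h4 : T t x - x = (T t x - T t q.1) + (T t q.1 - q.1) + (q.1 - x) := by abel
    rw [h4]
    refine norm_add₃_le.trans_lt ?_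
    linarith
  -- the generator is a dissipative extension of `G`, hence equal to it
  · obtain ⟨q, hq, hqp⟩ := hG.onto 1 one_pos (p.1 - p.2)
    rw [Complex.ofReal_one, one_smul] at hqp
    have h1 : Tendsto (fun t : ℝ => t⁻¹ • (T t (p.1 - q.1) - (p.1 - q.1))) (𝓝[>] 0)
        (𝓝 (p.2 - q.2)) := by
      refine (hp.sub (hforward q hq)).congr fun t => ?_
      rw [← smul_sub, map_sub]
      congr 1
      abel
    have h2 : p.2 - q.2 = p.1 - q.1 := by
      rw [sub_eq_sub_iff_sub_eq_sub] at hqp ⊢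
      rw [sub_eq_sub_iff_add_eq_add] at hqp ⊢
      rw [add_comm, ← hqp, add_comm]
    rw [h2] at h1
    have h3 : (inner ℂ (p.1 - q.1) (p.1 - q.1)).re ≤ 0 := by
      have h4 := (Complex.continuous_re.tendsto _).comp
        (tendsto_const_nhds (x := p.1 - q.1).inner h1 (𝕜 := ℂ))
      refine le_of_tendsto h4 ?_
      filter_upwards [self_mem_nhdsWithin] with t ht
      have ht0 : 0 < t := ht
      have h5 := (Complex.re_le_norm _).trans
        (norm_inner_le_norm (𝕜 := ℂ) (p.1 - q.1) (T t (p.1 - q.1)))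
      have h6 := hb t ht0.le (p.1 - q.1)
      have h7 : (inner ℂ (p.1 - q.1) (p.1 - q.1)).re = ‖p.1 - q.1‖ ^ 2 :=
        inner_self_eq_norm_sq (𝕜 := ℂ) _
      have h8 : (inner ℂ (p.1 - q.1) (t⁻¹ • (T t (p.1 - q.1) - (p.1 - q.1)))).re =
          t⁻¹ * ((inner ℂ (p.1 - q.1) (T t (p.1 - q.1))).re - ‖p.1 - q.1‖ ^ 2) := by
        rw [← h7, ← Complex.coe_smul, inner_smul_right, inner_sub_right, Complex.re_ofReal_mul,
          Complex.sub_re]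
      simp only [Function.comp_apply]
      rw [h8]
      refine mul_nonpos_of_nonneg_of_nonpos (inv_nonneg.2 ht0.le) ?_
      nlinarith [norm_nonneg (p.1 - q.1)]
    have h4 : p.1 - q.1 = 0 := (re_inner_self_nonpos (𝕜 := ℂ)).1 h3
    have h5 : p = q := Prod.ext (sub_eq_zero.1 h4) (sub_eq_zero.1 (h2.trans h4))
    rw [h5]; exact hq

end HilleYosida

/-! ### Bounded perturbations and solutions of the Cauchy problem -/

section Generation

variable {X : Type} [NormedAddCommGroup X] [InnerProductSpace ℂ X]

/-- The graph of `A + B`, where `G` is the graph of `A`. -/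
def perturb (G : Submodule ℂ (X × X)) (B : X →L[ℂ] X) : Submodule ℂ (X × X) :=
  G.comap ((LinearMap.fst ℂ X X).prod (LinearMap.snd ℂ X X - B.toLinearMap ∘ₗ LinearMap.fst ℂ X X))

theorem mem_perturb {G : Submodule ℂ (X × X)} {B : X →L[ℂ] X} {p : X × X} :
    p ∈ perturb G B ↔ (p.1, p.2 - B p.1) ∈ G := Iff.rfl

/-- A bounded perturbation of a maximal dissipative operator is maximal dissipative up to a shift:
`l + w - A - B = (1 - B R) (l + w - A)` with `R = (l + w - A)⁻¹`, and `‖B R‖ ≤ w / (l + w) < 1`. -/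
theorem MDissipative.perturb [CompleteSpace X] {G : Submodule ℂ (X × X)} (hG : MDissipative G)
    (B : X →L[ℂ] X) {w : ℝ} (hw : ‖B‖ ≤ w) :
    MDissipative (perturb G (B - (w : ℂ) • ContinuousLinearMap.id ℂ X)) := by
  have hw0 : 0 ≤ w := (norm_nonneg B).trans hw
  refine ⟨fun p hp h0 => ?_, fun p hp => ?_, fun l hl z => ?_⟩
  · have := hG.functional _ (mem_perturb.1 hp) h0
    simpa [h0] using this
  · have h1 := hG.dissipative _ (mem_perturb.1 hp)
    have h2 : (inner ℂ p.1 (B p.1)).re ≤ w * ‖p.1‖ ^ 2 := by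
      refine (Complex.re_le_norm _).trans ((norm_inner_le_norm (𝕜 := ℂ) _ _).trans ?_)
      have := (B.le_opNorm p.1).trans (mul_le_mul_of_nonneg_right hw (norm_nonneg p.1))
      nlinarith [norm_nonneg p.1]
    have h3 : (inner ℂ p.1 p.1).re = ‖p.1‖ ^ 2 := inner_self_eq_norm_sq (𝕜 := ℂ) _
    simp only [_root_.sub_apply, _root_.smul_apply,
      ContinuousLinearMap.id_apply, inner_sub_right, inner_smul_right, Complex.sub_re,
      Complex.re_ofReal_mul, h3] at h1
    linarith
  · obtain ⟨R, hR, hRb, -⟩ := hG.exists_resolvent (add_pos_of_pos_of_nonneg hl hw0)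
    have hlt : ‖B * R‖ < 1 := by
      have : ‖B * R‖ ≤ w / (l + w) := by
        refine ContinuousLinearMap.opNorm_le_bound _ (by positivity) fun x => ?_
        refine (B.le_opNorm (R x)).trans ?_
        rw [div_mul_eq_mul_div, le_div_iff₀ (by positivity)]
        have h1 := hRb x
        have h2 := mul_le_mul_of_nonneg_right hw (norm_nonneg (R x))
        have h3 := mul_le_mul_of_nonneg_right h2 (show 0 ≤ l + w by positivity)
        have h4 := mul_le_mul_of_nonneg_left h1 hw0
        linarith
      refine this.trans_lt ?_
      rw [div_lt_one (by positivity)]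
      linarith
    obtain ⟨u, hu⟩ := isUnit_one_sub_of_norm_lt_one hlt
    have hv : ∀ z, (1 - B * R) ((↑u⁻¹ : X →L[ℂ] X) z) = z := fun z => by
      rw [← hu]
      exact congrArg (fun f : X →L[ℂ] X => f z) u.mul_inv
    set v := (↑u⁻¹ : X →L[ℂ] X) z with hvdef
    have h1 := hv z
    rw [← hvdef] at h1
    have h2 : v - B (R v) = z := h1
    refine ⟨(R v, (((l + w : ℝ) : ℂ) • R v - v) + (B (R v) - (w : ℂ) • R v)), ?_, ?_⟩
    · rw [mem_perturb]
      have := hR v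
      convert this using 2
      simp
    · simp only
      rw [← h2, Complex.ofReal_add]
      module

/-- A quasi-contractive `C₀`-semigroup generated by the operator with graph `G`. -/
structure IsGeneratedBy (G : Submodule ℂ (X × X)) (w : ℝ) (T : ℝ → X →L[ℂ] X) : Prop where
  semigroup : IsC0Semigroup T
  norm_le : ∀ t, 0 ≤ t → ∀ x, ‖T t x‖ ≤ Real.exp (w * t) * ‖x‖
  mem_iff : ∀ p, p ∈ G ↔ Tendsto (fun t : ℝ => t⁻¹ • (T t p.1 - p.1)) (𝓝[>] 0) (𝓝 p.2)
  dense : Dense (G.map (LinearMap.fst ℂ X X) : Set X)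

/-- A bounded perturbation of a maximal dissipative operator is a generator: up to a shift by
the norm `w` of the perturbation it is maximal dissipative, and the factor `e^{w t}` undoes the
shift. -/
theorem exists_isGeneratedBy [CompleteSpace X] {G G₀ : Submodule ℂ (X × X)}
    (hG₀ : MDissipative G₀) (B : X →L[ℂ] X) (hG : G = perturb G₀ B) :
    ∃ T, IsGeneratedBy G ‖B‖ T := by
  set w := ‖B‖
  have hP := hG₀.perturb B (w := w) le_rfl
  obtain ⟨T, hT, hb, hiff⟩ := hP.exists_semigroup
  have hmem : ∀ p : X × X, p ∈ G ↔
      (p.1, p.2 - (w : ℂ) • p.1) ∈ perturb G₀ (B - (w : ℂ) • ContinuousLinearMap.id ℂ X) := by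
    intro p
    rw [hG, mem_perturb, mem_perturb]
    simp
  have hexp : Tendsto (fun t : ℝ => t⁻¹ * (Real.exp (w * t) - 1)) (𝓝[>] 0) (𝓝 w) := by
    have h : HasDerivAt (fun t : ℝ => Real.exp (w * t)) w 0 := by
      have := ((hasDerivAt_id (0 : ℝ)).const_mul w).exp
      simpa using this
    have h2 := (hasDerivWithinAt_iff_tendsto_slope' (s := Ioi 0) (by simp)).1 h.hasDerivWithinAt
    refine h2.congr fun t => ?_
    simp [slope_def_field, div_eq_inv_mul]
  have hexp1 : Tendsto (fun t : ℝ => Real.exp (w * t)) (𝓝[>] 0) (𝓝 1) := by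
    have : Continuous fun t : ℝ => Real.exp (w * t) := by fun_prop
    have := this.tendsto 0
    simp only [mul_zero, Real.exp_zero] at this
    exact this.mono_left nhdsWithin_le_nhds
  refine ⟨fun t => Real.exp (w * t) • T t, ⟨?_, ?_, ?_⟩, ?_, fun p => ?_, ?_⟩
  · simp [hT.zero]
  · intro s t hs ht
    ext x
    simp only [hT.add s t hs ht, mul_add, Real.exp_add, _root_.smul_apply,
      ContinuousLinearMap.comp_apply, map_smul, ← Complex.coe_smul, mul_smul]
    exact smul_comm _ _ _
  · intro x
    simpa using hexp1.smul (hT.tendsto x)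
  · intro t ht x
    simp only [_root_.smul_apply, norm_smul, Real.norm_of_nonneg (Real.exp_pos _).le]
    exact mul_le_mul_of_nonneg_left (hb t ht x) (Real.exp_pos _).le
  · rw [hmem, hiff]
    simp only [_root_.smul_apply]
    have key : ∀ t : ℝ, t⁻¹ • (Real.exp (w * t) • T t p.1 - p.1) =
        Real.exp (w * t) • (t⁻¹ • (T t p.1 - p.1)) + (t⁻¹ * (Real.exp (w * t) - 1)) • p.1 := by
      intro t; module
    have hinv : Tendsto (fun t : ℝ => (Real.exp (w * t))⁻¹) (𝓝[>] 0) (𝓝 1) := by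
      simpa using hexp1.inv₀ one_ne_zero
    constructor
    · intro h
      have := (hexp1.smul h).add (hexp.smul_const p.1)
      rw [one_smul, Complex.coe_smul, sub_add_cancel] at this
      exact this.congr fun t => (key t).symm
    · intro h
      have := hinv.smul (h.sub (hexp.smul_const p.1))
      rw [one_smul, ← Complex.coe_smul] at this
      refine this.congr fun t => ?_
      rw [key, add_sub_cancel_right, smul_smul, inv_mul_cancel₀ (Real.exp_pos _).ne', one_smul]
  · refine hP.dense_domain.mono ?_
    rintro - ⟨p, hp, rfl⟩
    exact ⟨(p.1, p.2 + (w : ℂ) • p.1), (hmem _).2 (by simpa using hp), rfl⟩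

namespace IsGeneratedBy

variable {G : Submodule ℂ (X × X)} {w : ℝ} {T : ℝ → X →L[ℂ] X}

theorem invariant (h : IsGeneratedBy G w T) {p : X × X} (hp : p ∈ G) {t : ℝ} (ht : 0 ≤ t) :
    (T t p.1, T t p.2) ∈ G := by
  rw [h.mem_iff]
  have h1 := ((T t).continuous.tendsto _).comp ((h.mem_iff p).1 hp)
  refine h1.congr' ?_
  filter_upwards [self_mem_nhdsWithin] with s hs
  have hs0 : 0 ≤ s := le_of_lt hs
  have h2 : T s (T t p.1) = T t (T s p.1) := by
    have e1 := congrArg (fun f : X →L[ℂ] X => f p.1) (h.semigroup.add s t hs0 ht)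
    have e2 := congrArg (fun f : X →L[ℂ] X => f p.1) (h.semigroup.add t s ht hs0)
    rw [add_comm] at e1
    exact e1.symm.trans e2
  simp only [Function.comp_apply]
  rw [h2, ← map_sub, ← Complex.coe_smul, ← Complex.coe_smul, map_smul]

theorem apply_add (h : IsGeneratedBy G w T) {s t : ℝ} (hs : 0 ≤ s) (ht : 0 ≤ t) (x : X) :
    T (s + t) x = T s (T t x) := congrArg (fun f : X →L[ℂ] X => f x) (h.semigroup.add s t hs ht)

theorem tendsto_abs_sub (t : ℝ) : Tendsto (fun s : ℝ => |s - t|) (𝓝[Ici 0 \ {t}] t) (𝓝[>] 0) := by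
  refine tendsto_nhdsWithin_iff.2 ⟨?_, ?_⟩
  · have : Continuous fun s : ℝ => |s - t| := by fun_prop
    have := this.tendsto t
    simp only [sub_self, abs_zero] at this
    exact this.mono_left nhdsWithin_le_nhds
  · filter_upwards [self_mem_nhdsWithin] with s hs
    exact abs_pos.2 (sub_ne_zero.2 hs.2)

theorem norm_min_le (h : IsGeneratedBy G w T) (hw : 0 ≤ w) {s t : ℝ} (hs : 0 ≤ s) (ht : 0 ≤ t)
    (x : X) : ‖T (min s t) x‖ ≤ Real.exp (w * t) * ‖x‖ := by
  refine (h.norm_le _ (le_min hs ht) x).trans ?_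
  gcongr
  exact min_le_right _ _

theorem sub_apply_eq (h : IsGeneratedBy G w T) {s t : ℝ} (hs : 0 ≤ s) (ht : 0 ≤ t) (x : X) :
    ‖T s x - T t x‖ = ‖T (min s t) (T |s - t| x - x)‖ := by
  rcases le_total s t with hst | hst
  · rw [min_eq_left hst, abs_of_nonpos (sub_nonpos.2 hst), map_sub, ← h.apply_add hs (by linarith),
      neg_sub, add_sub_cancel, norm_sub_rev]
  · rw [min_eq_right hst, abs_of_nonneg (sub_nonneg.2 hst), map_sub, ← h.apply_add ht (by linarith),
      add_sub_cancel]

theorem continuousOn (h : IsGeneratedBy G w T) (hw : 0 ≤ w) (x : X) :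
    ContinuousOn (fun t => T t x) (Ici 0) := by
  intro t ht
  rw [← continuousWithinAt_sdiff_self, ContinuousWithinAt, tendsto_iff_norm_sub_tendsto_zero]
  have h1 : Tendsto (fun s : ℝ => Real.exp (w * t) * ‖T |s - t| x - x‖)
      (𝓝[Ici 0 \ {t}] t) (𝓝 0) := by
    simpa using (((h.semigroup.tendsto x).comp (tendsto_abs_sub t)).sub_const x).norm.const_mul
      (Real.exp (w * t))
  refine squeeze_zero' (Eventually.of_forall fun _ => norm_nonneg _) ?_ h1
  filter_upwards [self_mem_nhdsWithin] with s hs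
  rw [h.sub_apply_eq hs.1 ht]
  exact h.norm_min_le hw hs.1 ht _

theorem hasDerivWithinAt (h : IsGeneratedBy G w T) (hw : 0 ≤ w) {p : X × X} (hp : p ∈ G) {t : ℝ}
    (ht : 0 ≤ t) : HasDerivWithinAt (fun t => T t p.1) (T t p.2) (Ici 0) t := by
  rw [hasDerivWithinAt_iff_tendsto_slope, tendsto_iff_norm_sub_tendsto_zero]
  have h1 : Tendsto (fun s : ℝ => Real.exp (w * t) *
      ‖|s - t|⁻¹ • (T |s - t| p.1 - p.1) - p.2‖ + ‖T (min s t) p.2 - T t p.2‖)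
      (𝓝[Ici 0 \ {t}] t) (𝓝 0) := by
    have e1 := ((((h.mem_iff p).1 hp).comp (tendsto_abs_sub t)).sub_const p.2).norm.const_mul
      (Real.exp (w * t))
    have e2 : Tendsto (fun s : ℝ => min s t) (𝓝[Ici 0 \ {t}] t) (𝓝[Ici 0] t) := by
      refine tendsto_nhdsWithin_iff.2 ⟨?_, ?_⟩
      · have : Continuous fun s : ℝ => min s t := by fun_prop
        have := this.tendsto t
        simp only [min_self] at this
        exact this.mono_left nhdsWithin_le_nhds
      · filter_upwards [self_mem_nhdsWithin] with s hs
        exact le_min hs.1 ht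
    have e3 := (((h.continuousOn hw p.2 t ht).tendsto.comp e2).sub_const (T t p.2)).norm
    have := e1.add e3
    simpa using this
  refine squeeze_zero' (Eventually.of_forall fun _ => norm_nonneg _) ?_ h1
  filter_upwards [self_mem_nhdsWithin] with s hs
  have hs0 : (0 : ℝ) ≤ s := hs.1
  have key : slope (fun t => T t p.1) t s =
      T (min s t) (|s - t|⁻¹ • (T |s - t| p.1 - p.1)) := by
    rw [← Complex.coe_smul, map_smul, Complex.coe_smul, map_sub, slope_def_module]
    rcases le_total s t with hst | hst
    · rw [min_eq_left hst, abs_of_nonpos (sub_nonpos.2 hst), ← h.apply_add hs0 (by linarith),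
        neg_sub, add_sub_cancel, ← neg_sub t s, ← neg_sub (T t p.1), inv_neg, neg_smul_neg]
    · rw [min_eq_right hst, abs_of_nonneg (sub_nonneg.2 hst), ← h.apply_add ht (by linarith),
        add_sub_cancel]
  rw [key]
  have e : T (min s t) (|s - t|⁻¹ • (T |s - t| p.1 - p.1)) - T t p.2 =
      T (min s t) (|s - t|⁻¹ • (T |s - t| p.1 - p.1) - p.2) + (T (min s t) p.2 - T t p.2) := by
    rw [map_sub]; abel
  rw [e]
  exact (norm_add_le _ _).trans (add_le_add_left (h.norm_min_le hw hs0 ht _) _)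

/-- The orbit of an arbitrary vector is a weak solution: for initial values in the domain this is
the product rule, and the mean value inequality is stable under passage to the limit. -/
theorem isWeakSolution {A : X →ₗ.[ℂ] X} (h : IsGeneratedBy A.graph w T) (hw : 0 ≤ w) (U₀ : X) :
    IsWeakSolution A U₀ (fun t => T t U₀) := by
  refine ⟨h.continuousOn hw U₀, by simp [h.semigroup.zero], fun y z hyz t ht => ?_⟩
  have hadj : ∀ p ∈ A.graph, inner ℂ y p.2 = inner ℂ z p.1 := by
    intro p hp
    obtain ⟨u, hu1, hu2⟩ := (LinearPMap.mem_graph_iff A).1 hp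
    rw [← hu1, ← hu2]
    exact hyz u
  rw [hasDerivWithinAt_iff_isLittleO, Asymptotics.isLittleO_iff]
  intro c hc
  set e := c / (‖z‖ + 1) with he_def
  have he : 0 < e := by positivity
  obtain ⟨r, hr, hrt⟩ := Metric.continuousWithinAt_iff.1 (h.continuousOn hw U₀ t ht) e he
  set S : Set ℝ := Ici 0 ∩ Metric.ball t r
  have hSc : Convex ℝ S := (convex_Ici 0).inter (convex_ball t r)
  have htS : t ∈ S := ⟨ht, Metric.mem_ball_self hr⟩
  set M := Real.exp (w * (t + r))
  have hest : ∀ p ∈ A.graph, ∀ s ∈ S,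
      ‖(inner ℂ y (T s p.1) - s • inner ℂ z (T t U₀))
          - (inner ℂ y (T t p.1) - t • inner ℂ z (T t U₀))‖
        ≤ (‖z‖ * (M * ‖p.1 - U₀‖ + e)) * ‖s - t‖ := by
    intro p hp s hs
    refine hSc.norm_image_sub_le_of_norm_hasDerivWithin_le
      (f := fun s : ℝ => inner ℂ y (T s p.1) - s • inner ℂ z (T t U₀))
      (f' := fun s : ℝ => inner ℂ z (T s p.1) - inner ℂ z (T t U₀)) ?_ ?_ htS hs
    · intro q hq
      have h1 := (h.hasDerivWithinAt hw hp hq.1).mono (inter_subset_left : S ⊆ Ici 0)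
      have h2 : HasDerivWithinAt (fun s => inner ℂ y (T s p.1)) (inner ℂ y (T q p.2)) S q :=
        ((innerSL ℂ y).restrictScalars ℝ).hasFDerivAt.comp_hasDerivWithinAt q h1
      rw [hadj _ (h.invariant hp hq.1)] at h2
      have h3 := h2.sub
        (((hasDerivAt_id q).smul_const (inner ℂ z (T t U₀))).hasDerivWithinAt (s := S))
      refine h3.congr_deriv ?_
      rw [one_smul]
    · intro q hq
      rw [← inner_sub_right]
      refine (norm_inner_le_norm _ _).trans (mul_le_mul_of_nonneg_left ?_ (norm_nonneg _))
      have h1 := h.norm_le q hq.1 (p.1 - U₀)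
      have h2 : Real.exp (w * q) ≤ M := by
        have := hq.2
        rw [Metric.mem_ball, Real.dist_eq, abs_lt] at this
        refine Real.exp_le_exp.2 (mul_le_mul_of_nonneg_left ?_ hw)
        linarith
      have h3 := hrt hq.1 hq.2
      rw [dist_eq_norm] at h3
      have h4 : T q p.1 - T t U₀ = T q (p.1 - U₀) + (T q U₀ - T t U₀) := by
        rw [map_sub]; abel
      rw [h4]
      refine (norm_add_le _ _).trans (add_le_add (h1.trans ?_) h3.le)
      gcongr
  filter_upwards [inter_mem_nhdsWithin (Ici 0) (Metric.ball_mem_nhds t hr)] with s hs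
  have hcl : IsClosed {x : X |
      ‖(inner ℂ y (T s x) - s • inner ℂ z (T t U₀)) - (inner ℂ y (T t x) - t • inner ℂ z (T t U₀))‖
        ≤ (‖z‖ * (M * ‖x - U₀‖ + e)) * ‖s - t‖} := by
    refine isClosed_le ?_ ?_ <;> fun_prop
  have hsub : (A.graph.map (LinearMap.fst ℂ X X) : Set X) ⊆ {x : X |
      ‖(inner ℂ y (T s x) - s • inner ℂ z (T t U₀)) - (inner ℂ y (T t x) - t • inner ℂ z (T t U₀))‖
        ≤ (‖z‖ * (M * ‖x - U₀‖ + e)) * ‖s - t‖} := by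
    rintro - ⟨p, hp, rfl⟩
    exact hest p hp s hs
  have hU := closure_minimal hsub hcl (h.dense U₀)
  simp only [mem_ofPred_eq, sub_self, norm_zero, mul_zero, zero_add] at hU
  rw [sub_smul]
  have h5 : ‖z‖ * e ≤ c := by
    rw [he_def, mul_div_assoc', div_le_iff₀ (by positivity)]
    nlinarith [norm_nonneg z]
  refine le_trans (le_of_eq ?_) (hU.trans (mul_le_mul_of_nonneg_right h5 (norm_nonneg _)))
  congr 1
  abel

theorem hasDerivWithinAt_powDomain {A : X →ₗ.[ℂ] X} {k : ℕ} {W : ℝ → powDomain A k}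
    {V : powDomain A k} {s : Set ℝ} {t : ℝ}
    (h : ∀ j, HasDerivWithinAt (fun t => (W t : Fin (k + 1) → X) j) ((V : Fin (k + 1) → X) j) s t) :
    HasDerivWithinAt W V s t := by
  rw [hasDerivWithinAt_iff_tendsto_slope, Topology.IsInducing.subtypeVal.tendsto_nhds_iff]
  have h2 := hasDerivWithinAt_iff_tendsto_slope.1 (hasDerivWithinAt_pi.2 h)
  refine h2.congr fun r => ?_
  simp only [slope_def_module, Function.comp_apply]
  rfl

theorem isStrongSolution {A : X →ₗ.[ℂ] X} (h : IsGeneratedBy A.graph w T) (hw : 0 ≤ w) {k : ℕ}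
    (hk : 1 ≤ k) {W : Fin (k + 1) → X} (hW : W ∈ powDomain A k) :
    IsStrongSolution A k (W 0) (fun t => T t (W 0)) := by
  obtain ⟨m, rfl⟩ : ∃ m, k = m + 1 := ⟨k - 1, by omega⟩
  refine ⟨by simp [h.semigroup.zero], fun t ht => ?_, ?_, ?_⟩
  · have hp : (W 0, W 1) ∈ A.graph := hW 0
    exact ⟨T t (W 1), h.invariant hp ht, h.hasDerivWithinAt hw hp ht⟩
  · -- the values for `t < 0` are immaterial; `max t 0` keeps the tuple in `D(A^k)`
    refine ⟨fun t => ⟨fun j => T (max t 0) (W j), fun j => h.invariant (hW j) (le_max_right _ _)⟩,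
      ?_, fun t ht => by simp [max_eq_left ht]⟩
    refine continuousOn_iff_continuous_domRestrict.2 ?_
    refine Continuous.subtype_mk (continuous_pi fun j => ?_) _
    have := continuousOn_iff_continuous_domRestrict.1 (h.continuousOn hw (W j))
    refine this.congr fun t => ?_
    simp [max_eq_left t.2.out]
  · have hmem : ∀ t, (fun j : Fin (m + 1) => T (max t 0) (W j.castSucc)) ∈ powDomain A m :=
      fun t j => h.invariant (hW j.castSucc) (le_max_right _ _)
    have hmem' : ∀ t, (fun j : Fin (m + 1) => T (max t 0) (W j.succ)) ∈ powDomain A m :=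
      fun t j => h.invariant (hW j.succ) (le_max_right _ _)
    refine ⟨fun t => ⟨_, hmem t⟩, ?_, fun t ht => by simp [max_eq_left ht]⟩
    have hd : ∀ t ∈ Ici (0 : ℝ), HasDerivWithinAt (fun t => (⟨_, hmem t⟩ : powDomain A m))
        ⟨_, hmem' t⟩ (Ici 0) t := by
      intro t ht
      refine hasDerivWithinAt_powDomain fun j => ?_
      have h1 := h.hasDerivWithinAt hw (hW j) ht
      simp only [max_eq_left ht.out]
      refine h1.congr (fun s hs => ?_) ?_
      · simp [max_eq_left hs.out]
      · simp [max_eq_left ht.out]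
    refine (contDiffOn_one_iff_derivWithin (uniqueDiffOn_Ici 0)).2
      ⟨fun t ht => (hd t ht).differentiableWithinAt, ?_⟩
    refine ContinuousOn.congr (f := fun t => (⟨_, hmem' t⟩ : powDomain A m)) ?_
      fun t ht => (hd t ht).derivWithin (uniqueDiffOn_Ici 0 t ht)
    refine continuousOn_iff_continuous_domRestrict.2 ?_
    refine Continuous.subtype_mk (continuous_pi fun j => ?_) _
    have := continuousOn_iff_continuous_domRestrict.1 (h.continuousOn hw (W j.succ))
    refine this.congr fun t => ?_
    simp [max_eq_left t.2.out]

end IsGeneratedBy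
end Generation

/-! ### Test functions on the half line -/

theorem IsTest.exists_antideriv {k : ℝ → ℝ} (hk : IsTest k (Ioi 0)) (h0 : ∫ s in Ioi 0, k s = 0) :
    ∃ φ : ℝ → ℝ, IsTest φ (Ioi 0) ∧ deriv φ = k := by
  have hkc : Continuous k := hk.smooth.continuous
  have hd : ∀ s, HasDerivAt (fun s => ∫ r in (0 : ℝ)..s, k r) (k s) s := fun s =>
    intervalIntegral.integral_hasDerivAt_right (hkc.intervalIntegrable _ _)
      hkc.aestronglyMeasurable.stronglyMeasurableAtFilter hkc.continuousAt
  have hderiv : deriv (fun s => ∫ r in (0 : ℝ)..s, k r) = k := funext fun s => (hd s).deriv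
  have hsmooth : ContDiff ℝ ∞ (fun s => ∫ r in (0 : ℝ)..s, k r) := by
    rw [contDiff_infty_iff_deriv, hderiv]
    exact ⟨fun s => (hd s).differentiableAt, hk.smooth⟩
  have hz : (0 : ℝ) ∈ (tsupport k)ᶜ := fun h => lt_irrefl (0 : ℝ) (hk.support h)
  obtain ⟨α, hα, hαk⟩ := Metric.isOpen_iff.1 (isClosed_tsupport k).isOpen_compl 0 hz
  obtain ⟨β, hβ⟩ := hk.compact.isCompact.bddAbove
  have hlow : ∀ s, s < α → k s = 0 := by
    intro s hs
    by_contra hne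
    have hst : s ∈ tsupport k := subset_tsupport _ hne
    have hs0 : 0 < s := hk.support hst
    refine hαk ?_ hst
    rw [Metric.mem_ball, Real.dist_eq, sub_zero, abs_of_pos hs0]
    exact hs
  have hupp : ∀ s, β < s → k s = 0 := by
    intro s hs
    by_contra hne
    exact absurd (hβ (subset_tsupport _ hne)) (not_le.2 hs)
  have hsupp : tsupport (fun s => ∫ r in (0 : ℝ)..s, k r) ⊆ Icc α β := by
    refine closure_minimal ?_ isClosed_Icc
    intro s hs
    by_contra hn
    apply hs
    rw [mem_Icc, not_and_or, not_le, not_le] at hn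
    rcases hn with hn | hn
    · refine intervalIntegral.integral_zero_ae (Eventually.of_forall fun r hr => hlow r ?_)
      rcases le_total 0 s with h | h
      · rw [uIoc_of_le h] at hr; exact hr.2.trans_lt hn
      · rw [uIoc_of_ge h] at hr; exact hr.2.trans_lt hα
    · rcases le_total 0 s with h | h
      · simp only
        rw [intervalIntegral.integral_of_le h]
        refine Eq.trans (setIntegral_eq_of_subset_of_forall_sdiff_eq_zero measurableSet_Ioi
          Ioc_subset_Ioi_self fun r hr => hupp r ?_).symm h0
        by_contra hc
        exact hr.2 ⟨hr.1, (not_lt.1 hc).trans hn.le⟩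
      · refine intervalIntegral.integral_zero_ae (Eventually.of_forall fun r hr => hlow r ?_)
        rw [uIoc_of_ge h] at hr; exact hr.2.trans_lt hα
  exact ⟨_, ⟨hsmooth, HasCompactSupport.of_support_subset_isCompact isCompact_Icc
    ((subset_tsupport _).trans hsupp), hsupp.trans fun s hs => hα.trans_le hs.1⟩, hderiv⟩

theorem IsTest.const_mul {g : ℝ → ℝ} {S : Set ℝ} (c : ℝ) (h : IsTest g S) :
    IsTest (fun s => c * g s) S := by
  have hs : tsupport (fun s => c * g s) ⊆ tsupport g := by
    refine closure_mono fun x hx hx' => hx ?_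
    simp [hx']
  exact ⟨contDiff_const.mul h.smooth, h.compact.of_isClosed_subset (isClosed_tsupport _) hs,
    hs.trans h.support⟩

theorem IsTest.mul_right {g f : ℝ → ℝ} {S : Set ℝ} (h : IsTest g S) (hf : ContDiff ℝ ∞ f) :
    IsTest (fun s => g s * f s) S := by
  have hs : tsupport (fun s => g s * f s) ⊆ tsupport g := by
    refine closure_mono fun x hx hx' => hx ?_
    simp [hx']
  exact ⟨h.smooth.mul hf, h.compact.of_isClosed_subset (isClosed_tsupport _) hs,
    hs.trans h.support⟩

theorem IsTest.sub {g f : ℝ → ℝ} {S : Set ℝ} (h : IsTest g S) (hf : IsTest f S) :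
    IsTest (fun s => g s - f s) S := by
  have hs : tsupport (fun s => g s - f s) ⊆ tsupport g ∪ tsupport f := by
    refine closure_minimal (fun x hx => ?_) ((isClosed_tsupport g).union (isClosed_tsupport f))
    by_contra hn
    rw [mem_union, not_or] at hn
    exact hx (by
      simp [image_eq_zero_of_notMem_tsupport hn.1, image_eq_zero_of_notMem_tsupport hn.2])
  exact ⟨h.smooth.sub hf.smooth, (h.compact.isCompact.union hf.compact.isCompact).of_isClosed_subset
    (isClosed_tsupport _) hs, hs.trans (union_subset h.support hf.support)⟩

theorem exists_test_integral_one : ∃ φ : ℝ → ℝ, IsTest φ (Ioi 0) ∧ ∫ s in Ioi 0, φ s = 1 := by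
  let b : ContDiffBump (1 : ℝ) := ⟨1 / 4, 1 / 2, by norm_num, by norm_num⟩
  have hsub : tsupport (b.normed volume) ⊆ Ioi 0 := by
    rw [b.tsupport_normed_eq]
    intro x hx
    rw [Metric.mem_closedBall, Real.dist_eq] at hx
    have := (abs_le.1 hx).1
    change -(1 / 2) ≤ x - 1 at this
    change (0 : ℝ) < x
    linarith
  refine ⟨b.normed volume, ⟨b.contDiff_normed, b.hasCompactSupport_normed, hsub⟩, ?_⟩
  rw [setIntegral_eq_integral_of_forall_compl_eq_zero, b.integral_normed]
  intro x hx
  by_contra hne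
  exact hx (hsub (subset_tsupport _ hne))

section
variable {X : Type} [NormedAddCommGroup X] [InnerProductSpace ℂ X] [CompleteSpace X]

/-- **du Bois-Reymond lemma** on the half line. -/
theorem ae_eq_const_of_integral_deriv_smul_eq_zero {h : ℝ → X} (hh : LocallyIntegrableOn h (Ioi 0))
    (H : ∀ φ : ℝ → ℝ, IsTest φ (Ioi 0) → ∫ s in Ioi 0, deriv φ s • h s = 0) :
    ∃ c, ∀ᵐ s ∂volume.restrict (Ioi 0), h s = c := by
  obtain ⟨φ₀, hφ₀, hone⟩ := exists_test_integral_one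
  have hint : ∀ g : ℝ → ℝ, IsTest g (Ioi 0) → IntegrableOn (fun s => g s • h s) (Ioi 0) := by
    intro g hg
    have h1 := hh.integrableOn_compact_subset hg.support hg.compact.isCompact
    have h2 := h1.continuousOn_smul hg.smooth.continuous.continuousOn hg.compact.isCompact
    refine ((integrableOn_iff_integrable_of_support_subset ?_).1 h2).integrableOn
    intro s hs
    refine subset_tsupport g ?_
    intro h0
    exact hs (by simp [h0])
  set c := ∫ s in Ioi 0, φ₀ s • h s
  refine ⟨c, ?_⟩
  have hz : ∀ᵐ s ∂(volume : Measure ℝ), s ∈ Ioi (0 : ℝ) → h s - c = 0 := by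
    refine isOpen_Ioi.ae_eq_zero_of_integral_contDiff_smul_eq_zero
      (hh.sub (locallyIntegrableOn_const c)) ?_
    intro g hg hgc hgs
    have hgt : IsTest g (Ioi 0) := ⟨hg, hgc, hgs⟩
    have hgi : IntegrableOn g (Ioi 0) :=
      (hg.continuous.integrable_of_hasCompactSupport hgc).integrableOn
    have hφi : IntegrableOn φ₀ (Ioi 0) :=
      (hφ₀.smooth.continuous.integrable_of_hasCompactSupport hφ₀.compact).integrableOn
    set m := ∫ s in Ioi 0, g s
    -- `g - m φ₀` has integral zero, so it is the derivative of a test function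
    obtain ⟨φ, hφ, hφd⟩ := (hgt.sub (hφ₀.const_mul m)).exists_antideriv (by
      rw [integral_sub hgi (hφi.const_mul m), integral_const_mul, hone, mul_one, sub_self])
    have h1 := H φ hφ
    rw [hφd] at h1
    have h2 : ∫ s in Ioi 0, (g s - m * φ₀ s) • h s = (∫ s in Ioi 0, g s • h s) - m • c := by
      rw [← integral_smul, ← integral_sub (hint g hgt)
        (show IntegrableOn (fun s => m • φ₀ s • h s) (Ioi 0) volume from (hint φ₀ hφ₀).smul m)]
      refine integral_congr_ae (Eventually.of_forall fun s => ?_)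
      simp only [sub_smul, mul_smul]
    rw [h2] at h1
    rw [← setIntegral_eq_integral_of_forall_compl_eq_zero (s := Ioi 0)]
    · simp only [smul_sub]
      rw [integral_sub (hint g hgt) (hgi.smul_const c), integral_smul_const]
      exact h1
    · intro s hs
      have : g s = 0 := by
        by_contra hne
        exact hs (hgs (subset_tsupport _ hne))
      simp [this]
  rw [ae_restrict_iff' measurableSet_Ioi]
  filter_upwards [hz] with s hs hs0
  exact sub_eq_zero.1 (hs hs0)

/-- Integration by parts of a test function against the primitive of an integrable function. -/
theorem integral_deriv_smul_primitive {b : ℝ → X} (hb : ∀ N, IntegrableOn b (Ioc 0 N))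
    {ψ : ℝ → ℝ} (hψ : IsTest ψ (Ioi 0)) :
    ∫ s in Ioi 0, deriv ψ s • (∫ r in (0 : ℝ)..s, b r) = -∫ s in Ioi 0, ψ s • b s := by
  obtain ⟨N, hN⟩ := hψ.compact.isCompact.bddAbove
  set M := max N 0 + 1
  have hM0 : 0 ≤ M := by positivity
  have hMN : N < M := (le_max_left N 0).trans_lt (lt_add_one _)
  have hd : Continuous (deriv ψ) := hψ.smooth.continuous_deriv (by simp)
  have hψz : ∀ s, N < s → ψ s = 0 := fun s hs => by
    by_contra hne
    exact absurd (hN (subset_tsupport _ hne)) (not_le.2 hs)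
  have hψdz : ∀ s, N < s → deriv ψ s = 0 := fun s hs => by
    by_contra hne
    exact absurd (hN (support_deriv_subset (f := ψ) hne)) (not_le.2 hs)
  have hcut : ∀ F : ℝ → X, (∀ s, N < s → F s = 0) → ∫ s in Ioi 0, F s = ∫ s in Ioc 0 M, F s := by
    intro F hF
    refine setIntegral_eq_of_subset_of_forall_sdiff_eq_zero measurableSet_Ioi
      Ioc_subset_Ioi_self fun r hr => hF r ?_
    by_contra hc
    exact hr.2 ⟨hr.1, (not_lt.1 hc).trans hMN.le⟩
  rw [hcut _ fun s hs => by rw [hψdz s hs, zero_smul],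
    hcut _ fun s hs => by rw [hψz s hs, zero_smul]]
  have hdi : IntegrableOn (deriv ψ) (Ioc 0 M) := hd.integrableOn_Ioc
  have hprod : Integrable (fun p : ℝ × ℝ => deriv ψ p.1 • b p.2)
      ((volume.restrict (Ioc 0 M)).prod (volume.restrict (Ioc 0 M))) := hdi.smul_prod (hb M)
  have hmeas : MeasurableSet {p : ℝ × ℝ | p.2 ≤ p.1} :=
    measurableSet_le measurable_snd measurable_fst
  have hswap := integral_integral_swap (f := fun s r => {p : ℝ × ℝ | p.2 ≤ p.1}.indicator
    (fun p : ℝ × ℝ => deriv ψ p.1 • b p.2) (s, r)) (hprod.indicator hmeas)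
  have hL : ∫ s in Ioc 0 M, deriv ψ s • (∫ r in (0 : ℝ)..s, b r) = ∫ s in Ioc 0 M, ∫ r in Ioc 0 M,
      {p : ℝ × ℝ | p.2 ≤ p.1}.indicator (fun p : ℝ × ℝ => deriv ψ p.1 • b p.2) (s, r) := by
    refine setIntegral_congr_fun measurableSet_Ioc fun s hs => ?_
    rw [intervalIntegral.integral_of_le hs.1.le, ← integral_smul]
    have : ∀ r, {p : ℝ × ℝ | p.2 ≤ p.1}.indicator (fun p : ℝ × ℝ => deriv ψ p.1 • b p.2) (s, r)
        = (Iic s).indicator (fun r => deriv ψ s • b r) r := fun r => by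
      simp [indicator_apply]
    simp only [this]
    rw [setIntegral_indicator measurableSet_Iic]
    congr 2
    ext r
    simp only [mem_Ioc, mem_inter_iff, mem_Iic]
    exact ⟨fun h => ⟨⟨h.1, h.2.trans hs.2⟩, h.2⟩, fun h => ⟨h.1.1, h.2⟩⟩
  have hR : ∀ r ∈ Ioc 0 M, ∫ s in Ioc 0 M,
      {p : ℝ × ℝ | p.2 ≤ p.1}.indicator (fun p : ℝ × ℝ => deriv ψ p.1 • b p.2) (s, r)
        = -(ψ r • b r) := by
    intro r hr
    have : ∀ s, {p : ℝ × ℝ | p.2 ≤ p.1}.indicator (fun p : ℝ × ℝ => deriv ψ p.1 • b p.2) (s, r)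
        = (Ici r).indicator (fun s => deriv ψ s • b r) s := fun s => by
      simp [indicator_apply]
    simp only [this]
    rw [setIntegral_indicator measurableSet_Ici, integral_smul_const]
    have h1 : Ioc 0 M ∩ Ici r = Icc r M := by
      ext s
      simp only [mem_Ioc, mem_inter_iff, mem_Ici, mem_Icc]
      exact ⟨fun h => ⟨h.2, h.1.2⟩, fun h => ⟨⟨hr.1.trans_le h.1, h.2⟩, h.1⟩⟩
    rw [h1, integral_Icc_eq_integral_Ioc, ← intervalIntegral.integral_of_le hr.2,
      intervalIntegral.integral_deriv_eq_sub
        (fun x _ => (hψ.smooth.differentiable (by simp)).differentiableAt)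
        (hd.intervalIntegrable _ _), hψz M hMN, zero_sub, neg_smul]
  rw [hL, hswap, setIntegral_congr_fun measurableSet_Ioc hR, integral_neg]

end

/-! ### The derivative in the weighted history spaces -/

/-- The Cauchy-Schwarz inequality against the constant function. -/
theorem sq_lintegral_le {α : Type*} [MeasurableSpace α] (ν : Measure α) {f : α → ENNReal}
    (hf : Measurable f) : (∫⁻ x, f x ∂ν) ^ 2 ≤ ν univ * ∫⁻ x, f x ^ 2 ∂ν := by
  have h := ENNReal.lintegral_mul_le_Lp_mul_Lq ν (p := 2) (q := 2)
    (Real.HolderConjugate.two_two) hf.aemeasurable (aemeasurable_const (b := (1 : ENNReal)))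
  simp only [Pi.mul_apply, mul_one, ENNReal.rpow_two, one_pow, lintegral_const, one_mul] at h
  have h2 := pow_le_pow_left' h 2
  refine h2.trans (le_of_eq ?_)
  rw [mul_pow, ← ENNReal.rpow_two, ← ENNReal.rpow_two, ← ENNReal.rpow_mul, ← ENNReal.rpow_mul]
  norm_num [mul_comm]

/-- Schur's test. -/
theorem lintegral_sq_kernel_le {μ : Measure ℝ} [SFinite μ] {K : ℝ → ℝ → ENNReal}
    (hK : Measurable (Function.uncurry K)) {c : ENNReal} (h1 : ∀ s, ∫⁻ r, K s r ∂μ ≤ c)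
    (h2 : ∀ r, ∫⁻ s, K s r ∂μ ≤ c) {f : ℝ → ENNReal} (hf : Measurable f) :
    ∫⁻ s, (∫⁻ r, K s r * f r ∂μ) ^ 2 ∂μ ≤ c ^ 2 * ∫⁻ r, f r ^ 2 ∂μ := by
  have hKs : ∀ s, Measurable (K s) := fun s => hK.of_uncurry_left
  have hmeas : Measurable (Function.uncurry fun s r => K s r * f r ^ 2) :=
    hK.mul ((hf.pow_const 2).comp measurable_snd)
  have step : ∀ s, (∫⁻ r, K s r * f r ∂μ) ^ 2 ≤ c * ∫⁻ r, K s r * f r ^ 2 ∂μ := by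
    intro s
    have e1 := lintegral_withDensity_eq_lintegral_mul μ (hKs s) hf
    have e2 := lintegral_withDensity_eq_lintegral_mul μ (hKs s) (hf.pow_const 2)
    simp only [Pi.mul_apply] at e1 e2
    rw [← e1, ← e2]
    refine (sq_lintegral_le _ hf).trans ?_
    gcongr
    rw [withDensity_apply _ MeasurableSet.univ, Measure.restrict_univ]
    exact h1 s
  calc ∫⁻ s, (∫⁻ r, K s r * f r ∂μ) ^ 2 ∂μ ≤ ∫⁻ s, c * ∫⁻ r, K s r * f r ^ 2 ∂μ ∂μ :=
        lintegral_mono step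
    _ = c * ∫⁻ r, ∫⁻ s, K s r * f r ^ 2 ∂μ ∂μ := by
        rw [lintegral_const_mul _ (show Measurable fun s => ∫⁻ r, K s r * f r ^ 2 ∂μ from
          hmeas.lintegral_prod_right'), lintegral_lintegral_swap hmeas.aemeasurable]
    _ ≤ c * ∫⁻ r, c * f r ^ 2 ∂μ := by
        gcongr with r
        rw [lintegral_mul_const _ (hK.of_uncurry_right)]
        gcongr
        exact h2 r
    _ = c ^ 2 * ∫⁻ r, f r ^ 2 ∂μ := by
        rw [lintegral_const_mul _ (hf.pow_const 2), sq, mul_assoc]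

/-- The convolution kernel of the resolvent of the derivative with zero initial value. -/
def expKernel (l s r : ℝ) : ENNReal :=
  (Iic s).indicator (fun r => ENNReal.ofReal (Real.exp (l * (r - s)))) r

theorem expKernel_measurable (l : ℝ) : Measurable (Function.uncurry (expKernel l)) := by
  have : Function.uncurry (expKernel l) = {p : ℝ × ℝ | p.2 ≤ p.1}.indicator
      (fun p => ENNReal.ofReal (Real.exp (l * (p.2 - p.1)))) := by
    ext p
    simp [Function.uncurry, expKernel, indicator_apply]
  rw [this]
  refine Measurable.indicator (by fun_prop) (measurableSet_le measurable_snd measurable_fst)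

theorem lintegral_expKernel_right {l : ℝ} (hl : 0 < l) (s : ℝ) :
    ∫⁻ r in Ioi 0, expKernel l s r ≤ ENNReal.ofReal l⁻¹ := by
  refine (lintegral_mono' Measure.restrict_le_self le_rfl).trans ?_
  unfold expKernel
  rw [lintegral_indicator measurableSet_Iic]
  have e : ∀ r, Real.exp (l * (r - s)) = Real.exp (l * r) * Real.exp (-(l * s)) := fun r => by
    rw [← Real.exp_add]; ring_nf
  have hi : IntegrableOn (fun r => Real.exp (l * (r - s))) (Iic s) := by
    simp only [e]
    exact (integrableOn_exp_mul_Iic hl s).mul_const _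
  rw [← ofReal_integral_eq_lintegral_ofReal hi (Eventually.of_forall fun r => (Real.exp_pos _).le)]
  refine le_of_eq (congrArg _ ?_)
  simp only [e]
  rw [integral_mul_const, integral_exp_mul_Iic hl, div_mul_eq_mul_div, ← Real.exp_add,
    add_neg_cancel, Real.exp_zero, one_div]

theorem lintegral_expKernel_left {l : ℝ} (hl : 0 < l) (r : ℝ) :
    ∫⁻ s in Ioi 0, expKernel l s r ≤ ENNReal.ofReal l⁻¹ := by
  refine (lintegral_mono' Measure.restrict_le_self le_rfl).trans ?_
  have e0 : ∀ s, expKernel l s r = (Ici r).indicator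
      (fun s => ENNReal.ofReal (Real.exp (l * (r - s)))) s := fun s => by
    simp [expKernel, indicator_apply]
  simp only [e0]
  rw [lintegral_indicator measurableSet_Ici, setLIntegral_congr Ioi_ae_eq_Ici.symm]
  have e : ∀ s, Real.exp (l * (r - s)) = Real.exp (-l * s) * Real.exp (l * r) := fun s => by
    rw [← Real.exp_add]; ring_nf
  have hi : IntegrableOn (fun s => Real.exp (l * (r - s))) (Ioi r) := by
    simp only [e]
    exact (integrableOn_exp_mul_Ioi (neg_neg_of_pos hl) r).mul_const _
  rw [← ofReal_integral_eq_lintegral_ofReal hi (Eventually.of_forall fun r => (Real.exp_pos _).le)]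
  refine le_of_eq (congrArg _ ?_)
  simp only [e]
  rw [integral_mul_const, integral_exp_mul_Ioi (neg_neg_of_pos hl), neg_div_neg_eq,
    div_mul_eq_mul_div, ← Real.exp_add, neg_mul, neg_add_cancel, Real.exp_zero, one_div]

section
variable {C δ : ℝ} {X : Type} [NormedAddCommGroup X]

theorem lintegral_hist (hC : 0 < C) (f : ℝ → X) :
    ∫⁻ s, ‖f s‖ₑ ^ 2 ∂histMeasure C δ =
      ∫⁻ s in Ioi 0, (ENNReal.ofReal (√(weight C δ s)) * ‖f s‖ₑ) ^ 2 := by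
  unfold histMeasure
  rw [lintegral_withDensity_eq_lintegral_mul_non_measurable _
    (weight_continuous C δ).measurable.ennreal_ofReal (by simp)]
  refine lintegral_congr fun s => ?_
  rw [Pi.mul_apply, mul_pow, ← ENNReal.ofReal_pow (Real.sqrt_nonneg _),
    Real.sq_sqrt (weight_pos δ hC s).le]

theorem eLpNorm_two_sq {μ : Measure ℝ} (f : ℝ → X) : eLpNorm f 2 μ ^ 2 = ∫⁻ s, ‖f s‖ₑ ^ 2 ∂μ := by
  have := eLpNorm_nnreal_pow_eq_lintegral (μ := μ) (f := f) (p := 2) (by norm_num)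
  simpa using this

variable [InnerProductSpace ℂ X]

theorem integrableOn_of_hist (hC : 0 < C) (hδ : 0 < δ) (a : L2w C δ X) {g : ℝ → ℝ}
    (hg : Continuous g) (N : ℝ) : IntegrableOn (fun s => g s • a s) (Ioc 0 N) := by
  have h1 : IntegrableOn (fun s => weight C δ s • a s) (Ioi 0) :=
    integrable_smul_of_le_weight (M := 1) hC hδ (weight_continuous C δ).continuousOn
      (fun s _ => by rw [one_mul, abs_of_pos (weight_pos δ hC s)]) a
  have hc : Continuous fun s => g s / weight C δ s :=
    hg.div (weight_continuous C δ) fun s => (weight_pos δ hC s).ne'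
  obtain ⟨M, hM⟩ := isCompact_Icc.exists_bound_of_continuousOn (s := Icc 0 N) hc.continuousOn
  have h2 :
      IntegrableOn ((fun s => g s / weight C δ s) • fun s => weight C δ s • a s) (Ioc 0 N) := by
    refine Integrable.bdd_smul (h1.mono_set Ioc_subset_Ioi_self) M hc.aestronglyMeasurable ?_
    filter_upwards [self_mem_ae_restrict measurableSet_Ioc] with s hs
    exact hM s ⟨hs.1.le, hs.2⟩
  refine h2.congr (Eventually.of_forall fun s => ?_)
  simp only [Pi.smul_apply', smul_smul]
  rw [div_mul_cancel₀ _ (weight_pos δ hC s).ne']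

/-- The solution `s ↦ ∫₀ˢ e^{-l (s - r)} a(r) dr` of `l η + η' = a`, `η(0) = 0`. -/
def histSol (l : ℝ) (a : L2w C δ X) (s : ℝ) : X :=
  Real.exp (-(l * s)) • ∫ r in (0 : ℝ)..s, Real.exp (l * r) • a r

theorem histSol_continuousOn (hC : 0 < C) (hδ : 0 < δ) (l : ℝ) (a : L2w C δ X) :
    ContinuousOn (histSol l a) (Ici 0) := by
  unfold histSol
  refine ContinuousOn.smul (f := fun s => Real.exp (-(l * s))) (by fun_prop) ?_
  intro t ht
  have h1 : IntegrableOn (fun r => Real.exp (l * r) • a r) (Icc 0 (t + 1)) :=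
    (integrableOn_Icc_iff_integrableOn_Ioc).2 (integrableOn_of_hist hC hδ a (by fun_prop) _)
  have h2 := intervalIntegral.continuousOn_primitive_interval' (a := 0) (b₁ := 0) (b₂ := t + 1)
    (f := fun r => Real.exp (l * r) • a r) (μ := volume)
    ((intervalIntegrable_iff_integrableOn_Icc_of_le (by linarith [ht.out])).2 h1) left_mem_uIcc
  rw [uIcc_of_le (by linarith [ht.out])] at h2
  have h3 := h2 t ⟨ht, by linarith⟩
  refine h3.mono_of_mem_nhdsWithin ?_
  rw [← Ici_inter_Iic]
  exact inter_mem self_mem_nhdsWithin (mem_nhdsWithin_of_mem_nhds (Iic_mem_nhds (by linarith)))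

/-- Since the weight is decreasing, the convolution defining `histSol` is dominated by the same
convolution of the weighted norms. -/
theorem enorm_histSol_le (hC : 0 < C) (hδ : 0 < δ) (l : ℝ) (a : L2w C δ X) {s : ℝ} (hs : 0 < s) :
    ENNReal.ofReal (√(weight C δ s)) * ‖histSol l a s‖ₑ ≤
      ∫⁻ r in Ioi 0, expKernel l s r * (ENNReal.ofReal (√(weight C δ r)) * ‖a r‖ₑ) := by
  have h1 : histSol l a s = ∫ r in Ioc 0 s, Real.exp (l * (r - s)) • a r := by
    unfold histSol
    rw [intervalIntegral.integral_of_le hs.le, ← integral_smul]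
    refine integral_congr_ae (Eventually.of_forall fun r => ?_)
    simp only [smul_smul, ← Real.exp_add]
    ring_nf
  have h2 : ∫⁻ r in Ioi 0, expKernel l s r * (ENNReal.ofReal (√(weight C δ r)) * ‖a r‖ₑ) =
      ∫⁻ r in Ioc 0 s, ENNReal.ofReal (Real.exp (l * (r - s))) *
        (ENNReal.ofReal (√(weight C δ r)) * ‖a r‖ₑ) := by
    have : ∀ r, expKernel l s r * (ENNReal.ofReal (√(weight C δ r)) * ‖a r‖ₑ) = (Iic s).indicator
        (fun r => ENNReal.ofReal (Real.exp (l * (r - s))) *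
          (ENNReal.ofReal (√(weight C δ r)) * ‖a r‖ₑ)) r := by
      intro r
      by_cases h : r ≤ s <;> simp [expKernel, h]
    simp only [this]
    rw [setLIntegral_indicator measurableSet_Iic, inter_comm, Ioi_inter_Iic]
  rw [h1, h2]
  refine (mul_le_mul_right (enorm_integral_le_lintegral_enorm _) _).trans ?_
  rw [← lintegral_const_mul' _ _ ENNReal.ofReal_ne_top]
  refine setLIntegral_mono' measurableSet_Ioc fun r hr => ?_
  have h3 : weight C δ s ≤ weight C δ r := by
    unfold weight
    have := hr.2
    gcongr C * Real.exp ?_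
    nlinarith
  rw [enorm_smul, Real.enorm_of_nonneg (Real.exp_pos _).le, mul_left_comm]
  gcongr

theorem histSol_eLpNorm_le (hC : 0 < C) (hδ : 0 < δ) {l : ℝ} (hl : 0 < l) (a : L2w C δ X) :
    eLpNorm (histSol l a) 2 (histMeasure C δ) ≤
      ENNReal.ofReal l⁻¹ * eLpNorm a 2 (histMeasure C δ) := by
  rw [← ENNReal.pow_le_pow_left_iff two_ne_zero, mul_pow, eLpNorm_two_sq, eLpNorm_two_sq,
    lintegral_hist hC, lintegral_hist hC]
  refine le_trans ?_ (lintegral_sq_kernel_le (expKernel_measurable l) (lintegral_expKernel_right hl)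
    (lintegral_expKernel_left hl) ?_)
  · refine setLIntegral_mono' measurableSet_Ioi fun s hs => ?_
    gcongr
    exact enorm_histSol_le hC hδ l a hs
  · exact ((weight_continuous C δ).sqrt.measurable.ennreal_ofReal).mul
      (Lp.stronglyMeasurable a).enorm

theorem histSol_memLp (hC : 0 < C) (hδ : 0 < δ) {l : ℝ} (hl : 0 < l) (a : L2w C δ X) :
    MemLp (histSol l a) 2 (histMeasure C δ) := by
  refine ⟨?_, (histSol_eLpNorm_le hC hδ hl a).trans_lt (ENNReal.mul_lt_top ENNReal.ofReal_lt_top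
    (Lp.eLpNorm_lt_top a))⟩
  refine AEStronglyMeasurable.mono_ac (withDensity_absolutelyContinuous _ _) ?_
  exact ((histSol_continuousOn hC hδ l a).mono
    Ioi_subset_Ici_self).aestronglyMeasurable measurableSet_Ioi

variable [CompleteSpace X]

theorem histSol_mem_derivGraph (hC : 0 < C) (hδ : 0 < δ) {l : ℝ} (hl : 0 < l) (a : L2w C δ X) :
    ((histSol_memLp hC hδ hl a).toLp, a - (l : ℂ) • (histSol_memLp hC hδ hl a).toLp) ∈
      derivGraph hC hδ X := by
  set η := (histSol_memLp hC hδ hl a).toLp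
  have hη : ∀ᵐ s ∂volume.restrict (Ioi 0), η s = histSol l a s :=
    (ae_history_iff hC).1 (histSol_memLp hC hδ hl a).coeFn_toLp
  refine ⟨fun φ hφ => ?_, histSol l a, histSol_continuousOn hC hδ l a, by simp [histSol], hη⟩
  have hψ : IsTest (fun s => φ s * Real.exp (-(l * s))) (Ioi 0) := hφ.mul_right (by fun_prop)
  have hkey := integral_deriv_smul_primitive (b := fun r => Real.exp (l * r) • a r)
    (fun N => integrableOn_of_hist hC hδ a (by fun_prop) N) hψ
  have hd : ∀ s, deriv (fun s => φ s * Real.exp (-(l * s))) s =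
      deriv φ s * Real.exp (-(l * s)) - l * (φ s * Real.exp (-(l * s))) := by
    intro s
    have h1 := (hφ.smooth.differentiable (by simp) s).hasDerivAt
    have h2 : HasDerivAt (fun s : ℝ => Real.exp (-(l * s))) (Real.exp (-(l * s)) * (-(l * 1))) s :=
      (((hasDerivAt_id s).const_mul l).neg).exp
    refine (h1.mul h2).deriv.trans ?_
    ring
  have hdc : Continuous (deriv φ) := hφ.smooth.continuous_deriv (by simp)
  obtain ⟨M, hM⟩ := exists_bound_of_compact (δ := δ) hC hdc hφ.compact.deriv
  obtain ⟨N, hN⟩ := exists_bound_of_compact (δ := δ) hC hφ.smooth.continuous hφ.compact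
  have i1 := integrable_smul_of_le_weight hC hδ hdc.continuousOn hM η
  have i2 := integrable_smul_of_le_weight hC hδ hφ.smooth.continuous.continuousOn hN η
  have i3 := integrable_smul_of_le_weight hC hδ hφ.smooth.continuous.continuousOn hN a
  have e1 : ∫ s in Ioi 0, deriv (fun s => φ s * Real.exp (-(l * s))) s •
      (∫ r in (0 : ℝ)..s, Real.exp (l * r) • a r) =
      (∫ s in Ioi 0, deriv φ s • η s) - l • ∫ s in Ioi 0, φ s • η s := by
    rw [← integral_smul, ← integral_sub i1
      (show IntegrableOn (fun s => l • φ s • η s) (Ioi 0) volume from i2.smul l)]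
    refine integral_congr_ae ?_
    filter_upwards [hη] with s hs
    rw [hs, hd, histSol]
    module
  have e2 : ∫ s in Ioi 0, (φ s * Real.exp (-(l * s))) • (Real.exp (l * s) • a s) =
      ∫ s in Ioi 0, φ s • a s := by
    refine integral_congr_ae (Eventually.of_forall fun s => ?_)
    simp only [smul_smul]
    rw [mul_assoc, ← Real.exp_add, neg_add_cancel, Real.exp_zero, mul_one]
  rw [e1, e2] at hkey
  have e3 : ∫ s in Ioi 0, φ s • (a - (l : ℂ) • η) s =
      (∫ s in Ioi 0, φ s • a s) - l • ∫ s in Ioi 0, φ s • η s := by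
    rw [← integral_smul, ← integral_sub i3
      (show IntegrableOn (fun s => l • φ s • η s) (Ioi 0) volume from i2.smul l)]
    refine integral_congr_ae ?_
    filter_upwards [(ae_history_iff hC).1 (Lp.coeFn_sub a ((l : ℂ) • η)),
      (ae_history_iff hC).1 (Lp.coeFn_smul (l : ℂ) η)] with s h1 h2
    rw [h1, Pi.sub_apply, h2, Pi.smul_apply, smul_sub, Complex.coe_smul, smul_comm l]
  change ∫ s in Ioi 0, deriv φ s • η s = -∫ s in Ioi 0, φ s • (a - (l : ℂ) • η) s
  rw [e3, neg_sub, sub_eq_iff_eq_add.1 hkey]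
  abel

/-- Uniqueness for `∂ₛ θ = -l θ`, `θ(0) = 0`: by the du Bois-Reymond lemma `e^{l s} θ(s)` is
constant, and the constant is the initial value. -/
theorem derivGraph_eq_zero (hC : 0 < C) (hδ : 0 < δ) {l : ℝ} {θ : L2w C δ X}
    (h : (θ, -((l : ℂ) • θ)) ∈ derivGraph hC hδ X) : θ = 0 := by
  obtain ⟨hw, f, hf, hf0, hfe⟩ := h
  simp only at hw hfe
  have hθ : LocallyIntegrableOn (fun s => weight C δ s • θ s) (Ioi 0) :=
    IntegrableOn.locallyIntegrableOn (integrable_smul_of_le_weight (M := 1) hC hδ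
      (weight_continuous C δ).continuousOn
      (fun s _ => by rw [one_mul, abs_of_pos (weight_pos δ hC s)]) θ)
  have hloc : LocallyIntegrableOn (fun s => Real.exp (l * s) • θ s) (Ioi 0) := by
    have hc : Continuous fun s => Real.exp (l * s) / weight C δ s :=
      Continuous.div (by fun_prop) (weight_continuous C δ) fun s => (weight_pos δ hC s).ne'
    have := hθ.continuousOn_smul isOpen_Ioi.isLocallyClosed hc.continuousOn
    refine this.congr (Eventually.of_forall fun s => ?_)
    simp only [smul_smul]
    rw [div_mul_cancel₀ _ (weight_pos δ hC s).ne']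
  obtain ⟨c, hc⟩ := ae_eq_const_of_integral_deriv_smul_eq_zero hloc (by
    intro φ hφ
    have hψ : IsTest (fun s => φ s * Real.exp (l * s)) (Ioi 0) := hφ.mul_right (by fun_prop)
    have hd : ∀ s, deriv (fun s => φ s * Real.exp (l * s)) s =
        deriv φ s * Real.exp (l * s) + l * (φ s * Real.exp (l * s)) := by
      intro s
      have h1 := (hφ.smooth.differentiable (by simp) s).hasDerivAt
      have h2 : HasDerivAt (fun s : ℝ => Real.exp (l * s)) (Real.exp (l * s) * (l * 1)) s :=
        ((hasDerivAt_id s).const_mul l).exp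
      refine (h1.mul h2).deriv.trans ?_
      ring
    have hdc : Continuous (deriv fun s => φ s * Real.exp (l * s)) :=
      hψ.smooth.continuous_deriv (by simp)
    obtain ⟨M, hM⟩ := exists_bound_of_compact (δ := δ) hC hdc hψ.compact.deriv
    obtain ⟨N, hN⟩ := exists_bound_of_compact (δ := δ) hC hψ.smooth.continuous hψ.compact
    have i1 := integrable_smul_of_le_weight hC hδ hdc.continuousOn hM θ
    have i2 := integrable_smul_of_le_weight hC hδ hψ.smooth.continuous.continuousOn hN θ
    have h1 := hw _ hψ
    have h2 : ∫ s in Ioi 0, (φ s * Real.exp (l * s)) • (-((l : ℂ) • θ)) s =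
        -(l • ∫ s in Ioi 0, (φ s * Real.exp (l * s)) • θ s) := by
      rw [← integral_smul, ← integral_neg]
      refine integral_congr_ae ?_
      filter_upwards [(ae_history_iff hC).1 (Lp.coeFn_neg ((l : ℂ) • θ)),
        (ae_history_iff hC).1 (Lp.coeFn_smul (l : ℂ) θ)] with s h1 h2
      rw [h1, Pi.neg_apply, h2, Pi.smul_apply, Complex.coe_smul, smul_neg, smul_comm l]
    rw [h2, neg_neg, ← sub_eq_zero, ← integral_smul, ← integral_sub i1 (show IntegrableOn
      (fun s => l • (φ s * Real.exp (l * s)) • θ s) (Ioi 0) volume from i2.smul l)] at h1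
    rw [← h1]
    refine integral_congr_ae (Eventually.of_forall fun s => ?_)
    simp only [hd]
    module)
  have hfc : EqOn f (fun s => Real.exp (-(l * s)) • c) (Ioi 0) := by
    refine Measure.eqOn_open_of_ae_eq (μ := volume) ?_ isOpen_Ioi (hf.mono Ioi_subset_Ici_self)
      (ContinuousOn.smul (f := fun s => Real.exp (-(l * s))) (by fun_prop) continuousOn_const)
    filter_upwards [hc, hfe] with s h1 h2
    rw [← h1, ← h2, smul_smul, ← Real.exp_add, neg_add_cancel, Real.exp_zero, one_smul]
  have hc0 : c = 0 := by
    have h1 : Tendsto f (𝓝[>] 0) (𝓝 0) := by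
      have := (hf 0 (le_refl (0 : ℝ))).mono Ioi_subset_Ici_self
      rwa [ContinuousWithinAt, hf0] at this
    have h2 : Tendsto (fun s => Real.exp (-(l * s)) • c) (𝓝[>] 0) (𝓝 c) := by
      have : Continuous fun s => Real.exp (-(l * s)) • c :=
        Continuous.smul (f := fun s => Real.exp (-(l * s))) (by fun_prop) continuous_const
      have := this.tendsto 0
      simp only [mul_zero, neg_zero, Real.exp_zero, one_smul] at this
      exact this.mono_left nhdsWithin_le_nhds
    refine tendsto_nhds_unique h2 (h1.congr' ?_)
    filter_upwards [self_mem_nhdsWithin] with s hs using hfc hs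
  rw [Lp.eq_zero_iff_ae_eq_zero]
  refine (ae_history_iff hC).2 ?_
  filter_upwards [hfe, self_mem_ae_restrict measurableSet_Ioi] with s h1 hs
  rw [h1, hfc hs, hc0]
  simp

/-- `-∂ₛ` with zero initial value is dissipative in the weighted space. The resolvent estimate
`l ‖η‖ ≤ ‖l η + ∂ₛ η‖`, for all `l > 0`, gives the sign of the real part as `l → ∞`. -/
theorem derivGraph_re_nonneg (hC : 0 < C) (hδ : 0 < δ) {p : L2w C δ X × L2w C δ X}
    (hp : p ∈ derivGraph hC hδ X) : 0 ≤ (inner ℂ p.1 p.2).re := by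
  have hest : ∀ l : ℝ, 0 < l → l * ‖p.1‖ ≤ ‖(l : ℂ) • p.1 + p.2‖ := by
    intro l hl
    set a := (l : ℂ) • p.1 + p.2
    have h1 := histSol_mem_derivGraph hC hδ hl a
    have h2 := (derivGraph hC hδ X).sub_mem hp h1
    set η := (histSol_memLp hC hδ hl a).toLp
    have h3 : p.1 - η = 0 := by
      refine derivGraph_eq_zero hC hδ (l := l) ?_
      convert h2 using 1
      refine Prod.ext rfl ?_
      simp only [Prod.snd_sub, a]
      module
    rw [sub_eq_zero] at h3
    have h4 := histSol_eLpNorm_le hC hδ hl a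
    have h5 : ‖p.1‖ ≤ l⁻¹ * ‖a‖ := by
      rw [h3, Lp.norm_toLp, Lp.norm_def]
      refine (ENNReal.toReal_mono
        (ENNReal.mul_ne_top ENNReal.ofReal_ne_top (Lp.eLpNorm_ne_top a)) h4).trans ?_
      rw [ENNReal.toReal_mul, ENNReal.toReal_ofReal (by positivity)]
    rwa [inv_mul_eq_div, le_div_iff₀ hl, mul_comm] at h5
  have hsq : ∀ l : ℝ, 0 < l → 0 ≤ 2 * l * (inner ℂ p.1 p.2).re + ‖p.2‖ ^ 2 := by
    intro l hl
    have h1 := pow_le_pow_left₀ (by positivity) (hest l hl) 2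
    rw [norm_add_sq (𝕜 := ℂ), norm_smul, Complex.norm_real, Real.norm_of_nonneg hl.le,
      inner_smul_left, Complex.conj_ofReal, RCLike.re_to_complex, Complex.re_ofReal_mul] at h1
    linarith
  by_contra hneg
  push Not at hneg
  have h1 := hsq ((‖p.2‖ ^ 2 + 1) / (-(inner ℂ p.1 p.2).re)) (by
    have : 0 < -(inner ℂ p.1 p.2).re := by linarith
    positivity)
  have h2 : (‖p.2‖ ^ 2 + 1) / (-(inner ℂ p.1 p.2).re) * (inner ℂ p.1 p.2).re =
      -(‖p.2‖ ^ 2 + 1) := by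
    rw [div_neg, neg_mul, div_mul_cancel₀ _ hneg.ne]
  nlinarith [sq_nonneg ‖p.2‖]

theorem derivGraph_onto (hC : 0 < C) (hδ : 0 < δ) {l : ℝ} (hl : 0 < l) (a : L2w C δ X) :
    ∃ p ∈ derivGraph hC hδ X, (l : ℂ) • p.1 + p.2 = a :=
  ⟨_, histSol_mem_derivGraph hC hδ hl a, add_sub_cancel _ _⟩

end

/-! ### Symmetry of the classical curl -/

theorem inner_C3 (a b : C3) : inner ℂ a b =
    starRingEnd ℂ (a 0) * b 0 + starRingEnd ℂ (a 1) * b 1 + starRingEnd ℂ (a 2) * b 2 := by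
  simp [PiLp.inner_apply, Fin.sum_univ_three, mul_comm]

theorem classicalCurl_zero (ψ : R3 → C3) (x : R3) :
    classicalCurl ψ x 0 = pd 1 (fun y => ψ y 2) x - pd 2 (fun y => ψ y 1) x := rfl

theorem classicalCurl_one (ψ : R3 → C3) (x : R3) :
    classicalCurl ψ x 1 = pd 2 (fun y => ψ y 0) x - pd 0 (fun y => ψ y 2) x := rfl

theorem classicalCurl_two (ψ : R3 → C3) (x : R3) :
    classicalCurl ψ x 2 = pd 0 (fun y => ψ y 1) x - pd 1 (fun y => ψ y 0) x := rfl

theorem IsTest.coord {ψ : R3 → C3} {S : Set R3} (h : IsTest ψ S) (i : Fin 3) :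
    IsTest (fun x => ψ x i) S := by
  have hs : tsupport (fun x => ψ x i) ⊆ tsupport ψ := by
    refine closure_mono fun x hx hx' => hx ?_
    simp [hx']
  exact ⟨(contDiff_piLp 2).1 h.smooth i, h.compact.of_isClosed_subset (isClosed_tsupport _) hs,
    hs.trans h.support⟩

theorem IsTest.pd {f : R3 → ℂ} {S : Set R3} (h : IsTest f S) (i : Fin 3) : IsTest (pd i f) S := by
  have hs : tsupport (DispersiveMaxwell.pd i f) ⊆ tsupport f :=
    closure_minimal (pd_support i) (isClosed_tsupport _)
  exact ⟨pd_smooth h.smooth i, h.compact.of_isClosed_subset (isClosed_tsupport _) hs,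
    hs.trans h.support⟩

theorem IsTest.differentiable {V F : Type*} [NormedAddCommGroup V] [NormedSpace ℝ V]
    [NormedAddCommGroup F] [NormedSpace ℝ F] {f : V → F} {S : Set V} (h : IsTest f S) :
    Differentiable ℝ f := h.smooth.differentiable (by simp)

theorem pd_conj {f : R3 → ℂ} (hf : Differentiable ℝ f) (i : Fin 3) (x : R3) :
    pd i (fun y => starRingEnd ℂ (f y)) x = starRingEnd ℂ (pd i f x) := by
  unfold pd
  have h := (Complex.conjCLE.toContinuousLinearMap.hasFDerivAt (x := f x)).comp x (hf x).hasFDerivAt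
  exact congrArg (fun L : R3 →L[ℝ] ℂ => L (EuclideanSpace.single i 1)) h.fderiv

theorem IsTest.integrable_mul {f g : R3 → ℂ} {S T : Set R3} (hf : IsTest f S) (hg : IsTest g T) :
    Integrable (fun x => starRingEnd ℂ (f x) * g x) :=
  Continuous.integrable_of_hasCompactSupport
    ((Complex.continuous_conj.comp hf.smooth.continuous).mul hg.smooth.continuous)
    (hg.compact.mul_left)

theorem integral_conj_pd_mul {f g : R3 → ℂ} {S T : Set R3} (hf : IsTest f S) (hg : IsTest g T)
    (i : Fin 3) : ∫ x, starRingEnd ℂ (pd i f x) * g x = -∫ x, starRingEnd ℂ (f x) * pd i g x := by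
  have hcd : Differentiable ℝ fun x => starRingEnd ℂ (f x) :=
    Complex.conjCLE.differentiable.comp hf.differentiable
  have := integral_mul_fderiv_eq_neg_fderiv_mul_of_integrable (μ := volume)
    (f := fun x => starRingEnd ℂ (f x)) (g := g) (v := EuclideanSpace.single i (1 : ℝ))
    (((hf.pd i).integrable_mul hg).congr (Eventually.of_forall fun x => by
      simp only; rw [← pd_conj hf.differentiable]; rfl))
    (hf.integrable_mul (hg.pd i)) (hf.integrable_mul hg) (fun x _ => hcd x)
    (fun x _ => hg.differentiable x)
  rw [eq_neg_iff_add_eq_zero, add_comm, ← eq_neg_iff_add_eq_zero]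
  refine this.trans (congrArg Neg.neg (integral_congr_ae (Eventually.of_forall fun x => ?_)))
  simp only; rw [← pd_conj hf.differentiable]; rfl

theorem integral_sub_add_sub_add_sub {f₁ f₂ f₃ f₄ f₅ f₆ : R3 → ℂ} (h₁ : Integrable f₁)
    (h₂ : Integrable f₂) (h₃ : Integrable f₃) (h₄ : Integrable f₄) (h₅ : Integrable f₅)
    (h₆ : Integrable f₆) :
    ∫ x, (f₁ x - f₂ x + (f₃ x - f₄ x) + (f₅ x - f₆ x)) =
      (∫ x, f₁ x) - (∫ x, f₂ x) + ((∫ x, f₃ x) - ∫ x, f₄ x) + ((∫ x, f₅ x) - ∫ x, f₆ x) := by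
  refine (integral_add ((h₁.sub h₂).add (h₃.sub h₄)) (h₅.sub h₆)).trans ?_
  refine congrArg₂ (· + ·) ((integral_add (h₁.sub h₂) (h₃.sub h₄)).trans ?_) (integral_sub h₅ h₆)
  exact congrArg₂ (· + ·) (integral_sub h₁ h₂) (integral_sub h₃ h₄)

/-- The classical curl is symmetric on test fields. -/
theorem integral_inner_classicalCurl {φ ψ : R3 → C3} {S T : Set R3} (hφ : IsTest φ S)
    (hψ : IsTest ψ T) :
    ∫ x, inner ℂ (classicalCurl ψ x) (φ x) = ∫ x, inner ℂ (ψ x) (classicalCurl φ x) := by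
  have I1 : ∀ a b c, Integrable fun x => starRingEnd ℂ (pd a (fun y => ψ y b) x) * φ x c :=
    fun a b c => ((hψ.coord b).pd a).integrable_mul (hφ.coord c)
  have I2 : ∀ a b c, Integrable fun x => starRingEnd ℂ (ψ x b) * pd a (fun y => φ y c) x :=
    fun a b c => (hψ.coord b).integrable_mul ((hφ.coord c).pd a)
  have E : ∀ a b c, ∫ x, starRingEnd ℂ (pd a (fun y => ψ y b) x) * φ x c =
      -∫ x, starRingEnd ℂ (ψ x b) * pd a (fun y => φ y c) x := fun a b c =>
    integral_conj_pd_mul (hψ.coord b) (hφ.coord c) a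
  simp only [inner_C3, classicalCurl_zero, classicalCurl_one, classicalCurl_two, map_sub, sub_mul,
    mul_sub]
  rw [integral_sub_add_sub_add_sub (I1 _ _ _) (I1 _ _ _) (I1 _ _ _) (I1 _ _ _) (I1 _ _ _)
    (I1 _ _ _),
    integral_sub_add_sub_add_sub (I2 _ _ _) (I2 _ _ _) (I2 _ _ _) (I2 _ _ _) (I2 _ _ _) (I2 _ _ _)]
  simp only [E]
  ring

/-! ### Mollification of fields -/

/-- The convolution of a field with a real function. -/
def moll (k : R3 → ℝ) (p : R3 → C3) (x : R3) : C3 := ∫ z, k z • p (x - z)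

theorem moll_eq_convolution (k : R3 → ℝ) (p : R3 → C3) :
    moll k p = convolution k p (ContinuousLinearMap.lsmul ℝ ℝ) volume := rfl

theorem moll_eq (k : R3 → ℝ) (p : R3 → C3) (x : R3) : moll k p x = ∫ y, k (x - y) • p y := by
  unfold moll
  rw [← integral_sub_left_eq_self _ volume x]
  simp

theorem integrable_comp_sub_smul {k : R3 → ℝ} (hk : Continuous k) (hkc : HasCompactSupport k)
    {p : R3 → C3} (hp : LocallyIntegrable p) (x : R3) : Integrable fun y => k (x - y) • p y :=
  hp.integrable_smul_left_of_hasCompactSupport (hk.comp (continuous_const.sub continuous_id))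
    (hkc.comp_homeomorph (Homeomorph.subLeft x))

theorem moll_contDiff {k : R3 → ℝ} {S : Set R3} (hk : IsTest k S) {p : R3 → C3}
    (hp : LocallyIntegrable p) : ContDiff ℝ ∞ (moll k p) :=
  hk.compact.contDiff_convolution_left (ContinuousLinearMap.lsmul ℝ ℝ) hk.smooth hp

theorem IsTest.fderiv_apply {k : R3 → ℝ} {S : Set R3} (hk : IsTest k S) (e : R3) :
    IsTest (fun z => fderiv ℝ k z e) S := by
  have hs : tsupport (fun z => fderiv ℝ k z e) ⊆ tsupport k := by
    refine closure_minimal (fun x hx => ?_) (isClosed_tsupport _)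
    by_contra hn
    apply hx
    have : fderiv ℝ k x = 0 := by
      by_contra h'
      exact hn (support_fderiv_subset ℝ h')
    simp [this]
  exact ⟨(hk.smooth.fderiv_right (m := ∞) (by simp)).clm_apply contDiff_const,
    hk.compact.of_isClosed_subset (isClosed_tsupport _) hs, hs.trans hk.support⟩

theorem fderiv_moll {k : R3 → ℝ} {S : Set R3} (hk : IsTest k S) {p : R3 → C3}
    (hp : LocallyIntegrable p) (x e : R3) :
    fderiv ℝ (moll k p) x e = moll (fun z => fderiv ℝ k z e) p x := by
  have h := hk.compact.hasFDerivAt_convolution_left (ContinuousLinearMap.lsmul ℝ ℝ)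
    (hk.smooth.of_le (by simp)) hp x
  rw [moll_eq_convolution, h.fderiv, convolution, ContinuousLinearMap.integral_apply]
  · rfl
  · exact (hk.compact.fderiv ℝ).convolutionExists_left
      ((ContinuousLinearMap.lsmul ℝ ℝ).precompL R3 : (R3 →L[ℝ] ℝ) →L[ℝ] C3 →L[ℝ] (R3 →L[ℝ] C3))
      ((hk.smooth.fderiv_right (m := ∞) (by simp)).continuous) hp x

theorem pd_coord {f : R3 → C3} (hf : Differentiable ℝ f) (i j : Fin 3) (x : R3) :
    pd i (fun y => f y j) x = (fderiv ℝ f x (EuclideanSpace.single i 1)) j := by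
  unfold pd
  have h := ((EuclideanSpace.proj (𝕜 := ℂ) j : C3 →L[ℂ] ℂ).restrictScalars ℝ).hasFDerivAt.comp x
    (hf x).hasFDerivAt
  exact congrArg (fun L : R3 →L[ℝ] ℂ => L (EuclideanSpace.single i 1)) h.fderiv

theorem integral_coord {f : R3 → C3} (hf : Integrable f) (j : Fin 3) :
    (∫ y, f y) j = ∫ y, f y j :=
  ((EuclideanSpace.proj (𝕜 := ℂ) j : C3 →L[ℂ] ℂ).integral_comp_comm hf).symm

theorem pd_moll {k : R3 → ℝ} {S : Set R3} (hk : IsTest k S) {p : R3 → C3}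
    (hp : LocallyIntegrable p) (x : R3) (i j : Fin 3) :
    pd i (fun y => moll k p y j) x =
      ∫ y, (fderiv ℝ k (x - y) (EuclideanSpace.single i 1) : ℂ) * p y j := by
  have ht := hk.fderiv_apply (EuclideanSpace.single i 1)
  rw [pd_coord ((moll_contDiff hk hp).differentiable (by simp)), fderiv_moll hk hp, moll_eq,
    integral_coord (integrable_comp_sub_smul ht.smooth.continuous ht.compact hp x)]
  simp

/-- `q` is the weak curl of `p`, tested against the fields supported in `S`. -/
def IsWeakCurl (S : Set R3) (p q : R3 → C3) : Prop :=
  ∀ ψ : R3 → C3, IsTest ψ S →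
    ∫ x, inner ℂ (classicalCurl ψ x) (p x) = ∫ x, inner ℂ (ψ x) (q x)

/-- Mollification commutes with the weak curl: the weak curl is tested with the translates of the
reflected mollifier, placed in each of the three components. -/
theorem classicalCurl_moll {k : R3 → ℝ} {S : Set R3} (hk : IsTest k S) {p q : R3 → C3}
    (hp : LocallyIntegrable p) (hq : LocallyIntegrable q) (h : IsWeakCurl univ p q) (x : R3) :
    classicalCurl (moll k p) x = moll k q x := by
  have hkx : ContDiff ℝ ∞ fun y => k (x - y) := hk.smooth.comp (contDiff_const.sub contDiff_id)
  have hkc : ContDiff ℝ ∞ fun y => (k (x - y) : ℂ) := Complex.ofRealCLM.contDiff.comp hkx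
  have hΨ : ∀ i : Fin 3, IsTest (fun y => EuclideanSpace.single i (k (x - y) : ℂ)) univ := by
    intro i
    refine ⟨?_, ?_, subset_univ _⟩
    · rw [contDiff_piLp 2]
      intro j
      by_cases hij : j = i
      · subst hij
        simpa using hkc
      · simpa [hij] using contDiff_const
    · refine (hk.compact.comp_homeomorph (Homeomorph.subLeft x)).of_isClosed_subset
        (isClosed_tsupport _) (closure_mono fun y hy hy' => hy ?_)
      have : k (x - y) = 0 := hy'
      simp [this]
  have hpd : ∀ (a : Fin 3) y, pd a (fun y => (k (x - y) : ℂ)) y =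
      -(fderiv ℝ k (x - y) (EuclideanSpace.single a 1) : ℂ) := by
    intro a y
    unfold pd
    have h1 : HasFDerivAt (fun y => k (x - y)) ((fderiv ℝ k (x - y)).comp
        (-(ContinuousLinearMap.id ℝ R3))) y :=
      (hk.differentiable (x - y)).hasFDerivAt.comp y ((hasFDerivAt_id y).const_sub x)
    have h2 := Complex.ofRealCLM.hasFDerivAt.comp y h1
    refine (congrArg (fun L : R3 →L[ℝ] ℂ => L (EuclideanSpace.single a 1)) h2.fderiv).trans ?_
    simp
  have hpd0 : ∀ (a : Fin 3) y, pd a (fun _ => (0 : ℂ)) y = 0 := by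
    intro a y; simp [pd]
  have hI : ∀ a b, Integrable fun y =>
      (fderiv ℝ k (x - y) (EuclideanSpace.single a 1) : ℂ) * p y b := by
    intro a b
    have ht := hk.fderiv_apply (EuclideanSpace.single a 1)
    have := (EuclideanSpace.proj (𝕜 := ℂ) b : C3 →L[ℂ] ℂ).integrable_comp
      (integrable_comp_sub_smul ht.smooth.continuous ht.compact hp x)
    simpa using this
  have hq' : ∀ i, (moll k q x) i = ∫ y, (k (x - y) : ℂ) * q y i := by
    intro i
    rw [moll_eq, integral_coord (integrable_comp_sub_smul hk.smooth.continuous hk.compact hq x)]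
    simp
  ext i
  have hi := h _ (hΨ i)
  rw [hq' i]
  simp only [inner_C3, classicalCurl_zero, classicalCurl_one, classicalCurl_two] at hi
  fin_cases i
  · simp [hpd, hpd0] at hi
    refine Eq.trans ?_ hi
    change pd 1 (fun y => moll k p y 2) x - pd 2 (fun y => moll k p y 1) x = _
    rw [pd_moll hk hp, pd_moll hk hp, ← integral_sub (hI _ _) (hI _ _)]
    exact integral_congr_ae (Eventually.of_forall fun y => by simp only; ring)
  · simp [hpd, hpd0] at hi
    refine Eq.trans ?_ hi
    change pd 2 (fun y => moll k p y 0) x - pd 0 (fun y => moll k p y 2) x = _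
    rw [pd_moll hk hp, pd_moll hk hp, ← integral_sub (hI _ _) (hI _ _)]
    exact integral_congr_ae (Eventually.of_forall fun y => by simp only; ring)
  · simp [hpd, hpd0] at hi
    refine Eq.trans ?_ hi
    change pd 0 (fun y => moll k p y 1) x - pd 1 (fun y => moll k p y 0) x = _
    rw [pd_moll hk hp, pd_moll hk hp, ← integral_sub (hI _ _) (hI _ _)]
    exact integral_congr_ae (Eventually.of_forall fun y => by simp only; ring)

/-! ### Testing with translated and mollified fields -/

theorem memLp_integrable_inner {f g : R3 → C3} (hf : MemLp f 2) (hg : MemLp g 2) :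
    Integrable fun x => inner ℂ (f x) (g x) := by
  refine (L2.integrable_inner (𝕜 := ℂ) (hf.toLp f) (hg.toLp g)).congr ?_
  filter_upwards [hf.coeFn_toLp, hg.coeFn_toLp] with x h1 h2
  rw [h1, h2]

/-- The translations are strongly continuous on `L²`. -/
theorem continuous_integral_inner_comp_sub {f g : R3 → C3} (hf : MemLp f 2) (hg : MemLp g 2) :
    Continuous fun z : R3 => ∫ x, inner ℂ (f (x - z)) (g x) := by
  have : Fact ((2 : ENNReal) ≠ ⊤) := ⟨by norm_num⟩
  have h : Continuous fun z : R3 => inner ℂ ((DomAddAct.mk (-z)) +ᵥ hf.toLp f) (hg.toLp g) := by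
    have h1 : Continuous fun z : R3 => (DomAddAct.mk (-z)) :=
      DomAddAct.continuous_mk.comp continuous_neg
    have h2 : Continuous fun z : R3 => ((DomAddAct.mk (-z)) +ᵥ hf.toLp f : Lp C3 2 volume) :=
      h1.vadd continuous_const
    exact h2.inner continuous_const
  refine h.congr fun z => ?_
  rw [DomAddAct.mk_vadd_toLp, L2.inner_def]
  refine integral_congr_ae ?_
  filter_upwards [hg.coeFn_toLp, MemLp.coeFn_toLp
    (hf.comp_measurePreserving <| measurePreserving_vadd (-z) (volume : Measure R3))] with x h1 h2
  refine congrArg₂ (inner ℂ) (h2.trans ?_) h1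
  simp only [Function.comp_apply, vadd_eq_add]
  rw [neg_add_eq_sub]

theorem integral_inner_moll {k : R3 → ℝ} (hk : Continuous k) (hkc : HasCompactSupport k)
    {q u : R3 → C3} (hq : MemLp q 2) (hu : MemLp u 2) :
    ∫ z, k z • ∫ x, inner ℂ (q (x - z)) (u x) = ∫ x, inner ℂ (moll k q x) (u x) := by
  have hki : Integrable k := hk.integrable_of_hasCompactSupport hkc
  have hql : LocallyIntegrable q := hq.locallyIntegrable (by norm_num)
  have hint : Integrable (fun a : R3 × R3 => k a.2 • inner ℂ (q (a.1 - a.2)) (u a.1))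
      (volume.prod volume) := by
    have hq2 : Integrable fun x => ‖q x‖ ^ 2 := (memLp_two_iff_integrable_sq_norm hq.1).1 hq
    have hu2 : Integrable fun x => ‖u x‖ ^ 2 := (memLp_two_iff_integrable_sq_norm hu.1).1 hu
    have h1 := hki.norm.convolution_integrand (ContinuousLinearMap.mul ℝ ℝ) hq2 (μ := volume)
    have h2 : Integrable (fun a : R3 × R3 => ‖u a.1‖ ^ 2 * ‖k a.2‖) (volume.prod volume) :=
      hu2.mul_prod hki.norm
    refine (h1.add h2).mono' ?_ (Eventually.of_forall fun a => ?_)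
    · have m1 : AEStronglyMeasurable (fun a : R3 × R3 => q (a.1 - a.2)) (volume.prod volume) :=
        hq.1.comp_quasiMeasurePreserving
          (quasiMeasurePreserving_sub_of_right_invariant volume volume)
      have m2 : AEStronglyMeasurable (fun a : R3 × R3 => u a.1) (volume.prod volume) :=
        hu.1.comp_fst
      exact ((hk.comp continuous_snd).aestronglyMeasurable).smul (m1.inner m2)
    · simp only [Pi.add_apply, ContinuousLinearMap.mul_apply']
      rw [norm_smul]
      have h3 := norm_inner_le_norm (𝕜 := ℂ) (q (a.1 - a.2)) (u a.1)
      have h4 : ‖q (a.1 - a.2)‖ * ‖u a.1‖ ≤ ‖q (a.1 - a.2)‖ ^ 2 + ‖u a.1‖ ^ 2 := by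
        nlinarith [sq_nonneg (‖q (a.1 - a.2)‖ - ‖u a.1‖), sq_nonneg ‖q (a.1 - a.2)‖,
          sq_nonneg ‖u a.1‖]
      have h5 := mul_le_mul_of_nonneg_left (h3.trans h4) (norm_nonneg (k a.2))
      linarith
  have hswap := integral_integral_swap (f := fun x z => k z • inner ℂ (q (x - z)) (u x)) hint
  simp only [← integral_smul]
  rw [← hswap]
  refine integral_congr_ae (Eventually.of_forall fun x => ?_)
  have hx : Integrable fun z => k z • q (x - z) :=
    hkc.convolutionExists_left (ContinuousLinearMap.lsmul ℝ ℝ) hk hql x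
  have h1 : ∀ z, k z • inner ℂ (q (x - z)) (u x) =
      starRingEnd ℂ (inner ℂ (u x) (k z • q (x - z))) := by
    intro z
    rw [inner_conj_symm, ← Complex.coe_smul, ← Complex.coe_smul, inner_smul_left,
      Complex.conj_ofReal, smul_eq_mul]
  simp only [h1]
  rw [integral_conj, integral_inner hx, inner_conj_symm]
  rfl

/-- Let `p` live on a part `S` of `Ω` from which a cone of directions points into `Ω`. Mollifying
the translates of `p` along the cone gives test fields in `Ω`; the pairing with the translates is
continuous, hence `p` itself can be used as a test field. -/
theorem integral_inner_eq_of_cone {Ω S : Set R3} (hb : Bornology.IsBounded Ω)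
    {e : R3} {c t₀ : ℝ} (hc : 0 < c) (ht₀ : 0 < t₀)
    (hcone : ∀ y ∈ S ∩ Ω, ∀ t, 0 < t → t < t₀ → Metric.ball (y + t • e) (c * t) ⊆ Ω)
    {p q u v : R3 → C3} (hp : MemLp p 2) (hq : MemLp q 2) (hu : MemLp u 2) (hv : MemLp v 2)
    (hpS : ∀ x, x ∉ S ∩ Ω → p x = 0) (hpq : IsWeakCurl univ p q) (huv : IsWeakCurl Ω u v) :
    ∫ x, inner ℂ (q x) (u x) = ∫ x, inner ℂ (p x) (v x) := by
  have hpl : LocallyIntegrable p := hp.locallyIntegrable (by norm_num)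
  have hql : LocallyIntegrable q := hq.locallyIntegrable (by norm_num)
  set F : R3 → ℂ := fun z => (∫ x, inner ℂ (q (x - z)) (u x)) - ∫ x, inner ℂ (p (x - z)) (v x)
  have c1 := continuous_integral_inner_comp_sub hq hu
  have c2 := continuous_integral_inner_comp_sub hp hv
  have hF : Continuous F := c1.sub c2
  have hzero : ∀ t, 0 < t → t < t₀ → F (t • e) = 0 := by
    intro t ht htt
    have hct : 0 < c * t / 2 := by positivity
    have hae : ∀ᵐ z, z ∈ Metric.ball (t • e) (c * t / 2) → F z = 0 := by
      refine Metric.isOpen_ball.ae_eq_zero_of_integral_contDiff_smul_eq_zero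
        (hF.locallyIntegrable.locallyIntegrableOn _) ?_
      intro k hk hkc hks
      have hkt : IsTest k univ := ⟨hk, hkc, subset_univ _⟩
      have hsupp : tsupport (moll k p) ⊆ Ω := by
        intro x hx
        obtain ⟨w, hw, hxw⟩ := Metric.mem_closure_iff.1 hx (c * t / 2) hct
        rw [moll_eq_convolution] at hw
        obtain ⟨z, hz, y, hy, rfl⟩ := support_convolution_subset _ hw
        have hyS : y ∈ S ∩ Ω := by
          by_contra hn
          exact hy (hpS y hn)
        refine hcone y hyS t ht htt ?_
        have h1 := hks (subset_tsupport _ hz)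
        rw [Metric.mem_ball] at h1 ⊢
        have h2 : dist (z + y) (y + t • e) = dist z (t • e) := by
          rw [add_comm, dist_add_left]
        have h3 := dist_triangle x (z + y) (y + t • e)
        simp only at hxw
        linarith
      have hP : IsTest (moll k p) Ω := ⟨moll_contDiff hkt hpl,
        Metric.isCompact_of_isClosed_isBounded (isClosed_tsupport _) (hb.subset hsupp), hsupp⟩
      have h1 := huv _ hP
      simp only [classicalCurl_moll hkt hpl hql hpq] at h1
      rw [← integral_inner_moll hk.continuous hkc hq hu,
        ← integral_inner_moll hk.continuous hkc hp hv, ← sub_eq_zero, ← integral_sub] at h1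
      · rw [← h1]
        refine integral_congr_ae (Eventually.of_forall fun z => ?_)
        simp only [F, smul_sub]
      · exact (hk.continuous.smul c1).integrable_of_hasCompactSupport hkc.smul_right
      · exact (hk.continuous.smul c2).integrable_of_hasCompactSupport hkc.smul_right
    have heq : EqOn F (fun _ => 0) (Metric.ball (t • e) (c * t / 2)) :=
      Measure.eqOn_open_of_ae_eq (μ := volume) ((ae_restrict_iff' measurableSet_ball).2 hae)
        Metric.isOpen_ball hF.continuousOn continuousOn_const
    exact heq (Metric.mem_ball_self hct)
  have hlim : Tendsto (fun t : ℝ => F (t • e)) (𝓝[>] 0) (𝓝 (F 0)) := by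
    have : Continuous fun t : ℝ => F (t • e) := hF.comp (continuous_id.smul continuous_const)
    have := this.tendsto 0
    simp only [zero_smul] at this
    exact this.mono_left nhdsWithin_le_nhds
  have h0 : F 0 = 0 := by
    refine tendsto_nhds_unique hlim (tendsto_const_nhds.congr' ?_)
    filter_upwards [Ioo_mem_nhdsGT ht₀] with t ht
    exact (hzero t ht.1 ht.2).symm
  simp only [F, sub_zero] at h0
  exact sub_eq_zero.1 h0

/-! ### Localization of fields -/

/-- The cross product of the gradient of the real function `χ` with the field `p`. -/
def gradCross (χ : R3 → ℝ) (p : R3 → C3) (x : R3) : C3 :=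
  !₂[(fderiv ℝ χ x (EuclideanSpace.single 1 1) : ℂ) * p x 2
      - (fderiv ℝ χ x (EuclideanSpace.single 2 1) : ℂ) * p x 1,
    (fderiv ℝ χ x (EuclideanSpace.single 2 1) : ℂ) * p x 0
      - (fderiv ℝ χ x (EuclideanSpace.single 0 1) : ℂ) * p x 2,
    (fderiv ℝ χ x (EuclideanSpace.single 0 1) : ℂ) * p x 1
      - (fderiv ℝ χ x (EuclideanSpace.single 1 1) : ℂ) * p x 0]

theorem memLp_ofReal_mul {g : R3 → ℝ} (hg : Continuous g) (hgc : HasCompactSupport g) {f : R3 → ℂ}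
    (hf : MemLp f 2) : MemLp (fun x => (g x : ℂ) * f x) 2 := by
  have h1 : MemLp (fun x => (g x : ℂ)) ⊤ := by
    refine (Complex.continuous_ofReal.comp hg).memLp_of_hasCompactSupport ?_
    exact hgc.comp_left Complex.ofReal_zero
  exact hf.mul h1

theorem memLp_gradCross {χ : R3 → ℝ} {S : Set R3} (hχ : IsTest χ S) {p : R3 → C3}
    (hp : MemLp p 2) : MemLp (gradCross χ p) 2 := by
  have h : ∀ a b, MemLp (fun x => (fderiv ℝ χ x (EuclideanSpace.single a 1) : ℂ) * p x b) 2 :=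
    fun a b => memLp_ofReal_mul (hχ.fderiv_apply (EuclideanSpace.single a 1)).smooth.continuous
      (hχ.fderiv_apply (EuclideanSpace.single a 1)).compact (hp.eval_piLp b)
  refine MemLp.of_eval_piLp fun i => ?_
  fin_cases i
  · exact (h 1 2).sub (h 2 1)
  · exact (h 2 0).sub (h 0 2)
  · exact (h 0 1).sub (h 1 0)

theorem memLp_smul_field {χ : R3 → ℝ} {S : Set R3} (hχ : IsTest χ S) {p : R3 → C3}
    (hp : MemLp p 2) : MemLp (fun x => (χ x : ℂ) • p x) 2 := by
  refine MemLp.of_eval_piLp fun i => ?_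
  exact memLp_ofReal_mul hχ.smooth.continuous hχ.compact (hp.eval_piLp i)

theorem pd_ofReal_mul {χ : R3 → ℝ} {f : R3 → ℂ} (hχ : Differentiable ℝ χ) (hf : Differentiable ℝ f)
    (i : Fin 3) (x : R3) : pd i (fun y => (χ y : ℂ) * f y) x =
      (fderiv ℝ χ x (EuclideanSpace.single i 1) : ℂ) * f x + (χ x : ℂ) * pd i f x := by
  have h1 : HasFDerivAt (fun y => (χ y : ℂ)) (Complex.ofRealCLM.comp (fderiv ℝ χ x)) x :=
    Complex.ofRealCLM.hasFDerivAt.comp x (hχ x).hasFDerivAt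
  have h2 : HasFDerivAt (fun y => (χ y : ℂ) * f y)
      ((χ x : ℂ) • fderiv ℝ f x + f x • Complex.ofRealCLM.comp (fderiv ℝ χ x)) x :=
    h1.mul (hf x).hasFDerivAt
  unfold pd
  rw [h2.fderiv]
  simp only [Complex.ofRealCLM_apply, _root_.add_apply, _root_.smul_apply,
    smul_eq_mul, ContinuousLinearMap.comp_apply]
  ring

/-- The product rule `curl (χ p) = χ curl p + ∇χ × p` for the weak curl. -/
theorem IsWeakCurl.smul {χ : R3 → ℝ} {S : Set R3} (hχ : IsTest χ S) {p q : R3 → C3}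
    (hp : MemLp p 2) (hq : MemLp q 2) (h : IsWeakCurl univ p q) :
    IsWeakCurl univ (fun x => (χ x : ℂ) • p x) (fun x => (χ x : ℂ) • q x + gradCross χ p x) := by
  intro ψ hψ
  have hψ' : IsTest (fun x => (χ x : ℂ) • ψ x) univ := by
    refine ⟨?_, HasCompactSupport.smul_left (f := fun x => (χ x : ℂ)) hψ.compact, subset_univ _⟩
    rw [contDiff_piLp 2]
    intro i
    have h1 : ContDiff ℝ ∞ fun x => (χ x : ℂ) := Complex.ofRealCLM.contDiff.comp hχ.smooth
    exact h1.mul (hψ.coord i).smooth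
  have h1 := h _ hψ'
  have hψm : MemLp ψ 2 := hψ.smooth.continuous.memLp_of_hasCompactSupport hψ.compact
  have hψm' : MemLp (fun x => (χ x : ℂ) • ψ x) 2 := memLp_smul_field hχ hψm
  have hcm : MemLp (classicalCurl fun x => (χ x : ℂ) • ψ x) 2 :=
    (classicalCurl_continuous_compact hψ').1.memLp_of_hasCompactSupport
      (classicalCurl_continuous_compact hψ').2
  have key : ∀ x, inner ℂ (classicalCurl ψ x) ((χ x : ℂ) • p x) =
      inner ℂ (classicalCurl (fun x => (χ x : ℂ) • ψ x) x) (p x)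
        + inner ℂ (ψ x) (gradCross χ p x) := by
    intro x
    have hd := fun b => pd_ofReal_mul hχ.differentiable (hψ.coord b).differentiable
    simp only [inner_C3, classicalCurl_zero, classicalCurl_one, classicalCurl_two, PiLp.smul_apply,
      smul_eq_mul, hd, map_add, map_sub, map_mul, Complex.conj_ofReal]
    simp only [gradCross, PiLp.toLp_apply, Matrix.cons_val_zero, Matrix.cons_val_one,
      Matrix.cons_val]
    ring
  have key2 : ∀ x, inner ℂ (ψ x) ((χ x : ℂ) • q x + gradCross χ p x) =
      inner ℂ ((χ x : ℂ) • ψ x) (q x) + inner ℂ (ψ x) (gradCross χ p x) := by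
    intro x
    rw [inner_add_right, inner_smul_left, inner_smul_right, Complex.conj_ofReal]
  simp only [key, key2]
  rw [integral_add (memLp_integrable_inner hcm hp)
      (memLp_integrable_inner hψm (memLp_gradCross hχ hp)),
    integral_add (memLp_integrable_inner hψm' hq)
      (memLp_integrable_inner hψm (memLp_gradCross hχ hp)), h1]

/-! ### Green's formula in a Lipschitz domain -/

/-- Near every point of its closure, a domain with Lipschitz boundary contains the cones with a
fixed axis `e` and opening `c` based at its points. -/
theorem exists_cone {Ω : Set R3} (hΩ : IsOpen Ω) (hL : HasLipschitzBoundary Ω) {x : R3}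
    (hx : x ∈ closure Ω) :
    ∃ N : Set R3, IsOpen N ∧ x ∈ N ∧ Bornology.IsBounded N ∧
      ∃ (e : R3) (c t₀ : ℝ), 0 < c ∧ 0 < t₀ ∧
      ∀ y ∈ N ∩ Ω, ∀ t, 0 < t → t < t₀ → Metric.ball (y + t • e) (c * t) ⊆ Ω := by
  by_cases hxΩ : x ∈ Ω
  · obtain ⟨r, hr, hrΩ⟩ := Metric.isOpen_iff.1 hΩ x hxΩ
    refine ⟨Metric.ball x (r / 2), Metric.isOpen_ball, Metric.mem_ball_self (by positivity),
      Metric.isBounded_ball, 0, 1, r / 2, one_pos, by positivity, fun y hy t _ htr w hw => hrΩ ?_⟩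
    have h1 := hy.1
    rw [smul_zero, add_zero, one_mul] at hw
    rw [Metric.mem_ball] at h1 hw ⊢
    linarith [dist_triangle w y x]
  · have hfr : x ∈ frontier Ω := ⟨hx, by rwa [hΩ.interior_eq]⟩
    obtain ⟨R, K, g, hg, hev⟩ := hL x hfr
    obtain ⟨r, hr, hball⟩ := Metric.eventually_nhds_iff_ball.1 hev
    set e : R3 := R.symm (EuclideanSpace.single 2 1) with he
    have hRe : R e = EuclideanSpace.single 2 1 := R.apply_symm_apply _
    have hne : ‖e‖ = 1 := by rw [he, LinearIsometryEquiv.norm_map]; simp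
    have hK : (0 : ℝ) ≤ K := K.2
    set c : ℝ := 1 / (1 + K) with hc_def
    have hc : 0 < c := by positivity
    have hcK : c * (1 + K) = 1 := by rw [hc_def]; field_simp
    have hc1 : c ≤ 1 := by nlinarith
    refine ⟨Metric.ball x (r / 3), Metric.isOpen_ball, Metric.mem_ball_self (by positivity),
      Metric.isBounded_ball, e, c, r / 3, hc, by positivity, fun y hy t ht htr w hw => ?_⟩
    have hyx := hy.1
    rw [Metric.mem_ball] at hyx hw
    have hte : dist (y + t • e) y = t := by
      rw [dist_eq_norm, add_sub_cancel_left, norm_smul, hne, mul_one, Real.norm_of_nonneg ht.le]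
    have hct : c * t ≤ t := by nlinarith
    have hwx : dist w x < r := by
      have h1 := dist_triangle w (y + t • e) x
      have h2 := dist_triangle (y + t • e) y x
      linarith
    have hyr : dist y x < r := by linarith
    have hy2 := (hball y (Metric.mem_ball.2 hyr)).1 hy.2
    rw [hball w (Metric.mem_ball.2 hwx)]
    set z := w - (y + t • e) with hz
    have hzn : ‖z‖ < c * t := by rwa [hz, ← dist_eq_norm]
    have hRw : R w = R y + t • EuclideanSpace.single 2 1 + R z := by
      rw [hz, ← hRe, ← map_smul, ← map_add, ← map_add, add_sub_cancel]
    have hRz : ‖R z‖ = ‖z‖ := R.norm_map z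
    have hcoord : ∀ i, |(R z) i| ≤ ‖z‖ := fun i => by
      rw [← hRz]; exact PiLp.norm_apply_le (R z) i
    have e0 : R w 0 = R y 0 + R z 0 := by rw [hRw]; simp
    have e1 : R w 1 = R y 1 + R z 1 := by rw [hRw]; simp
    have e2 : R w 2 = R y 2 + t + R z 2 := by rw [hRw]; simp
    have hgd : g !₂[R w 0, R w 1] - g !₂[R y 0, R y 1] ≤ K * ‖z‖ := by
      have h1 := hg.dist_le_mul !₂[R w 0, R w 1] !₂[R y 0, R y 1]
      rw [Real.dist_eq] at h1
      refine (le_abs_self _).trans (h1.trans (mul_le_mul_of_nonneg_left ?_ hK))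
      rw [← hRz, EuclideanSpace.dist_eq, EuclideanSpace.norm_eq]
      refine Real.sqrt_le_sqrt ?_
      simp only [Fin.sum_univ_two, Fin.sum_univ_three, Real.dist_eq, Real.norm_eq_abs, sq_abs]
      simp only [Matrix.cons_val_zero, Matrix.cons_val_one, e0, e1]
      nlinarith [sq_nonneg (R z 2)]
    have hz2 := (abs_le.1 (hcoord 2)).1
    have hfin : (1 + K) * ‖z‖ < t := by
      have : (1 + K : ℝ) * ‖z‖ < (1 + K) * (c * t) := mul_lt_mul_of_pos_left hzn (by positivity)
      calc (1 + K : ℝ) * ‖z‖ < (1 + K) * (c * t) := this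
        _ = (c * (1 + K)) * t := by ring
        _ = t := by rw [hcK, one_mul]
    rw [e2]
    linarith

open scoped Manifold in
/-- A smooth partition of unity on a compact set `K`, subordinate to bounded neighbourhoods of its
points. -/
theorem exists_smooth_partition {K : Set R3} (hK : IsCompact K) {N : R3 → Set R3}
    (hN : ∀ x ∈ K, IsOpen (N x) ∧ x ∈ N x ∧ Bornology.IsBounded (N x)) :
    ∃ (t : Finset R3) (χ : t → R3 → ℝ), (∀ i : t, (i : R3) ∈ K ∧ IsTest (χ i) (N i)) ∧
      ∀ x ∈ K, ∑ i, χ i x = 1 := by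
  obtain ⟨t, htK, ht⟩ := hK.elim_nhds_subcover N fun x hx => (hN x hx).1.mem_nhds (hN x hx).2.1
  obtain ⟨f, hf⟩ := SmoothPartitionOfUnity.exists_isSubordinate 𝓘(ℝ, R3) hK.isClosed
    (fun i : t => N i) (fun i => (hN i (htK i i.2)).1) (by
      intro x hx
      obtain ⟨y, hy, hxy⟩ := mem_iUnion₂.1 (ht hx)
      exact mem_iUnion.2 ⟨⟨y, hy⟩, hxy⟩)
  refine ⟨t, fun i => f i, fun i => ⟨htK i i.2, (f i).contMDiff.contDiff, ?_, hf i⟩, fun x hx => ?_⟩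
  · exact Metric.isCompact_of_isClosed_isBounded (isClosed_tsupport _)
      ((hN i (htK i i.2)).2.2.subset (hf i))
  · rw [← finsum_eq_sum_of_fintype]
    exact f.sum_eq_one hx

theorem IsTest.mono {V F : Type*} [NormedAddCommGroup V] [NormedSpace ℝ V]
    [NormedAddCommGroup F] [NormedSpace ℝ F] {f : V → F} {S T : Set V} (h : IsTest f S)
    (hST : S ⊆ T) : IsTest f T := ⟨h.smooth, h.compact, h.support.trans hST⟩

theorem integral_inner_indicator {Ω : Set R3} (hΩ : MeasurableSet Ω) (f g : R3 → C3) :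
    ∫ x, inner ℂ (f x) (Ω.indicator g x) = ∫ x in Ω, inner ℂ (f x) (g x) := by
  rw [← integral_indicator hΩ]
  refine integral_congr_ae (Eventually.of_forall fun x => ?_)
  by_cases hx : x ∈ Ω <;> simp [hx]

/-- The integrals over `Ω` defining `greenGraph` are integrals of zero extensions over the whole
space. -/
theorem isWeakCurl_indicator {Ω S : Set R3} (hΩ : MeasurableSet Ω) {u v : L2 Ω}
    (h : (u, v) ∈ greenGraph Ω S) : IsWeakCurl S (Ω.indicator u) (Ω.indicator v) := by
  intro ψ hψ
  rw [integral_inner_indicator hΩ, integral_inner_indicator hΩ]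
  exact h ψ hψ

theorem memLp_indicator_L2 {Ω : Set R3} (hΩ : MeasurableSet Ω) (u : L2 Ω) :
    MemLp (Ω.indicator (u : R3 → C3)) 2 :=
  (memLp_indicator_iff_restrict hΩ).2 (Lp.memLp u)

/-- Green's formula for the weak curl: in a bounded domain with Lipschitz boundary, the weak curl is
the adjoint of the weak curl with vanishing tangential trace. -/
theorem inner_eq_inner_of_mem_greenGraph {Ω : Set R3} (hΩ : IsOpen Ω) (hb : Bornology.IsBounded Ω)
    (hL : HasLipschitzBoundary Ω) {u v p q : L2 Ω} (huv : (u, v) ∈ greenGraph Ω Ω)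
    (hpq : (p, q) ∈ greenGraph Ω univ) : inner ℂ q u = inner ℂ p v := by
  have hm := hΩ.measurableSet
  set p' := Ω.indicator (p : R3 → C3)
  set q' := Ω.indicator (q : R3 → C3)
  set u' := Ω.indicator (u : R3 → C3)
  set v' := Ω.indicator (v : R3 → C3)
  have hp : MemLp p' 2 := memLp_indicator_L2 hm p
  have hq : MemLp q' 2 := memLp_indicator_L2 hm q
  have hu : MemLp u' 2 := memLp_indicator_L2 hm u
  have hv : MemLp v' 2 := memLp_indicator_L2 hm v
  have hpq' : IsWeakCurl univ p' q' := isWeakCurl_indicator hm hpq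
  have huv' : IsWeakCurl Ω u' v' := isWeakCurl_indicator hm huv
  have hp0 : ∀ x, x ∉ Ω → p' x = 0 := fun x hx => indicator_of_notMem hx _
  choose! N hNo hxN hNb e c t₀ hc ht₀ hcone using fun x (hx : x ∈ closure Ω) => exists_cone hΩ hL hx
  obtain ⟨t, χ, hχ, hsum⟩ := exists_smooth_partition (hb.isCompact_closure)
    fun x hx => ⟨hNo x hx, hxN x hx, hNb x hx⟩
  have hloc : ∀ i, ∫ x, inner ℂ ((χ i x : ℂ) • q' x + gradCross (χ i) p' x) (u' x) =
      ∫ x, inner ℂ ((χ i x : ℂ) • p' x) (v' x) := by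
    intro i
    obtain ⟨hi, hχi⟩ := hχ i
    refine integral_inner_eq_of_cone hb (hc i hi) (ht₀ i hi) (hcone i hi)
      (memLp_smul_field hχi hp) ((memLp_smul_field hχi hq).add (memLp_gradCross hχi hp)) hu hv
      (fun x hx => ?_) (hpq'.smul hχi hp hq) huv'
    by_cases hxΩ : x ∈ Ω
    · have hxN : x ∉ N i := fun h => hx ⟨h, hxΩ⟩
      have : χ i x = 0 := by
        by_contra hne
        exact hxN (hχi.support (subset_tsupport _ hne))
      simp [this]
    · simp [hp0 x hxΩ]
  have hL1 : ∀ x ∈ Ω, ∑ i, ((χ i x : ℂ) • q' x + gradCross (χ i) p' x) = q' x := by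
    intro x hx
    have h1 : ∑ i, (χ i x : ℂ) = 1 := by
      rw [← Complex.ofReal_sum, hsum x (subset_closure hx), Complex.ofReal_one]
    have h2 : ∀ a : R3, ∑ i, (fderiv ℝ (χ i) x a : ℂ) = 0 := by
      intro a
      have h3 : HasFDerivAt (fun x => ∑ i, χ i x) (∑ i, fderiv ℝ (χ i) x) x :=
        HasFDerivAt.fun_sum fun i _ => ((hχ i).2.differentiable x).hasFDerivAt
      have h4 : HasFDerivAt (fun x => ∑ i, χ i x) (0 : R3 →L[ℝ] ℝ) x := by
        refine (hasFDerivAt_const (1 : ℝ) x).congr_of_eventuallyEq ?_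
        filter_upwards [hΩ.mem_nhds hx] with y hy
        exact hsum y (subset_closure hy)
      have h5 := congrArg (fun L : R3 →L[ℝ] ℝ => L a) (h3.unique h4)
      simp only [_root_.sum_apply, _root_.zero_apply] at h5
      rw [← Complex.ofReal_sum, h5, Complex.ofReal_zero]
    rw [Finset.sum_add_distrib, ← Finset.sum_smul, h1, one_smul]
    -- the gradients of a partition of unity sum to zero
    have h6 : ∑ i, gradCross (χ i) p' x = 0 := by
      ext j
      rw [WithLp.ofLp_sum, Finset.sum_apply]
      fin_cases j <;>
        simp [gradCross, Finset.sum_sub_distrib, ← Finset.sum_mul, h2, -Finset.univ_eq_attach]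
    rw [h6, add_zero]
  have hR1 : ∀ x, ∑ i, (χ i x : ℂ) • p' x = p' x := by
    intro x
    by_cases hx : x ∈ Ω
    · rw [← Finset.sum_smul, ← Complex.ofReal_sum, hsum x (subset_closure hx), Complex.ofReal_one,
        one_smul]
    · simp [hp0 x hx]
  have hfin : ∫ x, inner ℂ (q' x) (u' x) = ∫ x, inner ℂ (p' x) (v' x) := by
    have e1 : ∫ x, inner ℂ (q' x) (u' x) =
        ∑ i, ∫ x, inner ℂ ((χ i x : ℂ) • q' x + gradCross (χ i) p' x) (u' x) := by
      rw [← integral_finsetSum _ fun i _ => memLp_integrable_inner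
        (show MemLp (fun x => (χ i x : ℂ) • q' x + gradCross (χ i) p' x) 2 volume from
          (memLp_smul_field (hχ i).2 hq).add (memLp_gradCross (hχ i).2 hp)) hu]
      refine integral_congr_ae (Eventually.of_forall fun x => ?_)
      simp only
      rw [← sum_inner]
      by_cases hx : x ∈ Ω
      · rw [hL1 x hx]
      · simp [u', hx]
    have e2 : ∫ x, inner ℂ (p' x) (v' x) = ∑ i, ∫ x, inner ℂ ((χ i x : ℂ) • p' x) (v' x) := by
      rw [← integral_finsetSum _ fun i _ => memLp_integrable_inner
        (memLp_smul_field (hχ i).2 hp) hv]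
      refine integral_congr_ae (Eventually.of_forall fun x => ?_)
      simp only
      rw [← sum_inner, hR1]
    rw [e1, e2]
    exact Finset.sum_congr rfl fun i _ => hloc i
  rw [L2.inner_def, L2.inner_def]
  have e3 : ∀ f g : L2 Ω, ∫ x in Ω, inner ℂ (f x) (g x) =
      ∫ x, inner ℂ (Ω.indicator (f : R3 → C3) x) (Ω.indicator (g : R3 → C3) x) := by
    intro f g
    rw [integral_inner_indicator hm]
    refine setIntegral_congr_fun hm fun x hx => ?_
    simp only [indicator_of_mem hx]
  rw [e3, e3]
  exact hfin

/-! ### The stationary Maxwell system -/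

theorem greenGraph_isClosed (Ω S : Set R3) : IsClosed (greenGraph Ω S : Set (L2 Ω × L2 Ω)) := by
  have : (greenGraph Ω S : Set (L2 Ω × L2 Ω)) = ⋂ (ψ : R3 → C3) (_ : IsTest ψ S),
      {p | ∫ x in Ω, inner ℂ (classicalCurl ψ x) (p.1 x) = ∫ x in Ω, inner ℂ (ψ x) (p.2 x)} := by
    ext p
    simp [greenGraph]
  rw [this]
  refine isClosed_iInter fun ψ => isClosed_iInter fun h => ?_
  obtain ⟨G, hG⟩ := exists_rep Ω h.smooth.continuous h.compact
  obtain ⟨K, hK⟩ := exists_rep Ω (classicalCurl_continuous_compact h).1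
    (classicalCurl_continuous_compact h).2
  simp only [hG, hK]
  exact isClosed_eq (continuous_const.inner continuous_fst) (continuous_const.inner continuous_snd)

theorem greenGraph_anti (Ω : Set R3) {S T : Set R3} (h : S ⊆ T) :
    greenGraph Ω T ≤ greenGraph Ω S :=
  fun _ hp ψ hψ => hp ψ (hψ.mono h)

theorem classicalCurl_eq_zero {φ : R3 → C3} {S : Set R3} (h : IsTest φ S) {x : R3} (hx : x ∉ S) :
    classicalCurl φ x = 0 := by
  have h0 : ∀ i j : Fin 3, pd i (fun y => φ y j) x = 0 := fun i j => by
    by_contra h'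
    exact hx ((IsTest.coord h j).support (pd_support i h'))
  ext i
  fin_cases i <;> simp [classicalCurl, h0]

/-- A smooth field with compact support in `Ω` has vanishing tangential trace, and its weak curl is
the classical one. -/
theorem IsTest.mem_greenGraph {Ω : Set R3} {φ : R3 → C3} (h : IsTest φ Ω)
    (hφ : MemLp φ 2 (volume.restrict Ω)) (hc : MemLp (classicalCurl φ) 2 (volume.restrict Ω)) :
    (hφ.toLp φ, hc.toLp (classicalCurl φ)) ∈ greenGraph Ω univ := by
  intro ψ hψ
  have key : ∀ (f g : R3 → C3) (hg : MemLp g 2 (volume.restrict Ω)), (∀ x, x ∉ Ω → g x = 0) →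
      ∫ x in Ω, inner ℂ (f x) (hg.toLp g x) = ∫ x, inner ℂ (f x) (g x) := by
    intro f g hg h0
    rw [← setIntegral_eq_integral_of_forall_compl_eq_zero (s := Ω)
      (f := fun x => inner ℂ (f x) (g x)) fun x hx => by rw [h0 x hx, inner_zero_right]]
    refine integral_congr_ae ?_
    filter_upwards [hg.coeFn_toLp] with x hx
    rw [hx]
  have h0 : ∀ x, x ∉ Ω → φ x = 0 := fun x hx => by
    by_contra hne
    exact hx (h.support (subset_tsupport _ hne))
  simp only
  rw [key _ _ hφ h0, key _ _ hc fun x hx => classicalCurl_eq_zero h hx]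
  exact integral_inner_classicalCurl h hψ

/-- The variational step: projection on the closed subspace of the pairs `(φ, k curl φ)`, where `φ`
has vanishing tangential trace. The orthogonality relations, tested with smooth compactly supported
fields, say that `k (b - k curl E)` has the weak curl `E - f`. -/
theorem exists_curl_curl_solution (Ω : Set R3) {k : ℝ} (hk : k ≠ 0) (f b : L2 Ω) :
    ∃ E q : L2 Ω, (E, q) ∈ greenGraph Ω univ ∧
      ((k : ℂ) • (b - (k : ℂ) • q), E - f) ∈ greenGraph Ω Ω := by
  have hk' : (k : ℂ) ≠ 0 := Complex.ofReal_ne_zero.2 hk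
  let Φ : WithLp 2 (L2 Ω × L2 Ω) →L[ℂ] L2 Ω × L2 Ω :=
    (WithLp.fstL 2 ℂ (L2 Ω) (L2 Ω)).prod ((k : ℂ)⁻¹ • WithLp.sndL 2 ℂ (L2 Ω) (L2 Ω))
  let K : Submodule ℂ (WithLp 2 (L2 Ω × L2 Ω)) := (greenGraph Ω univ).comap Φ.toLinearMap
  have hK : IsClosed (K : Set (WithLp 2 (L2 Ω × L2 Ω))) :=
    (greenGraph_isClosed Ω univ).preimage Φ.continuous
  have : CompleteSpace K := hK.completeSpace_coe
  obtain ⟨y, hy, z, hz, hyz⟩ := K.exists_add_mem_mem_orthogonal (WithLp.toLp 2 (f, b))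
  have hf : f = y.fst + z.fst := congrArg (fun w => w.fst) hyz
  have hb : b = y.snd + z.snd := congrArg (fun w => w.snd) hyz
  refine ⟨y.fst, (k : ℂ)⁻¹ • y.snd, hy, fun φ hφ => ?_⟩
  have hm : MemLp φ 2 (volume.restrict Ω) :=
    hφ.smooth.continuous.memLp_of_hasCompactSupport hφ.compact
  have hc : MemLp (classicalCurl φ) 2 (volume.restrict Ω) :=
    (classicalCurl_continuous_compact hφ).1.memLp_of_hasCompactSupport
      (classicalCurl_continuous_compact hφ).2
  have hmem : WithLp.toLp 2 (hm.toLp φ, (k : ℂ) • hc.toLp (classicalCurl φ)) ∈ K := by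
    have h1 := hφ.mem_greenGraph hm hc
    change (hm.toLp φ, (k : ℂ)⁻¹ • (k : ℂ) • hc.toLp (classicalCurl φ)) ∈ greenGraph Ω univ
    rwa [inv_smul_smul₀ hk']
  have horth := (Submodule.mem_orthogonal _ _).1 hz _ hmem
  rw [WithLp.prod_inner_apply] at horth
  simp only [inner_smul_left, Complex.conj_ofReal] at horth
  have e : ∀ (g : R3 → C3) (hg : MemLp g 2 (volume.restrict Ω)) (u : L2 Ω),
      ∫ x in Ω, inner ℂ (g x) (u x) = inner ℂ (hg.toLp g) u := by
    intro g hg u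
    rw [L2.inner_def]
    refine integral_congr_ae ?_
    filter_upwards [hg.coeFn_toLp] with x hx
    rw [hx]
  simp only
  rw [e _ hc, e _ hm, smul_inv_smul₀ hk', hb, hf, add_sub_cancel_left, inner_smul_right,
    sub_add_cancel_left, inner_neg_right]
  exact eq_neg_of_add_eq_zero_right horth

/-- Solvability of the stationary Maxwell system with positive coefficients. -/
theorem exists_maxwell_solution (Ω : Set R3) {a b : ℝ} (ha : 0 < a) (hb : 0 < b) (f g : L2 Ω) :
    ∃ E q H r : L2 Ω, (E, q) ∈ greenGraph Ω univ ∧ (H, r) ∈ greenGraph Ω Ω ∧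
      E = f + (a : ℂ) • r ∧ H = g - (b : ℂ) • q := by
  set k : ℝ := √(a * b) with hk_def
  have hk : 0 < k := Real.sqrt_pos.2 (mul_pos ha hb)
  have hkk : (k : ℂ) * k = a * b := by
    rw [← Complex.ofReal_mul, hk_def, Real.mul_self_sqrt (mul_pos ha hb).le, Complex.ofReal_mul]
  have ha' : (a : ℂ) ≠ 0 := Complex.ofReal_ne_zero.2 ha.ne'
  have hk' : (k : ℂ) ≠ 0 := Complex.ofReal_ne_zero.2 hk.ne'
  obtain ⟨E, q, hE, hH⟩ := exists_curl_curl_solution Ω hk.ne' f (((a : ℂ) / k) • g)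
  refine ⟨E, q, g - (b : ℂ) • q, (a : ℂ)⁻¹ • (E - f), hE, ?_, ?_, rfl⟩
  · have h1 := (greenGraph Ω Ω).smul_mem (a : ℂ)⁻¹ hH
    rw [Prod.smul_mk] at h1
    convert h1 using 2
    have e1 : (a : ℂ)⁻¹ * (k * (a / k)) = 1 := by field_simp
    have e2 : (a : ℂ)⁻¹ * (k * k) = b := by rw [hkk, inv_mul_cancel_left₀ ha']
    rw [smul_sub, smul_sub, smul_smul, smul_smul, smul_smul, smul_smul, mul_assoc, e1, one_smul,
      mul_assoc, e2]
  · rw [smul_inv_smul₀ ha', add_sub_cancel]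

/-! ### The memory operator -/

theorem enorm_memory_le {C δ : ℝ} (hC : 0 < C) (hδ : 0 < δ) {ν : ℝ → ℝ} (hν : IsKernel C δ ν)
    (X : Type) [NormedAddCommGroup X] [InnerProductSpace ℂ X] [CompleteSpace X] (η : L2w C δ X) :
    ‖memory hC hδ hν X η‖ₑ ≤ ∫⁻ s, ‖η s‖ₑ ∂histMeasure C δ := by
  unfold histMeasure
  rw [lintegral_withDensity_eq_lintegral_mul_non_measurable _
    (weight_continuous C δ).measurable.ennreal_ofReal (by simp)]
  refine (enorm_integral_le_lintegral_enorm _).trans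
    (setLIntegral_mono' measurableSet_Ioi fun s hs => ?_)
  rw [enorm_smul, Pi.mul_apply, Real.enorm_eq_ofReal_abs]
  exact mul_le_mul_left (ENNReal.ofReal_le_ofReal (hν.bound s (le_of_lt hs))) _

/-- The memory operator is bounded, since `L²_w` embeds in `L¹_w`. -/
theorem exists_norm_memory_le {C δ : ℝ} (hC : 0 < C) (hδ : 0 < δ) {ν : ℝ → ℝ}
    (hν : IsKernel C δ ν) (X : Type) [NormedAddCommGroup X] [InnerProductSpace ℂ X]
    [CompleteSpace X] : ∃ M, ∀ η : L2w C δ X, ‖memory hC hδ hν X η‖ ≤ M * ‖η‖ := by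
  have := histMeasure_finite (C := C) hδ
  set m := histMeasure C δ univ ^ (1 / (1 : ENNReal).toReal - 1 / (2 : ENNReal).toReal) with hm
  have hm_top : m ≠ ⊤ := ENNReal.rpow_ne_top_of_nonneg (by norm_num) (measure_ne_top _ _)
  refine ⟨m.toReal, fun η => ?_⟩
  have h1 := enorm_memory_le hC hδ hν X η
  rw [← eLpNorm_one_eq_lintegral_enorm] at h1
  have h2 := h1.trans (eLpNorm_le_eLpNorm_mul_rpow_measure_univ (q := 2) (by norm_num)
    (Lp.aestronglyMeasurable η))
  rw [← hm] at h2
  have h3 := ENNReal.toReal_mono (ENNReal.mul_ne_top (Lp.eLpNorm_ne_top η) hm_top) h2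
  rwa [ENNReal.toReal_mul, toReal_enorm, ← Lp.norm_def, mul_comm] at h3

namespace Medium

variable (d : Medium)

/-! ### The structure of the history space -/

theorem inner_hist (U V : d.Hist) : inner ℂ U V =
    (d.ε : ℂ) * inner ℂ (d.pE U) (d.pE V) + (d.μ : ℂ) * inner ℂ (d.pH U) (d.pH V)
      + inner ℂ (d.pηE U) (d.pηE V) + inner ℂ (d.pηH U) (d.pηH V) := rfl

theorem norm_sq_hist (U : d.Hist) :
    ‖U‖ ^ 2 = d.ε * ‖d.pE U‖ ^ 2 + d.μ * ‖d.pH U‖ ^ 2 + ‖d.pηE U‖ ^ 2 + ‖d.pηH U‖ ^ 2 := by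
  have h := congrArg Complex.re (d.inner_hist U U)
  simp only [Complex.add_re, Complex.re_ofReal_mul] at h
  simp only [← RCLike.re_to_complex] at h
  rw [inner_self_eq_norm_sq (d.pE U), inner_self_eq_norm_sq (d.pH U),
    inner_self_eq_norm_sq (d.pηE U), inner_self_eq_norm_sq (d.pηH U)] at h
  rw [← h]
  exact (inner_self_eq_norm_sq (𝕜 := ℂ) U).symm

theorem hist_ext {U V : d.Hist} (h₁ : d.pE U = d.pE V) (h₂ : d.pH U = d.pH V)
    (h₃ : d.pηE U = d.pηE V) (h₄ : d.pηH U = d.pηH V) : U = V :=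
  Prod.ext h₁ (Prod.ext h₂ (Prod.ext h₃ h₄))

/-- The identity map from the history space to the product of its factors. -/
def histEquivQuad : d.Hist ≃ₗ[ℂ] d.Quad where
  toFun U := U
  invFun U := U
  map_add' _ _ := rfl
  map_smul' _ _ := rfl
  left_inv _ := rfl
  right_inv _ := rfl

theorem norm_quad_le (U : d.Hist) :
    ‖d.histEquivQuad U‖ ≤ (√(d.ε⁻¹) + √(d.μ⁻¹) + 1) * ‖U‖ := by
  have hε := d.ε_pos
  have hμ := d.μ_pos
  have hn := d.norm_sq_hist U
  have key : ∀ c : ℝ, 0 < c → ∀ r : ℝ, c * r ^ 2 ≤ ‖U‖ ^ 2 → r ≤ √(c⁻¹) * ‖U‖ := by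
    intro c hc r hr
    refine le_of_sq_le_sq ?_ (by positivity)
    rw [mul_pow, Real.sq_sqrt (by positivity), inv_mul_eq_div, le_div_iff₀ hc]
    linarith
  have p1 : 0 ≤ d.ε * ‖d.pE U‖ ^ 2 := by positivity
  have p2 : 0 ≤ d.μ * ‖d.pH U‖ ^ 2 := by positivity
  have p3 : 0 ≤ ‖d.pηE U‖ ^ 2 := sq_nonneg _
  have p4 : 0 ≤ ‖d.pηH U‖ ^ 2 := sq_nonneg _
  have q1 : ‖d.pE U‖ ≤ √(d.ε⁻¹) * ‖U‖ := key _ hε _ (by linarith)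
  have q2 : ‖d.pH U‖ ≤ √(d.μ⁻¹) * ‖U‖ := key _ hμ _ (by linarith)
  have q3 : ‖d.pηE U‖ ≤ ‖U‖ := le_of_sq_le_sq (by linarith) (norm_nonneg _)
  have q4 : ‖d.pηH U‖ ≤ ‖U‖ := le_of_sq_le_sq (by linarith) (norm_nonneg _)
  have r1 : 0 ≤ √(d.ε⁻¹) * ‖U‖ := by positivity
  have r2 : 0 ≤ √(d.μ⁻¹) * ‖U‖ := by positivity
  have r3 := norm_nonneg U
  have e : (√(d.ε⁻¹) + √(d.μ⁻¹) + 1) * ‖U‖ = √(d.ε⁻¹) * ‖U‖ + √(d.μ⁻¹) * ‖U‖ + ‖U‖ := by ring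
  rw [e]
  have s1 := q1.trans (show _ ≤ √(d.ε⁻¹) * ‖U‖ + √(d.μ⁻¹) * ‖U‖ + ‖U‖ by linarith)
  have s2 := q2.trans (show _ ≤ √(d.ε⁻¹) * ‖U‖ + √(d.μ⁻¹) * ‖U‖ + ‖U‖ by linarith)
  have s3 := q3.trans (show _ ≤ √(d.ε⁻¹) * ‖U‖ + √(d.μ⁻¹) * ‖U‖ + ‖U‖ by linarith)
  have s4 := q4.trans (show _ ≤ √(d.ε⁻¹) * ‖U‖ + √(d.μ⁻¹) * ‖U‖ + ‖U‖ by linarith)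
  exact norm_prod_le_iff.2 ⟨s1, norm_prod_le_iff.2 ⟨s2, norm_prod_le_iff.2 ⟨s3, s4⟩⟩⟩

theorem norm_hist_le (U : d.Quad) :
    ‖d.histEquivQuad.symm U‖ ≤ √(d.ε + d.μ + 2) * ‖U‖ := by
  have hε := d.ε_pos
  have hμ := d.μ_pos
  refine le_of_sq_le_sq ?_ (by positivity)
  rw [mul_pow, Real.sq_sqrt (by positivity), norm_sq_hist]
  have q1 : ‖U.1‖ ^ 2 ≤ ‖U‖ ^ 2 := by
    gcongr; exact norm_fst_le U
  have q2 : ‖U.2.1‖ ^ 2 ≤ ‖U‖ ^ 2 := by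
    gcongr; exact (norm_fst_le U.2).trans (norm_snd_le U)
  have q3 : ‖U.2.2.1‖ ^ 2 ≤ ‖U‖ ^ 2 := by
    gcongr; exact (norm_fst_le U.2.2).trans ((norm_snd_le U.2).trans (norm_snd_le U))
  have q4 : ‖U.2.2.2‖ ^ 2 ≤ ‖U‖ ^ 2 := by
    gcongr; exact (norm_snd_le U.2.2).trans ((norm_snd_le U.2).trans (norm_snd_le U))
  have := mul_le_mul_of_nonneg_left q1 hε.le
  have := mul_le_mul_of_nonneg_left q2 hμ.le
  change d.ε * ‖U.1‖ ^ 2 + d.μ * ‖U.2.1‖ ^ 2 + ‖U.2.2.1‖ ^ 2 + ‖U.2.2.2‖ ^ 2 ≤ _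
  linarith

/-- The norm of the history space is equivalent to the norm of the product of its factors. -/
def histEquivQuadL : d.Hist ≃L[ℂ] d.Quad :=
  d.histEquivQuad.toContinuousLinearEquivOfBounds _ _ d.norm_quad_le d.norm_hist_le

instance : CompleteSpace d.Hist :=
  (completeSpace_congr (e := d.histEquivQuadL.toEquiv) d.histEquivQuadL.isUniformEmbedding).2
    inferInstance

/-! ### The principal part of the Maxwell operator and its bounded perturbation -/

/-- The graph of the principal part
`(E, H, η_E, η_H) ↦ (ε⁻¹ curl H, -μ⁻¹ curl E, -∂ₛ η_E, -∂ₛ η_H)` of `𝒜`, described by conditions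
that are linear in the pair of argument and value. -/
def principalGraph : Submodule ℂ (d.Hist × d.Hist) :=
  (greenGraph d.Ω univ).comap ((inclJ d.Ω ∘ₗ d.pE ∘ₗ LinearMap.fst ℂ d.Hist d.Hist).prod
    (-(d.μ : ℂ) • inclJhat d.Ω ∘ₗ d.pH ∘ₗ LinearMap.snd ℂ d.Hist d.Hist)) ⊓
  (greenGraph d.Ω d.Ω).comap ((inclJhat d.Ω ∘ₗ d.pH ∘ₗ LinearMap.fst ℂ d.Hist d.Hist).prod
    ((d.ε : ℂ) • inclJ d.Ω ∘ₗ d.pE ∘ₗ LinearMap.snd ℂ d.Hist d.Hist)) ⊓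
  (derivGraph d.C_pos d.δ_pos (JSpace d.Ω)).comap
    ((d.pηE ∘ₗ LinearMap.fst ℂ d.Hist d.Hist).prod
      (-d.pηE ∘ₗ LinearMap.snd ℂ d.Hist d.Hist)) ⊓
  (derivGraph d.C_pos d.δ_pos (JhatSpace d.Ω)).comap
    ((d.pηH ∘ₗ LinearMap.fst ℂ d.Hist d.Hist).prod
      (-d.pηH ∘ₗ LinearMap.snd ℂ d.Hist d.Hist))

theorem mem_principalGraph {U V : d.Hist} : (U, V) ∈ d.principalGraph ↔
    (inclJ d.Ω (d.pE U), -(d.μ : ℂ) • inclJhat d.Ω (d.pH V)) ∈ greenGraph d.Ω univ ∧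
    (inclJhat d.Ω (d.pH U), (d.ε : ℂ) • inclJ d.Ω (d.pE V)) ∈ greenGraph d.Ω d.Ω ∧
    (d.pηE U, -d.pηE V) ∈ derivGraph d.C_pos d.δ_pos (JSpace d.Ω) ∧
    (d.pηH U, -d.pηH V) ∈ derivGraph d.C_pos d.δ_pos (JhatSpace d.Ω) := by
  unfold principalGraph
  rw [Submodule.mem_inf, Submodule.mem_inf, Submodule.mem_inf, and_assoc, and_assoc]
  rfl

theorem inclJ_injective (Ω : Set R3) : Function.Injective (inclJ Ω) := Subtype.val_injective

theorem inclJhat_injective (Ω : Set R3) : Function.Injective (inclJhat Ω) := Subtype.val_injective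

theorem inner_inclJ (Ω : Set R3) (u v : JSpace Ω) :
    inner ℂ (inclJ Ω u) (inclJ Ω v) = inner ℂ u v := rfl

theorem inner_inclJhat (Ω : Set R3) (u v : JhatSpace Ω) :
    inner ℂ (inclJhat Ω u) (inclJhat Ω v) = inner ℂ u v := rfl

theorem principalGraph_functional : ∀ p ∈ d.principalGraph, p.1 = 0 → p.2 = 0 := by
  rintro ⟨U, V⟩ hp hU
  simp only at hU ⊢
  subst hU
  obtain ⟨h1, h2, h3, h4⟩ := d.mem_principalGraph.1 hp
  have hε : (d.ε : ℂ) ≠ 0 := Complex.ofReal_ne_zero.2 d.ε_pos.ne'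
  have hμ : -(d.μ : ℂ) ≠ 0 := neg_ne_zero.2 (Complex.ofReal_ne_zero.2 d.μ_pos.ne')
  refine d.hist_ext ?_ ?_ ?_ ?_
  · have h := greenGraph_functional d.isOpen _ h2 (by simp)
    refine inclJ_injective _ ?_
    rw [map_zero, map_zero]
    exact (smul_eq_zero_iff_right hε).1 h
  · have h := greenGraph_functional d.isOpen _ (greenGraph_anti d.Ω (subset_univ _) h1) (by simp)
    refine inclJhat_injective _ ?_
    rw [map_zero, map_zero]
    exact (smul_eq_zero_iff_right hμ).1 h
  · simpa using derivGraph_functional d.C_pos d.δ_pos _ _ h3 (by simp)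
  · simpa using derivGraph_functional d.C_pos d.δ_pos _ _ h4 (by simp)

/-- By Green's formula, the contributions of the two curls cancel. -/
theorem principalGraph_dissipative : ∀ p ∈ d.principalGraph, (inner ℂ p.1 p.2).re ≤ 0 := by
  rintro ⟨U, V⟩ hp
  obtain ⟨h1, h2, h3, h4⟩ := d.mem_principalGraph.1 hp
  have e1 := inner_eq_inner_of_mem_greenGraph d.isOpen d.isBounded d.lipschitz h2 h1
  rw [inner_smul_left, inner_smul_right, inner_inclJ, inner_inclJhat, map_neg,
    Complex.conj_ofReal] at e1
  have e2 := derivGraph_re_nonneg d.C_pos d.δ_pos h3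
  have e3 := derivGraph_re_nonneg d.C_pos d.δ_pos h4
  simp only [inner_neg_right, Complex.neg_re] at e2 e3
  have e4 := congrArg Complex.re e1
  rw [← inner_conj_symm (d.pH V) (d.pH U)] at e4
  simp only [neg_mul, Complex.neg_re, Complex.re_ofReal_mul, Complex.conj_re] at e4
  rw [inner_hist]
  simp only [Complex.add_re, Complex.re_ofReal_mul]
  linarith

/-- The Maxwell components are found with coefficients `(ε l)⁻¹` and `(μ l)⁻¹`; the solution lies in
`J(Ω) × Ĵ(Ω)` because curls are divergence free. -/
theorem principalGraph_onto (l : ℝ) (hl : 0 < l) (Z : d.Hist) :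
    ∃ p ∈ d.principalGraph, (l : ℂ) • p.1 - p.2 = Z := by
  have hl' : (l : ℂ) ≠ 0 := Complex.ofReal_ne_zero.2 hl.ne'
  have hε : (d.ε : ℂ) ≠ 0 := Complex.ofReal_ne_zero.2 d.ε_pos.ne'
  have hμ : (d.μ : ℂ) ≠ 0 := Complex.ofReal_ne_zero.2 d.μ_pos.ne'
  obtain ⟨E, q, H, r, hE, hH, hEf, hHg⟩ := exists_maxwell_solution d.Ω
    (inv_pos.2 (mul_pos d.ε_pos hl)) (inv_pos.2 (mul_pos d.μ_pos hl))
    ((l : ℂ)⁻¹ • inclJ d.Ω (d.pE Z)) ((l : ℂ)⁻¹ • inclJhat d.Ω (d.pH Z))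
  obtain ⟨η, hη, hηZ⟩ := derivGraph_onto d.C_pos d.δ_pos hl (d.pηE Z)
  obtain ⟨ζ, hζ, hζZ⟩ := derivGraph_onto d.C_pos d.δ_pos hl (d.pηH Z)
  have hEJ : E ∈ J d.Ω := by
    rw [hEf]
    exact add_mem (Submodule.smul_mem _ _ (Subtype.property (d.pE Z)))
      (Submodule.smul_mem _ _ (snd_mem_orthGrad hH))
  have hHJ : H ∈ Jhat d.Ω := by
    rw [hHg]
    exact sub_mem (Submodule.smul_mem _ _ (Subtype.property (d.pH Z)))
      (Submodule.smul_mem _ _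
        ⟨snd_mem_orthGrad (greenGraph_anti d.Ω (subset_univ _) hE), snd_mem_orthGrad hE⟩)
  let U : d.Hist := ((⟨E, hEJ⟩, ⟨H, hHJ⟩, η.1, ζ.1) : d.Quad)
  have hUE : inclJ d.Ω (d.pE U) = E := rfl
  have hUH : inclJhat d.Ω (d.pH U) = H := rfl
  have hUη : d.pηE U = η.1 := rfl
  have hUζ : d.pηH U = ζ.1 := rfl
  refine ⟨(U, (l : ℂ) • U - Z), d.mem_principalGraph.2 ⟨?_, ?_, ?_, ?_⟩, sub_sub_cancel _ _⟩
  · rw [map_sub, map_sub, map_smul, map_smul, hUE, hUH]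
    convert hE using 2
    have e : (d.μ : ℂ) * (l * ((d.μ * l)⁻¹ : ℝ)) = 1 := by
      push_cast
      field_simp
    rw [hHg, smul_sub (l : ℂ), smul_inv_smul₀ hl', sub_sub_cancel_left, smul_neg, neg_smul,
      neg_neg, smul_smul, smul_smul, mul_assoc, e, one_smul]
  · rw [map_sub, map_sub, map_smul, map_smul, hUE, hUH]
    convert hH using 2
    have e : (d.ε : ℂ) * (l * ((d.ε * l)⁻¹ : ℝ)) = 1 := by
      push_cast
      field_simp
    rw [hEf, smul_add, smul_inv_smul₀ hl', add_sub_cancel_left, smul_smul, smul_smul,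
      mul_assoc, e, one_smul]
  · rw [map_sub, map_smul, hUη, ← hηZ, sub_add_cancel_left, neg_neg]
    exact hη
  · rw [map_sub, map_smul, hUζ, ← hζZ, sub_add_cancel_left, neg_neg]
    exact hζ

theorem principalGraph_mDissipative : MDissipative d.principalGraph :=
  ⟨d.principalGraph_functional, d.principalGraph_dissipative, d.principalGraph_onto⟩

/-- The part of `𝒜` of order zero: `(E, H, η_E, η_H)` is mapped to
`(ε⁻¹ (-ν_E(0) E + ∫ ν_E'' η_E), μ⁻¹ (-ν_H(0) H + ∫ ν_H'' η_H), E, H)`. -/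
def lowerOrder : d.Hist →ₗ[ℂ] d.Hist := d.assemble
  ((d.ε : ℂ)⁻¹ • (-((d.νE 0 : ℂ) • d.pE)
    + memory d.C_pos d.δ_pos d.νE_kernel (JSpace d.Ω) ∘ₗ d.pηE))
  ((d.μ : ℂ)⁻¹ • (-((d.νH 0 : ℂ) • d.pH)
    + memory d.C_pos d.δ_pos d.νH_kernel (JhatSpace d.Ω) ∘ₗ d.pηH))
  (d.constHist (JSpace d.Ω) ∘ₗ d.pE) (d.constHist (JhatSpace d.Ω) ∘ₗ d.pH)

theorem lowerOrder_continuous : Continuous d.lowerOrder := by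
  obtain ⟨M, hM⟩ := exists_norm_memory_le d.C_pos d.δ_pos d.νE_kernel (JSpace d.Ω)
  obtain ⟨N, hN⟩ := exists_norm_memory_le d.C_pos d.δ_pos d.νH_kernel (JhatSpace d.Ω)
  have hm := AddMonoidHomClass.continuous_of_bound _ M hM
  have hn := AddMonoidHomClass.continuous_of_bound _ N hN
  have hq : Continuous d.histEquivQuadL := d.histEquivQuadL.continuous
  have h1 : Continuous d.pE := continuous_fst.comp hq
  have h2 : Continuous d.pH := continuous_fst.comp (continuous_snd.comp hq)
  have h3 : Continuous d.pηE := continuous_fst.comp (continuous_snd.comp (continuous_snd.comp hq))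
  have h4 : Continuous d.pηH := continuous_snd.comp (continuous_snd.comp (continuous_snd.comp hq))
  have h5 : Continuous (d.constHist (JSpace d.Ω)) :=
    (Lp.constL 2 (histMeasure d.C d.δ) ℂ (E := JSpace d.Ω)).continuous
  have h6 : Continuous (d.constHist (JhatSpace d.Ω)) :=
    (Lp.constL 2 (histMeasure d.C d.δ) ℂ (E := JhatSpace d.Ω)).continuous
  refine d.histEquivQuadL.symm.continuous.comp (Continuous.prodMk ?_ (Continuous.prodMk ?_
    (Continuous.prodMk (h5.comp h1) (h6.comp h2))))
  · exact (((h1.const_smul _).neg).add (hm.comp h3)).const_smul _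
  · exact (((h2.const_smul _).neg).add (hn.comp h4)).const_smul _

/-- The part of order zero as a bounded operator. -/
def lowerOrderL : d.Hist →L[ℂ] d.Hist := ⟨d.lowerOrder, d.lowerOrder_continuous⟩

theorem pE_opA (U : d.opA.domain) : d.pE (d.opA U) = (d.ε : ℂ)⁻¹ • (-((d.νE 0 : ℂ) • d.pE U)
      + memory d.C_pos d.δ_pos d.νE_kernel (JSpace d.Ω) (d.pηE U) + d.curlH U) := rfl

theorem pH_opA (U : d.opA.domain) : d.pH (d.opA U) = (d.μ : ℂ)⁻¹ • (-((d.νH 0 : ℂ) • d.pH U)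
      + memory d.C_pos d.δ_pos d.νH_kernel (JhatSpace d.Ω) (d.pηH U) - d.curlE U) := rfl

theorem pηE_opA (U : d.opA.domain) :
    d.pηE (d.opA U) = -d.dsE U + d.constHist (JSpace d.Ω) (d.pE U) := rfl

theorem pηH_opA (U : d.opA.domain) :
    d.pηH (d.opA U) = -d.dsH U + d.constHist (JhatSpace d.Ω) (d.pH U) := rfl

theorem pE_lowerOrder (U : d.Hist) : d.pE (d.lowerOrder U) =
    (d.ε : ℂ)⁻¹ • (-((d.νE 0 : ℂ) • d.pE U)
      + memory d.C_pos d.δ_pos d.νE_kernel (JSpace d.Ω) (d.pηE U)) := rfl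

theorem pH_lowerOrder (U : d.Hist) : d.pH (d.lowerOrder U) =
    (d.μ : ℂ)⁻¹ • (-((d.νH 0 : ℂ) • d.pH U)
      + memory d.C_pos d.δ_pos d.νH_kernel (JhatSpace d.Ω) (d.pηH U)) := rfl

theorem pηE_lowerOrder (U : d.Hist) :
    d.pηE (d.lowerOrder U) = d.constHist (JSpace d.Ω) (d.pE U) := rfl

theorem pηH_lowerOrder (U : d.Hist) :
    d.pηH (d.lowerOrder U) = d.constHist (JhatSpace d.Ω) (d.pH U) := rfl

theorem sub_lowerOrder_mem_principalGraph (U : d.opA.domain) :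
    ((U : d.Hist), d.opA U - d.lowerOrder U) ∈ d.principalGraph := by
  have hε : (d.ε : ℂ) ≠ 0 := Complex.ofReal_ne_zero.2 d.ε_pos.ne'
  have hμ : (d.μ : ℂ) ≠ 0 := Complex.ofReal_ne_zero.2 d.μ_pos.ne'
  have e1 : d.pE (d.opA U - d.lowerOrder U) = (d.ε : ℂ)⁻¹ • d.curlH U := by
    rw [map_sub, pE_opA, pE_lowerOrder, ← smul_sub, add_sub_cancel_left]
  have e2 : d.pH (d.opA U - d.lowerOrder U) = -((d.μ : ℂ)⁻¹ • d.curlE U) := by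
    rw [map_sub, pH_opA, pH_lowerOrder, ← smul_sub, sub_sub_cancel_left, smul_neg]
  have e3 : d.pηE (d.opA U - d.lowerOrder U) = -d.dsE U := by
    rw [map_sub, pηE_opA, pηE_lowerOrder, add_sub_cancel_right]
  have e4 : d.pηH (d.opA U - d.lowerOrder U) = -d.dsH U := by
    rw [map_sub, pηH_opA, pηH_lowerOrder, add_sub_cancel_right]
  refine d.mem_principalGraph.2 ⟨?_, ?_, ?_, ?_⟩
  · rw [e2, map_neg, map_smul, smul_neg, neg_smul, neg_neg, smul_inv_smul₀ hμ]
    exact (mem_greenGraph_curlZeroTrace d.isOpen ⟨_, U.2.1.1.1⟩).2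
  · rw [e1, map_smul, smul_inv_smul₀ hε]
    exact mem_greenGraph_curl d.isOpen ⟨_, U.2.1.1.2⟩
  · rw [e3, neg_neg]
    exact mem_derivGraph_ds d.C_pos d.δ_pos _ ⟨_, U.2.1.2⟩
  · rw [e4, neg_neg]
    exact mem_derivGraph_ds d.C_pos d.δ_pos _ ⟨_, U.2.2⟩

theorem mem_domA_of_mem_principalGraph {U V : d.Hist} (h : (U, V) ∈ d.principalGraph) :
    U ∈ d.domA := by
  obtain ⟨h1, h2, h3, h4⟩ := d.mem_principalGraph.1 h
  exact ⟨⟨⟨⟨_, ⟨greenGraph_anti d.Ω (subset_univ _) h1, h1⟩, rfl⟩, ⟨_, h2, rfl⟩⟩, ⟨_, h3, rfl⟩⟩,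
    ⟨_, h4, rfl⟩⟩

theorem graph_opA : d.opA.graph = perturb d.principalGraph d.lowerOrderL := by
  ext ⟨U, V⟩
  rw [LinearPMap.mem_graph_iff, mem_perturb]
  constructor
  · rintro ⟨u, hu, hv⟩
    simp only at hu hv ⊢
    subst hu hv
    exact d.sub_lowerOrder_mem_principalGraph u
  · intro h
    have hU : U ∈ d.opA.domain := d.mem_domA_of_mem_principalGraph h
    -- both `𝒜 U` and `V` differ from the lower order term by the value of the principal part at `U`
    refine ⟨⟨U, hU⟩, rfl, ?_⟩
    have h1 := d.principalGraph.sub_mem (d.sub_lowerOrder_mem_principalGraph ⟨U, hU⟩) h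
    have h2 := d.principalGraph_functional _ h1 (sub_self U)
    have h3 : d.opA ⟨U, hU⟩ - d.lowerOrder U - (V - d.lowerOrder U) = 0 := h2
    rw [sub_sub_sub_cancel_right] at h3
    exact sub_eq_zero.1 h3

end Medium

end DispersiveMaxwell

end

theorem theorem2p1 (d : DispersiveMaxwell.Medium) :
    ∃ T : ℝ → d.Hist →L[ℂ] d.Hist,
      DispersiveMaxwell.IsC0Semigroup T ∧
      DispersiveMaxwell.Generates d.opA T ∧
      (∀ U₀ : d.Hist, DispersiveMaxwell.IsWeakSolution d.opA U₀ (fun t => T t U₀)) ∧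
      (∀ k : ℕ, 1 ≤ k → ∀ U₀ : d.Hist,
        (∃ W ∈ DispersiveMaxwell.powDomain d.opA k, W 0 = U₀) →
        DispersiveMaxwell.IsStrongSolution d.opA k U₀ (fun t => T t U₀)) := by
  obtain ⟨T, hT⟩ := DispersiveMaxwell.exists_isGeneratedBy d.principalGraph_mDissipative
    d.lowerOrderL d.graph_opA
  refine ⟨T, hT.semigroup, fun x y => hT.mem_iff (x, y),
    fun U₀ => hT.isWeakSolution (norm_nonneg _) U₀, ?_⟩
  rintro k hk U₀ ⟨W, hW, rfl⟩
  exact hT.isStrongSolution (norm_nonneg _) hk hW
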